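/- Let $n\ge 1$ and let $\Omega:\mathbb{R}^n\to\mathbb{C}$ be homogeneous of degree zero ($\Omega(\lambda x)=\Omega(x)$ for all $\lambda>0$, $x\in\mathbb{R}^n$), $C^\infty$ on the unit sphere $\mathbb{S}^{n-1}$, with $\int_{\mathbb{S}^{n-1}}\Omega\,d\sigma=0$, and not identically zero on $\mathbb{S}^{n-1}$. Let $K(x)=\Omega(x)/|x|^n$ and let $T$ be the Calderón–Zygmund operator $Tf(x)=\mathrm{p.v.}\int_{\mathbb{R}^n}K(x-y)f(y)\,dy=\lim_{\varepsilon\to0+}\int_{|x-y|>\varepsilon}K(x-y)f(y)\,dy$. For a locally integrable function $b:\mathbb{R}^n\to\mathbb{C}$ put $[b,T]f=b\,T(f)-T(bf)$. Let $Q(x,r)$ be the open cube with sides parallel to the axes, centre $x$ and side length $2r$. For $1\le q\le p<\infty$ let $M^p_q$ and $WM^p_q$ be the spaces of measurable functions $f:\mathbb{R}^n\to\mathbb{C}$ for which, respectively, $$\|f\|_{M^p_q}=\sup_{x\in\mathbb{R}^n,\,r>0}\frac{1}{|Q(x,r)|^{1/q-1/p}}\Big(\int_{Q(x,r)}|f(y)|^q\,dy\Big)^{1/q}<\infty,$$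 $$\|f\|_{WM^p_q}=\sup_{x\in\mathbb{R}^n,\,r>0}\frac{1}{|Q(x,r)|^{1/q-1/p}}\sup_{\lambda>0}\big(\lambda^q\,|\{y\in Q(x,r):|f(y)|>\lambda\}|\big)^{1/q}<\infty.$$ For $0<\alpha<1$, $b\in\mathrm{Lip}_\alpha$ means that, after modification on a set of measure zero, $\sup_{x\in\mathbb{R}^n,\,h\ne0}|b(x+h)-b(x)|/|h|^\alpha<\infty$. We say that $[b,T]$ is bounded from $X$ to $Y$ if for every $f\in X$ the principal values defining $Tf$ and $T(bf)$ exist almost everywhere (with absolutely convergent truncated integrals), $[b,T]f\in Y$, and $\|[b,T]f\|_Y\le C\|f\|_X$ with a constant $C$ independent of $f$. **Theorem.** Let $0<\alpha<1$, $1<q\le p<\infty$, $1<t\le s<\infty$, $1<l\le s<\infty$, $\frac1s=\frac1p-\frac{\alpha}{n}$, $\frac1t=\frac1q-\frac{\alpha}{n}$ and $\frac ls=\frac qp$. Then for every locally integrable $b$ the following statements are equivalent: 1. $b\in\mathrm{Lip}_\alpha$; 2. $[b,T]$ is bounded from $M^p_q$ to $M^s_l$; 3. $[b,T]$ is bounded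 from $M^p_q$ to $M^s_t$; 4. $[b,T]$ is bounded from $M^p_q$ to $WM^s_t$. -/

import Mathlib

open MeasureTheory Filter Topology
open scoped NNReal ENNReal ContDiff

noncomputable section

namespace MorreyCommutator

/-- `ℝⁿ` with the Euclidean norm and Lebesgue measure. -/
abbrev Rn (n : ℕ) : Type := EuclideanSpace ℝ (Fin n)

/-- Conditions on the angular part `Ω` of the kernel: homogeneous of degree zero, smooth, and of
mean zero on the unit sphere with respect to surface measure. For a function that is homogeneous of
degree zero, smoothness on the sphere is the same as smoothness on `ℝⁿ ∖ {0}`. -/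
structure IsAngular {n : ℕ} (Ω : Rn n → ℂ) : Prop where
  homogeneous : ∀ (c : ℝ) (x : Rn n), 0 < c → Ω (c • x) = Ω x
  smooth : ContDiffOn ℝ ∞ Ω {0}ᶜ
  mean_zero : ∫ θ : Metric.sphere (0 : Rn n) 1, Ω (θ : Rn n)
    ∂((volume : Measure (Rn n)).toSphere) = 0

/-- The convolution kernel `K(x) = Ω(x) / |x|ⁿ`. -/
def kernel {n : ℕ} (Ω : Rn n → ℂ) (x : Rn n) : ℂ :=
  Ω x / ((‖x‖ ^ n : ℝ) : ℂ)

/-- The truncated singular integral `∫_{|x - y| > ε} K(x - y) f(y) dy`. -/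
def truncated {n : ℕ} (Ω : Rn n → ℂ) (ε : ℝ) (f : Rn n → ℂ) (x : Rn n) : ℂ :=
  ∫ y in {y : Rn n | ε < ‖x - y‖}, kernel Ω (x - y) * f y

/-- The principal value integral defining `T f (x)` exists: all truncated integrals converge
absolutely and they have a limit as `ε → 0+`. -/
def PVExists {n : ℕ} (Ω : Rn n → ℂ) (f : Rn n → ℂ) (x : Rn n) : Prop :=
  (∀ ε : ℝ, 0 < ε →
    IntegrableOn (fun y : Rn n => kernel Ω (x - y) * f y) {y : Rn n | ε < ‖x - y‖} volume) ∧
  ∃ v : ℂ, Tendsto (fun ε : ℝ => truncated Ω ε f x) (𝓝[>] 0) (𝓝 v)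

/-- `T f (x) = p.v. ∫ K(x - y) f(y) dy`, meaningful where `PVExists Ω f x` holds. -/
def singularIntegral {n : ℕ} (Ω : Rn n → ℂ) (f : Rn n → ℂ) (x : Rn n) : ℂ :=
  limUnder (𝓝[>] (0 : ℝ)) (fun ε : ℝ => truncated Ω ε f x)

/-- The commutator `[b, T] f = b T(f) - T(b f)`. -/
def commutator {n : ℕ} (Ω : Rn n → ℂ) (b f : Rn n → ℂ) (x : Rn n) : ℂ :=
  b x * singularIntegral Ω f x - singularIntegral Ω (fun y => b y * f y) x

/-- The open cube with centre `x` and side length `2 r`, with sides parallel to the axes. -/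
def cube {n : ℕ} (x : Rn n) (r : ℝ) : Set (Rn n) :=
  {y : Rn n | ∀ i : Fin n, |y i - x i| < r}

/-- The norm of the Morrey space `M^p_q`, with values in `[0, ∞]`. -/
def morreyNorm {n : ℕ} (p q : ℝ) (f : Rn n → ℂ) : ℝ≥0∞ :=
  ⨆ (x : Rn n) (r : ℝ) (_ : 0 < r),
    (volume (cube x r) ^ (1 / q - 1 / p))⁻¹ * (∫⁻ y in cube x r, ‖f y‖ₑ ^ q) ^ (1 / q)

/-- The quasi-norm of the weak Morrey space `WM^p_q`, with values in `[0, ∞]`. -/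
def weakMorreyNorm {n : ℕ} (p q : ℝ) (f : Rn n → ℂ) : ℝ≥0∞ :=
  ⨆ (x : Rn n) (r : ℝ) (_ : 0 < r),
    (volume (cube x r) ^ (1 / q - 1 / p))⁻¹ *
      ⨆ (c : ℝ≥0) (_ : 0 < c),
        ((c : ℝ≥0∞) ^ q * volume {y : Rn n | y ∈ cube x r ∧ (c : ℝ≥0∞) < ‖f y‖ₑ}) ^ (1 / q)

/-- Membership in the space of measurable functions with finite `N`, where `N` is one of the
(quasi-)norms above. -/
def MemSpace {n : ℕ} (N : (Rn n → ℂ) → ℝ≥0∞) (f : Rn n → ℂ) : Prop :=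
  AEStronglyMeasurable f volume ∧ N f < ⊤

/-- `[b, T]` is a bounded operator from the space with norm `N₁` to the space with (quasi-)norm
`N₂`: for every `f` in the first space, `T f` and `T (b f)` are defined almost everywhere,
`[b, T] f` belongs to the second space, and `N₂ ([b, T] f) ≤ C N₁ f` with `C` independent of
`f`. -/
def CommutatorBounded {n : ℕ} (Ω : Rn n → ℂ) (b : Rn n → ℂ)
    (N₁ N₂ : (Rn n → ℂ) → ℝ≥0∞) : Prop :=
  ∃ C : ℝ≥0, ∀ f : Rn n → ℂ, MemSpace N₁ f →
    (∀ᵐ x ∂(volume : Measure (Rn n)), PVExists Ω f x) ∧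
    (∀ᵐ x ∂(volume : Measure (Rn n)), PVExists Ω (fun y => b y * f y) x) ∧
    MemSpace N₂ (commutator Ω b f) ∧
    N₂ (commutator Ω b f) ≤ C * N₁ f

/-- `b ∈ Lip_α`, for `b` determined up to null sets: after a modification on a null set,
`|b(x + h) - b(x)| / |h|^α` is bounded over all `x` and all `h ≠ 0`. -/
def MemLip {n : ℕ} (α : ℝ) (b : Rn n → ℂ) : Prop :=
  ∃ g : Rn n → ℂ, b =ᵐ[volume] g ∧
    ∃ C : ℝ, ∀ x h : Rn n, h ≠ 0 → ‖g (x + h) - g x‖ / ‖h‖ ^ α ≤ C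

end MorreyCommutator

end

/-! Sufficiency (1 → 2). When `b` is Hölder, the factor `b x - b y` improves the kernel of the
commutator to size `|x - y|^(α - n)`, so `|[b,T]f|` is dominated by the fractional integral of `|f|`
(`pvExists_mul_and_enorm_commutator_le`). What remains is Adams' theorem on Morrey spaces. Splitting
the fractional integral at the best radius gives Hedberg's inequality `I_α F ≤ C N^(αp/n) (M F)^(1 -
αp/n)`, where `N` measures `F` in the Morrey scale and `M` is the maximal operator
(`exists_riesz_le`). Since `1 - αp/n = p/s` and `l p/s = q`, the Morrey estimate for `M`
(`exists_lintegral_maximal_rpow_le`) yields the target norm (`exists_morreyNorm_le_of_riesz`).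

Boundedness also requires the principal values to exist almost everywhere. Far from `x` the
integrals converge absolutely because the fractional integral is finite, so the question is local
and concerns integrable functions. Let `S_ε` be the smoothly truncated kernel. For bounded
integrable `h`, the differences `S_{2^{-N}} - S_1` telescope into dilates of one smooth mean-zero
bump; their Fourier transforms are uniformly bounded and converge, so Plancherel gives a weak limit
`G` in `L²` of `(S_{2^{-N}} - S_1) * h` (`exists_weak_limit_of_dilates`). Comparing `S_ε` with an
average at scale `ε` of the finer kernels leaves an error kernel dominated by an `L¹`-normalised
dilate of an integrable profile, with constant integral. Hence `S_ε * h` converges at common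
Lebesgue points of `h` and `G` (`IsAngular.ae_exists_tendsto_integral_smoothKernel_of_bounded`). A
general integrable `f` is handled on the closed sets where its averages are at most `k`: off such a
set its mass is spread over Whitney balls, giving a bounded function, and the error is controlled by
a Marcinkiewicz integral (`IsAngular.ae_exists_tendsto_integral_smoothKernel`). Passing from smooth
to sharp truncation costs one more Lebesgue point argument.

The steps 2 → 3 → 4 are Hölder's inequality, after checking `t ≤ l`, and Chebyshev's inequality.

Necessity (4 → 1). Fix a direction `e` with `Ω e ≠ 0`. For `x` in a ball `B` and `y` in the ball
`B'` of the same radius displaced by a large multiple of `-e`, the kernel is nearly a nonzero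
constant. Testing the commutator on the indicator of `B'` and on a suitable phase supported in `B'`
controls two kernel-weighted oscillation integrals. Replacing the kernel by the constant creates an
error proportional to the double oscillation of `b` over `B × B'`, which is absorbed because the
proportion is small (`integral_norm_sub_le_of_kernel_of_swap`). Thus the integral oscillation of `b`
on every ball of radius `r` is `O(r^(n + α))` (`exists_oscillation_le`), and Campanato's
characterisation gives Hölder continuity (`memLip_of_oscillation_le`). -/

noncomputable section

namespace MorreyCommutator

variable {n : ℕ} {Ω : Rn n → ℂ}

/-! ### Size, regularity and cancellation of the kernel -/

namespace IsAngular

theorem exists_norm_le (hΩ : IsAngular Ω) : ∃ C : ℝ, 0 ≤ C ∧ ∀ x : Rn n, x ≠ 0 → ‖Ω x‖ ≤ C := by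
  have hc : ContinuousOn Ω (Metric.sphere (0 : Rn n) 1) :=
    hΩ.smooth.continuousOn.mono fun x hx => by
      rw [Set.mem_compl_singleton_iff]; rintro rfl; simp at hx
  obtain ⟨C, hC⟩ := (isCompact_sphere (0 : Rn n) 1).exists_bound_of_continuousOn hc
  refine ⟨max C 0, le_max_right _ _, fun x hx => ?_⟩
  have h := hC (‖x‖⁻¹ • x) (by simp [norm_smul, hx])
  rw [hΩ.homogeneous _ _ (by positivity)] at h
  exact h.trans (le_max_left _ _)

theorem exists_norm_kernel_le (hΩ : IsAngular Ω) (hn : 1 ≤ n) :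
    ∃ C : ℝ, 0 ≤ C ∧ ∀ x : Rn n, ‖kernel Ω x‖ ≤ C / ‖x‖ ^ n := by
  obtain ⟨C, hC0, hC⟩ := hΩ.exists_norm_le
  refine ⟨C, hC0, fun x => ?_⟩
  rcases eq_or_ne x 0 with rfl | hx
  -- At the origin both sides are divisions by `0 ^ n`, which are zero only because `n ≠ 0`.
  · have : n ≠ 0 := by omega
    simp [kernel, this]
  · rw [kernel, norm_div, Complex.norm_real, Real.norm_of_nonneg (by positivity)]
    gcongr
    exact hC x hx

theorem kernel_smul (hΩ : IsAngular Ω) {c : ℝ} (hc : 0 < c) (x : Rn n) :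
    kernel Ω (c • x) = ((c ^ n : ℝ) : ℂ)⁻¹ * kernel Ω x := by
  rw [kernel, kernel, hΩ.homogeneous _ _ hc, norm_smul, Real.norm_of_nonneg hc.le, mul_pow,
    Complex.ofReal_mul]
  field_simp

theorem contDiffOn_kernel (hΩ : IsAngular Ω) : ContDiffOn ℝ ∞ (kernel Ω) {0}ᶜ := by
  have h : ContDiffOn ℝ ∞ (fun x : Rn n => ‖x‖ ^ n) {0}ᶜ :=
    (contDiffOn_id.norm ℝ (fun x hx => hx)).pow n
  have h' : ContDiffOn ℝ ∞ (fun x : Rn n => ((‖x‖ ^ n : ℝ) : ℂ)) {0}ᶜ :=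
    Complex.ofRealCLM.contDiff.comp_contDiffOn h
  have e : kernel Ω = fun x => Ω x * ((‖x‖ ^ n : ℝ) : ℂ)⁻¹ := funext fun x => div_eq_mul_inv _ _
  rw [e]
  refine hΩ.smooth.mul (h'.inv fun x hx => ?_)
  have : x ≠ 0 := hx
  simp [this]

/-- By homogeneity it suffices to take `‖u‖ = 1`. Then the ball of radius `1/2` about `u` lies in a
compact annulus away from the origin, where the derivative is bounded, and the mean value inequality
applies. -/
theorem exists_norm_kernel_sub_le (hΩ : IsAngular Ω) :
    ∃ C : ℝ, 0 ≤ C ∧ ∀ u v : Rn n, ‖u - v‖ ≤ ‖u‖ / 2 →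
      ‖kernel Ω u - kernel Ω v‖ ≤ C * ‖u - v‖ / ‖u‖ ^ (n + 1) := by
  have hopen : IsOpen ({0}ᶜ : Set (Rn n)) := isOpen_compl_singleton
  have hcd := hΩ.contDiffOn_kernel.continuousOn_fderiv_of_isOpen hopen (by simp)
  have hK : IsCompact (Metric.closedBall (0 : Rn n) 2 ∩ {x | 1 / 2 ≤ ‖x‖}) :=
    (isCompact_closedBall _ _).inter_right (isClosed_le continuous_const continuous_norm)
  obtain ⟨C, hC⟩ := hK.exists_bound_of_continuousOn (hcd.mono fun x hx => by
    rw [Set.mem_compl_singleton_iff]; rintro rfl; have := hx.2; norm_num at this)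
  have key : ∀ u v : Rn n, ‖u‖ = 1 → ‖u - v‖ ≤ 1 / 2 →
      ‖kernel Ω u - kernel Ω v‖ ≤ max C 0 * ‖u - v‖ := by
    intro u v hu huv
    have hsub : ∀ x ∈ Metric.closedBall u (1 / 2),
        x ∈ Metric.closedBall (0 : Rn n) 2 ∩ {x | 1 / 2 ≤ ‖x‖} := by
      intro x hx
      rw [mem_closedBall_iff_norm] at hx
      have h1 := norm_sub_norm_le u x
      have h2 := norm_sub_norm_le x u
      rw [norm_sub_rev] at h1
      refine ⟨mem_closedBall_zero_iff.2 (by linarith), ?_⟩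
      change 1 / 2 ≤ ‖x‖
      linarith
    refine (convex_closedBall u (1 / 2)).norm_image_sub_le_of_norm_fderiv_le (𝕜 := ℝ)
      (f := kernel Ω) (fun x hx => ?_) (fun x hx => (hC x (hsub x hx)).trans (le_max_left _ _))
      (by rw [mem_closedBall_iff_norm, norm_sub_rev]; exact huv) (by simp)
    have hx0 : x ∈ ({0}ᶜ : Set (Rn n)) := by
      rw [Set.mem_compl_singleton_iff]; rintro rfl
      have := (hsub _ hx).2; norm_num at this
    exact (hΩ.contDiffOn_kernel.contDiffAt (hopen.mem_nhds hx0)).differentiableAt (by simp)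
  refine ⟨max C 0, le_max_right _ _, fun u v huv => ?_⟩
  rcases eq_or_ne u 0 with rfl | hu
  · have : v = 0 := by simpa using huv
    simp [this]
  have hu' : 0 < ‖u‖ := norm_pos_iff.2 hu
  have e1 : ‖‖u‖⁻¹ • u - ‖u‖⁻¹ • v‖ = ‖u - v‖ / ‖u‖ := by
    rw [← smul_sub, norm_smul, norm_inv, norm_norm]; ring
  have h := key (‖u‖⁻¹ • u) (‖u‖⁻¹ • v) (by simp [norm_smul, hu]) (by
    rw [e1, div_le_iff₀ hu']; linarith)
  rw [hΩ.kernel_smul (by positivity), hΩ.kernel_smul (by positivity), ← mul_sub, norm_mul,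
    norm_inv, Complex.norm_real, e1, Real.norm_of_nonneg (by positivity), inv_pow, inv_inv] at h
  rw [le_div_iff₀ (by positivity), pow_succ]
  calc ‖kernel Ω u - kernel Ω v‖ * (‖u‖ ^ n * ‖u‖)
      = (‖u‖ ^ n * ‖kernel Ω u - kernel Ω v‖) * ‖u‖ := by ring
    _ ≤ (max C 0 * (‖u - v‖ / ‖u‖)) * ‖u‖ := by gcongr
    _ = _ := by field_simp

theorem measurable_kernel (hΩ : IsAngular Ω) : Measurable (kernel Ω) := by
  classical
  have h : kernel Ω = ({0}ᶜ : Set (Rn n)).piecewise (kernel Ω) (fun _ => kernel Ω 0) := by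
    ext x
    by_cases hx : x = 0 <;> simp [Set.piecewise, hx]
  rw [h]
  exact hΩ.contDiffOn_kernel.continuousOn.measurable_piecewise continuousOn_const
    (measurableSet_singleton _).compl

/-- In polar coordinates the integral factors, and the spherical factor is the mean of `Ω`. No
integrability is needed, since the product formula for the Bochner integral is unconditional. This
is the only source of cancellation in the proof. -/
theorem integral_kernel_mul_comp_norm (hΩ : IsAngular Ω) (hn : 1 ≤ n) (g : ℝ → ℂ) :
    ∫ x : Rn n, kernel Ω x * g ‖x‖ = 0 := by
  have : Nonempty (Fin n) := ⟨⟨0, hn⟩⟩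
  have hnt : Nontrivial (Rn n) := inferInstance
  calc ∫ x : Rn n, kernel Ω x * g ‖x‖
      = ∫ x : ({(0 : Rn n)}ᶜ : Set (Rn n)), kernel Ω x.1 * g ‖x.1‖
          ∂((volume : Measure (Rn n)).comap (↑)) := by
        rw [integral_subtype_comap (measurableSet_singleton _).compl
          fun x : Rn n => kernel Ω x * g ‖x‖, restrict_compl_singleton]
    _ = ∫ z : Metric.sphere (0 : Rn n) 1 × Set.Ioi (0 : ℝ),
          Ω z.1 * (((z.2 : ℝ) ^ n : ℝ) : ℂ)⁻¹ * g z.2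
          ∂((volume : Measure (Rn n)).toSphere.prod
            (.volumeIoiPow (Module.finrank ℝ (Rn n) - 1))) := by
        rw [← (volume : Measure (Rn n)).measurePreserving_homeomorphUnitSphereProd.integral_comp
          (Homeomorph.measurableEmbedding _)]
        refine integral_congr_ae (.of_forall fun x => ?_)
        have hx : (0 : ℝ) < ‖(x : Rn n)‖ := norm_pos_iff.2 x.2
        simp only [homeomorphUnitSphereProd_apply_fst_coe, homeomorphUnitSphereProd_apply_snd_coe]
        rw [hΩ.homogeneous _ _ (inv_pos.2 hx), kernel, div_eq_mul_inv]
    _ = 0 := by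
        simp_rw [mul_assoc]
        rw [integral_prod_mul (fun z : Metric.sphere (0 : Rn n) 1 => Ω z)
          (fun r : Set.Ioi (0 : ℝ) => (((r : ℝ) ^ n : ℝ) : ℂ)⁻¹ * g r), hΩ.mean_zero, zero_mul]

end IsAngular

/-! ### Smooth truncations of the kernel -/

/-- A smooth radial function vanishing on the unit ball and equal to one off the ball of
radius two. -/
def cutoff (x : Rn n) : ℝ := Real.smoothTransition ((‖x‖ ^ 2 - 1) / 3)

theorem contDiff_cutoff : ContDiff ℝ ∞ (cutoff : Rn n → ℝ) :=
  Real.smoothTransition.contDiff.comp (((contDiff_norm_sq ℝ).sub contDiff_const).div_const _)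

theorem cutoff_nonneg (x : Rn n) : 0 ≤ cutoff x := Real.smoothTransition.nonneg _

theorem cutoff_le_one (x : Rn n) : cutoff x ≤ 1 := Real.smoothTransition.le_one _

theorem cutoff_eq_zero {x : Rn n} (hx : ‖x‖ ≤ 1) : cutoff x = 0 :=
  Real.smoothTransition.zero_of_nonpos (by nlinarith [norm_nonneg x])

theorem cutoff_eq_one {x : Rn n} (hx : 2 ≤ ‖x‖) : cutoff x = 1 :=
  Real.smoothTransition.one_of_one_le (by nlinarith [norm_nonneg x])

theorem exists_cutoff_lipschitz :
    ∃ C : ℝ, 0 ≤ C ∧ ∀ u v : Rn n, |cutoff u - cutoff v| ≤ C * ‖u - v‖ := by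
  have hcs : HasCompactSupport (fun x : Rn n => 1 - cutoff x) :=
    HasCompactSupport.of_support_subset_isCompact (isCompact_closedBall (0 : Rn n) 2) fun x hx => by
      by_contra hx'
      rw [mem_closedBall_zero_iff, not_le] at hx'
      exact hx (by simp [cutoff_eq_one hx'.le])
  obtain ⟨C, hC⟩ := ContDiff.lipschitzWith_of_hasCompactSupport hcs
    (contDiff_const.sub contDiff_cutoff) (by simp : (∞ : WithTop ℕ∞) ≠ 0)
  refine ⟨C, C.2, fun u v => ?_⟩
  have := hC.dist_le_mul u v
  rwa [dist_eq_norm, dist_eq_norm, Real.norm_eq_abs, sub_sub_sub_cancel_left, abs_sub_comm] at this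

/-- The constant is independent of the scale `c`: once `c ‖u‖ ≥ 4` both values are one, and
otherwise the Lipschitz factor `c` is at most `4 / ‖u‖`. -/
theorem exists_cutoff_smul_sub_le :
    ∃ C : ℝ, 0 ≤ C ∧ ∀ (c : ℝ) (u v : Rn n), 0 < c → ‖u - v‖ ≤ ‖u‖ / 2 →
      |cutoff (c • u) - cutoff (c • v)| ≤ C * ‖u - v‖ / ‖u‖ := by
  obtain ⟨C, hC0, hC⟩ := exists_cutoff_lipschitz (n := n)
  refine ⟨4 * C, by positivity, fun c u v hc huv => ?_⟩
  rcases eq_or_ne u 0 with rfl | hu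
  · have : v = 0 := by simpa using huv
    simp [this]
  have hu' : 0 < ‖u‖ := norm_pos_iff.2 hu
  rcases le_total 4 (c * ‖u‖) with h | h
  · have h1 : 2 ≤ ‖c • u‖ := by rw [norm_smul, Real.norm_of_nonneg hc.le]; linarith
    have h2 : 2 ≤ ‖c • v‖ := by
      rw [norm_smul, Real.norm_of_nonneg hc.le]
      have : ‖u‖ / 2 ≤ ‖v‖ := by linarith [norm_sub_norm_le u v]
      nlinarith
    rw [cutoff_eq_one h1, cutoff_eq_one h2, sub_self, abs_zero]
    positivity
  · refine (hC _ _).trans ?_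
    rw [← smul_sub, norm_smul, Real.norm_of_nonneg hc.le, le_div_iff₀ hu']
    calc C * (c * ‖u - v‖) * ‖u‖ = C * ‖u - v‖ * (c * ‖u‖) := by ring
      _ ≤ C * ‖u - v‖ * 4 := by gcongr
      _ = _ := by ring

/-- The kernel smoothly truncated at scale `ε`. -/
def smoothKernel (Ω : Rn n → ℂ) (ε : ℝ) (x : Rn n) : ℂ := (cutoff (ε⁻¹ • x) : ℂ) * kernel Ω x

theorem norm_smoothKernel_le (ε : ℝ) (x : Rn n) : ‖smoothKernel Ω ε x‖ ≤ ‖kernel Ω x‖ := by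
  rw [smoothKernel, norm_mul, Complex.norm_real, Real.norm_of_nonneg (cutoff_nonneg _)]
  exact mul_le_of_le_one_left (norm_nonneg _) (cutoff_le_one _)

theorem smoothKernel_eq_zero {ε : ℝ} (hε : 0 < ε) {x : Rn n} (hx : ‖x‖ ≤ ε) :
    smoothKernel Ω ε x = 0 := by
  rw [smoothKernel, cutoff_eq_zero, Complex.ofReal_zero, zero_mul]
  rw [norm_smul, norm_inv, Real.norm_of_nonneg hε.le]
  exact inv_mul_le_one_of_le₀ hx hε.le

theorem smoothKernel_eq_kernel {ε : ℝ} (hε : 0 < ε) {x : Rn n} (hx : 2 * ε ≤ ‖x‖) :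
    smoothKernel Ω ε x = kernel Ω x := by
  rw [smoothKernel, cutoff_eq_one, Complex.ofReal_one, one_mul]
  rw [norm_smul, norm_inv, Real.norm_of_nonneg hε.le]
  rw [inv_mul_eq_div, le_div_iff₀ hε]
  exact hx

namespace IsAngular

/-- The truncated kernels are standard kernels uniformly in `ε`; every later limit `ε → 0` relies on
this uniformity. -/
theorem exists_norm_smoothKernel_sub_le (hΩ : IsAngular Ω) (hn : 1 ≤ n) :
    ∃ C : ℝ, 0 ≤ C ∧ ∀ (ε : ℝ) (u v : Rn n), 0 < ε → ‖u - v‖ ≤ ‖u‖ / 2 →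
      ‖smoothKernel Ω ε u - smoothKernel Ω ε v‖ ≤ C * ‖u - v‖ / ‖u‖ ^ (n + 1) := by
  obtain ⟨C₁, h₁, hC₁⟩ := hΩ.exists_norm_kernel_le hn
  obtain ⟨C₂, h₂, hC₂⟩ := hΩ.exists_norm_kernel_sub_le
  obtain ⟨C₃, h₃, hC₃⟩ := exists_cutoff_smul_sub_le (n := n)
  refine ⟨C₃ * C₁ + C₂, by positivity, fun ε u v hε huv => ?_⟩
  have e : smoothKernel Ω ε u - smoothKernel Ω ε v =
      ((cutoff (ε⁻¹ • u) - cutoff (ε⁻¹ • v) : ℝ) : ℂ) * kernel Ω u +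
        (cutoff (ε⁻¹ • v) : ℂ) * (kernel Ω u - kernel Ω v) := by
    simp only [smoothKernel]; push_cast; ring
  rw [e]
  refine (norm_add_le _ _).trans ?_
  rw [norm_mul, norm_mul, Complex.norm_real, Complex.norm_real, Real.norm_eq_abs,
    Real.norm_of_nonneg (cutoff_nonneg _)]
  have a1 := hC₃ ε⁻¹ u v (by positivity) huv
  have a2 := hC₁ u
  have a3 := hC₂ u v huv
  calc |cutoff (ε⁻¹ • u) - cutoff (ε⁻¹ • v)| * ‖kernel Ω u‖ +
        cutoff (ε⁻¹ • v) * ‖kernel Ω u - kernel Ω v‖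
      ≤ (C₃ * ‖u - v‖ / ‖u‖) * (C₁ / ‖u‖ ^ n) + 1 * (C₂ * ‖u - v‖ / ‖u‖ ^ (n + 1)) := by
        gcongr
        exact cutoff_le_one _
    _ = _ := by
        rw [div_mul_div_comm, pow_succ, one_mul, mul_comm ‖u‖ (‖u‖ ^ n), ← add_div]; ring

theorem smoothKernel_eq_smul (hΩ : IsAngular Ω) {ε c : ℝ} (hc : 0 < c) (x : Rn n) :
    smoothKernel Ω (c * ε) (c • x) = ((c ^ n : ℝ) : ℂ)⁻¹ * smoothKernel Ω ε x := by
  rw [smoothKernel, smoothKernel, hΩ.kernel_smul hc, smul_smul, mul_inv_rev, mul_assoc,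
    inv_mul_cancel₀ hc.ne', mul_one]
  ring

theorem contDiff_smoothKernel (hΩ : IsAngular Ω) {ε : ℝ} (hε : 0 < ε) :
    ContDiff ℝ ∞ (smoothKernel Ω ε) := by
  rw [contDiff_iff_contDiffAt]
  intro x
  rcases eq_or_ne x 0 with rfl | hx
  · have : smoothKernel Ω ε =ᶠ[𝓝 0] fun _ => 0 := by
      filter_upwards [Metric.closedBall_mem_nhds (0 : Rn n) hε] with y hy
      exact smoothKernel_eq_zero hε (mem_closedBall_zero_iff.1 hy)
    exact contDiffAt_const.congr_of_eventuallyEq this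
  · refine ContDiffAt.mul ?_ (hΩ.contDiffOn_kernel.contDiffAt
      (isOpen_compl_singleton.mem_nhds hx))
    exact Complex.ofRealCLM.contDiff.contDiffAt.comp x
      ((contDiff_cutoff.comp (contDiff_const_smul _)).contDiffAt)

theorem exists_norm_smoothKernel_le (hΩ : IsAngular Ω) (hn : 1 ≤ n) :
    ∃ C : ℝ, 0 ≤ C ∧ ∀ (ε : ℝ) (x : Rn n), 0 < ε → ‖smoothKernel Ω ε x‖ ≤ C / ε ^ n := by
  obtain ⟨C, h, hC⟩ := hΩ.exists_norm_kernel_le hn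
  refine ⟨C, h, fun ε x hε => ?_⟩
  rcases le_total ‖x‖ ε with hx | hx
  · rw [smoothKernel_eq_zero hε hx, norm_zero]; positivity
  · refine (norm_smoothKernel_le _ _).trans ((hC x).trans ?_)
    gcongr

end IsAngular

/-! ### Volumes of cubes and balls -/

theorem volume_cube (x : Rn n) {r : ℝ} (hr : 0 ≤ r) :
    volume (cube x r) = ENNReal.ofReal ((2 * r) ^ n) := by
  have h := (PiLp.volume_preserving_ofLp (Fin n)).measure_preimage
    (s := Set.univ.pi fun i => Metric.ball (x i) r)
    (MeasurableSet.univ_pi fun i => measurableSet_ball).nullMeasurableSet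
  have e : (WithLp.ofLp (p := 2)) ⁻¹' (Set.univ.pi fun i => Metric.ball (x i) r) = cube x r := by
    ext y
    simp [cube, Set.mem_pi, Real.dist_eq]
  rw [e] at h
  rw [h, volume_pi_pi]
  simp [Real.volume_ball, ENNReal.ofReal_pow (by positivity : 0 ≤ 2 * r)]

theorem isOpen_cube (x : Rn n) (r : ℝ) : IsOpen (cube x r) := by
  have : cube x r = ⋂ i, {y : Rn n | |y i - x i| < r} := by ext; simp [cube]
  rw [this]
  exact isOpen_iInter_of_finite fun i => isOpen_lt (by fun_prop) continuous_const

theorem measurableSet_cube (x : Rn n) (r : ℝ) : MeasurableSet (cube x r) :=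
  (isOpen_cube x r).measurableSet

theorem ball_subset_cube (x : Rn n) (r : ℝ) : Metric.ball x r ⊆ cube x r := fun y hy i => by
  rw [mem_ball_iff_norm] at hy
  have := PiLp.norm_apply_le (y - x) i
  rw [PiLp.sub_apply, Real.norm_eq_abs] at this
  exact this.trans_lt hy

theorem cube_subset_closedBall (x : Rn n) {r : ℝ} (hr : 0 ≤ r) :
    cube x r ⊆ Metric.closedBall x (n * r) := fun y hy => by
  rw [mem_closedBall_iff_norm, EuclideanSpace.norm_eq]
  rcases Nat.eq_zero_or_pos n with rfl | hn
  · simp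
  refine Real.sqrt_le_iff.2 ⟨by positivity, ?_⟩
  calc ∑ i, ‖(y - x) i‖ ^ 2 ≤ ∑ i : Fin n, r ^ 2 := by
        gcongr with i
        exact (hy i).le
    _ = n * r ^ 2 := by simp
    _ ≤ (n * r) ^ 2 := by
        rw [mul_pow]
        have : (1 : ℝ) ≤ n := by exact_mod_cast hn
        gcongr
        nlinarith

/-- The volume of the unit ball. -/
def unitBallVolume (n : ℕ) : ℝ := (volume (Metric.ball (0 : Rn n) 1)).toReal

theorem unitBallVolume_pos : 0 < unitBallVolume n :=
  ENNReal.toReal_pos (Metric.measure_ball_pos _ _ one_pos).ne' measure_ball_lt_top.ne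

theorem volume_closedBall (x : Rn n) {r : ℝ} (hr : 0 ≤ r) :
    volume (Metric.closedBall x r) = ENNReal.ofReal (unitBallVolume n * r ^ n) := by
  rw [Measure.addHaar_closedBall _ _ hr, mul_comm,
    ENNReal.ofReal_mul unitBallVolume_pos.le, unitBallVolume,
    ENNReal.ofReal_toReal measure_ball_lt_top.ne]
  simp

theorem volume_ball (x : Rn n) {r : ℝ} (hr : 0 < r) :
    volume (Metric.ball x r) = ENNReal.ofReal (unitBallVolume n * r ^ n) := by
  rw [Measure.addHaar_ball_of_pos _ _ hr, mul_comm,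
    ENNReal.ofReal_mul unitBallVolume_pos.le, unitBallVolume,
    ENNReal.ofReal_toReal measure_ball_lt_top.ne]
  simp

/-! ### Weak-type control of integrals and Morrey norms of test functions -/

theorem lintegral_enorm_le_of_weak {β : Type*} [MeasurableSpace β] {μ : Measure β} {F : β → ℂ}
    (hF : AEStronglyMeasurable F μ) {V L t : ℝ} (hV : 0 < V) (hμ : μ Set.univ ≤ ENNReal.ofReal V)
    (hL : 0 < L) (ht : 1 < t)
    (h : ∀ c : ℝ, 0 < c → μ {y | c < ‖F y‖} ≤ ENNReal.ofReal ((L / c) ^ t)) :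
    ∫⁻ y, ‖F y‖ₑ ∂μ ≤ ENNReal.ofReal (t / (t - 1) * L * V ^ (1 - 1 / t)) := by
  have ht0 : 0 < t := by linarith
  -- The height at which the trivial bound `V` and the weak-type bound `(L / c) ^ t` for the
  -- distribution function agree; the layer-cake integral is split there.
  set c₀ := L / V ^ (1 / t) with hc₀
  have hc₀pos : 0 < c₀ := by positivity
  have e : ∫⁻ y, ‖F y‖ₑ ∂μ = ∫⁻ c in Set.Ioi (0 : ℝ), μ {y | c < ‖F y‖} := by
    rw [← lintegral_eq_lintegral_meas_lt μ (.of_forall fun _ => norm_nonneg _) hF.norm.aemeasurable]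
    simp
  have hint : IntegrableOn (fun c : ℝ => L ^ t * c ^ (-t)) (Set.Ioi c₀) :=
    (integrableOn_Ioi_rpow_of_lt (by linarith) hc₀pos).const_mul _
  have e2 : ∫⁻ c in Set.Ioi c₀, ENNReal.ofReal ((L / c) ^ t) =
      ENNReal.ofReal (L ^ t * (c₀ ^ (1 - t) / (t - 1))) := by
    have : ∀ c ∈ Set.Ioi c₀, ENNReal.ofReal ((L / c) ^ t) = ENNReal.ofReal (L ^ t * c ^ (-t)) := by
      intro c hc
      have hc' : 0 < c := hc₀pos.trans hc
      rw [Real.div_rpow hL.le hc'.le, Real.rpow_neg hc'.le, div_eq_mul_inv]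
    rw [setLIntegral_congr_fun measurableSet_Ioi this, ← ofReal_integral_eq_lintegral_ofReal hint
      ((ae_restrict_iff' measurableSet_Ioi).2 (.of_forall fun c hc => by
        have hc' : 0 < c := hc₀pos.trans hc
        positivity)), integral_const_mul, integral_Ioi_rpow_of_lt (by linarith) hc₀pos]
    congr 2
    rw [show -t + 1 = -(t - 1) by ring, show 1 - t = -(t - 1) by ring]
    field_simp
  rw [e, ← Set.Ioc_union_Ioi_eq_Ioi hc₀pos.le, lintegral_union measurableSet_Ioi
    (Set.disjoint_left.2 fun c h1 h2 => not_lt.2 h1.2 h2)]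
  have i1 : ∫⁻ c in Set.Ioc 0 c₀, μ {y | c < ‖F y‖} ≤ ENNReal.ofReal (V * c₀) := by
    calc _ ≤ ∫⁻ c in Set.Ioc 0 c₀, ENNReal.ofReal V :=
          lintegral_mono fun c => (measure_mono (Set.subset_univ _)).trans hμ
      _ = _ := by simp [ENNReal.ofReal_mul hV.le]
  have i2 : ∫⁻ c in Set.Ioi c₀, μ {y | c < ‖F y‖} ≤
      ENNReal.ofReal (L ^ t * (c₀ ^ (1 - t) / (t - 1))) := by
    rw [← e2]
    exact setLIntegral_mono' measurableSet_Ioi fun c hc => h c (hc₀pos.trans hc)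
  refine (add_le_add i1 i2).trans ?_
  have ht1 : 0 < t - 1 := by linarith
  rw [← ENNReal.ofReal_add (by positivity) (by positivity)]
  refine ENNReal.ofReal_le_ofReal (le_of_eq ?_)
  have a1 : V * c₀ = L * V ^ (1 - 1 / t) := by
    rw [Real.rpow_sub hV, Real.rpow_one, hc₀]; field_simp
  have a2 : L ^ t * c₀ ^ (1 - t) = L * V ^ (1 - 1 / t) := by
    rw [hc₀, Real.div_rpow hL.le (by positivity), ← Real.rpow_mul hV.le,
      show 1 / t * (1 - t) = -(1 - 1 / t) by field_simp; ring, Real.rpow_neg hV.le, div_inv_eq_mul,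
      ← mul_assoc, ← Real.rpow_add hL]
    simp
  rw [a1, ← mul_div_assoc (L ^ t), a2]
  field_simp
  ring

/-- On a cube of volume `W` the integral is at most `m = min W |E|`. Writing `m^(1/q) = m^(1/q -
1/p) m^(1/p)`, the first factor is bounded through `W` (as `q ≤ p`) and the second through `|E|`. -/
theorem morreyNorm_le_of_support {p q : ℝ} (hq : 1 < q) (hqp : q ≤ p) {f : Rn n → ℂ}
    {E : Set (Rn n)} (hE : MeasurableSet E) (hf : ∀ y, ‖f y‖ ≤ 1) (hfE : ∀ y ∉ E, f y = 0)
    (hV0 : volume E ≠ 0) :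
    morreyNorm p q f ≤ volume E ^ (1 / p) := by
  have hq0 : 0 < q := by linarith
  have hp0 : 0 < p := by linarith
  refine iSup_le fun x => iSup_le fun r => iSup_le fun hr => ?_
  set W := volume (cube x r) with hW
  have hW0 : W ≠ 0 := by
    rw [hW, volume_cube x hr.le]
    exact (ENNReal.ofReal_pos.2 (by positivity)).ne'
  have hWt : W ≠ ⊤ := by rw [hW, volume_cube x hr.le]; exact ENNReal.ofReal_ne_top
  have hle : 1 / p ≤ 1 / q := one_div_le_one_div_of_le hq0 hqp
  have h1 : ∫⁻ y in cube x r, ‖f y‖ₑ ^ q ≤ min W (volume E) := by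
    have : ∀ y, ‖f y‖ₑ ^ q ≤ E.indicator 1 y := by
      intro y
      by_cases hy : y ∈ E
      · rw [Set.indicator_of_mem hy, Pi.one_apply]
        refine ENNReal.rpow_le_one ?_ hq0.le
        rw [← ofReal_norm]
        exact ENNReal.ofReal_le_one.2 (hf y)
      · simp [hfE y hy, hq0]
    refine (lintegral_mono this).trans ?_
    rw [lintegral_indicator_one hE, Measure.restrict_apply hE]
    exact le_min (measure_mono Set.inter_subset_right) (measure_mono Set.inter_subset_left)
  calc (W ^ (1 / q - 1 / p))⁻¹ * (∫⁻ y in cube x r, ‖f y‖ₑ ^ q) ^ (1 / q)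
      ≤ (W ^ (1 / q - 1 / p))⁻¹ * (min W (volume E)) ^ (1 / q) := by gcongr
    _ = (W ^ (1 / q - 1 / p))⁻¹ * ((min W (volume E)) ^ (1 / q - 1 / p) *
          (min W (volume E)) ^ (1 / p)) := by
        rw [← ENNReal.rpow_add, sub_add_cancel]
        · exact (lt_min hW0.bot_lt hV0.bot_lt).ne'
        · exact ((min_le_left _ _).trans_lt hWt.lt_top).ne
    _ ≤ (W ^ (1 / q - 1 / p))⁻¹ * (W ^ (1 / q - 1 / p) * volume E ^ (1 / p)) := by
        gcongr
        · exact min_le_left _ _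
        · exact min_le_right _ _
    _ = _ := by
        rw [← mul_assoc, ENNReal.inv_mul_cancel, one_mul]
        · exact (ENNReal.rpow_pos hW0.bot_lt hWt).ne'
        · exact ENNReal.rpow_ne_top_of_nonneg (by linarith) hWt

/-- Weak `L^t` embeds in `L¹` on sets of finite measure because `t > 1`. This is what makes the
weakest of the four statements sufficient for the oscillation estimate. -/
theorem lintegral_cube_le_of_weakMorreyNorm_le {s t : ℝ} (ht : 1 < t) {F : Rn n → ℂ}
    (hF : AEStronglyMeasurable F volume) {N : ℝ} (hN : 0 < N)
    (h : weakMorreyNorm s t F ≤ ENNReal.ofReal N) (x : Rn n) {r : ℝ} (hr : 0 < r) :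
    ∫⁻ y in cube x r, ‖F y‖ₑ ≤
      ENNReal.ofReal (t / (t - 1) * N * ((2 * r) ^ n) ^ (1 - 1 / s)) := by
  have ht0 : 0 < t := by linarith
  set V := (2 * r) ^ n with hV
  have hV0 : 0 < V := by positivity
  have key := lintegral_enorm_le_of_weak (μ := volume.restrict (cube x r)) (F := F) hF.restrict
    (V := V) (L := N * V ^ (1 / t - 1 / s)) (t := t) hV0 (by simp [volume_cube x hr.le, hV])
    (by positivity) ht ?_
  · refine key.trans (le_of_eq ?_)
    rw [mul_assoc, mul_assoc, mul_assoc, ← Real.rpow_add hV0,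
      show 1 / t - 1 / s + (1 - 1 / t) = 1 - 1 / s by ring]
  intro c hc
  have h1 : (volume (cube x r) ^ (1 / t - 1 / s))⁻¹ *
      (((c.toNNReal : ℝ≥0) : ℝ≥0∞) ^ t *
        volume {y : Rn n | y ∈ cube x r ∧ ((c.toNNReal : ℝ≥0) : ℝ≥0∞) < ‖F y‖ₑ}) ^ (1 / t) ≤
      ENNReal.ofReal N := by
    refine le_trans ?_ h
    refine le_iSup_of_le x (le_iSup_of_le r (le_iSup_of_le hr ?_))
    gcongr
    exact le_iSup_of_le c.toNNReal (le_iSup_of_le (by simpa using hc) le_rfl)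
  have hset : {y : Rn n | y ∈ cube x r ∧ ((c.toNNReal : ℝ≥0) : ℝ≥0∞) < ‖F y‖ₑ} =
      {y | c < ‖F y‖} ∩ cube x r := by
    ext y
    simp only [Set.mem_ofPred_eq, Set.mem_inter_iff, and_comm, ← ofReal_norm]
    refine and_congr_left' ?_
    exact ENNReal.ofReal_lt_ofReal_iff_of_nonneg hc.le
  rw [hset, ← Measure.restrict_apply' (measurableSet_cube x r), volume_cube x hr.le, ← hV,
    ENNReal.ofReal_rpow_of_pos hV0, mul_comm, ← div_eq_mul_inv,
    ENNReal.div_le_iff (ENNReal.ofReal_pos.2 (by positivity)).ne' ENNReal.ofReal_ne_top,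
    ← ENNReal.ofReal_mul hN.le] at h1
  have h2 := ENNReal.rpow_le_rpow h1 ht0.le
  rw [← ENNReal.rpow_mul, one_div, inv_mul_cancel₀ ht0.ne', ENNReal.rpow_one,
    ENNReal.ofReal_rpow_of_nonneg (by positivity) ht0.le] at h2
  change ENNReal.ofReal c ^ t * _ ≤ _ at h2
  rw [ENNReal.ofReal_rpow_of_pos hc, mul_comm, ← ENNReal.le_div_iff_mul_le
    (.inl (ENNReal.ofReal_pos.2 (by positivity)).ne') (.inl ENNReal.ofReal_ne_top),
    ← ENNReal.ofReal_div_of_pos (by positivity)] at h2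
  rw [Real.div_rpow (by positivity) hc.le, one_div]
  exact h2

/-! ### Oscillation from nearly constant kernels -/

section Oscillation

variable {X Y : Type*} [MeasurableSpace X] [MeasurableSpace Y] {μ : Measure X} {ν : Measure Y}
  [IsFiniteMeasure μ] [IsFiniteMeasure ν] {a : X → ℂ} {b : Y → ℂ} {k : X → Y → ℂ} {κ : ℂ}
  {θ M V : ℝ}

/-- Decompose `κ ∫ (a x - b y) dν = ∫ (a x - b y) k dν - ∫ (a x - b y) (k - κ) dν`. The first term
is the hypothesis, while the second leaves the double oscillation with the small factor `θ`. -/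
theorem integral_norm_sub_le_of_kernel (ha : Integrable a μ) (hb : Integrable b ν)
    (hk : Measurable (Function.uncurry k)) (hκ : κ ≠ 0)
    (hkκ : ∀ᵐ x ∂μ, ∀ᵐ y ∂ν, ‖k x y - κ‖ ≤ θ * ‖κ‖)
    (hkκ' : ∀ᵐ z ∂μ.prod ν, ‖k z.1 z.2‖ ≤ M) (hV : ν.real Set.univ = V) (hV0 : 0 < V) {A : ℝ}
    (hA : ∫ x, ‖∫ y, (a x - b y) * k x y ∂ν‖ ∂μ ≤ A * ‖κ‖) :
    V * ∫ x, ‖a x - (V : ℂ)⁻¹ * ∫ y, b y ∂ν‖ ∂μ ≤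
      A + θ * ∫ x, ∫ y, ‖a x - b y‖ ∂ν ∂μ := by
  have hκ' : 0 < ‖κ‖ := norm_pos_iff.2 hκ
  have hI : Integrable (fun z : X × Y => a z.1 - b z.2) (μ.prod ν) :=
    (ha.comp_fst ν).sub (hb.comp_snd μ)
  have hIk : Integrable (fun z : X × Y => (a z.1 - b z.2) * k z.1 z.2) (μ.prod ν) :=
    hI.mul_bdd hk.aestronglyMeasurable hkκ'
  have e : ∀ x, ((V : ℂ)) * (a x - (V : ℂ)⁻¹ * ∫ y, b y ∂ν) = ∫ y, (a x - b y) ∂ν := by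
    intro x
    rw [integral_sub (integrable_const _) hb, integral_const, hV, mul_sub, ← mul_assoc,
      mul_inv_cancel₀ (by exact_mod_cast hV0.ne'), one_mul, Complex.real_smul]
  have hpt : ∀ᵐ x ∂μ, ‖κ‖ * (V * ‖a x - (V : ℂ)⁻¹ * ∫ y, b y ∂ν‖) ≤
      ‖∫ y, (a x - b y) * k x y ∂ν‖ + θ * ‖κ‖ * ∫ y, ‖a x - b y‖ ∂ν := by
    filter_upwards [hkκ, hIk.prod_right_ae] with x hx hx2
    have i1 : Integrable (fun y => a x - b y) ν := (integrable_const _).sub hb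
    have h1 : κ * ∫ y, (a x - b y) ∂ν =
        ∫ y, (a x - b y) * k x y ∂ν - ∫ y, (a x - b y) * (k x y - κ) ∂ν := by
      rw [← integral_sub hx2]
      · rw [← integral_const_mul]
        exact integral_congr_ae (.of_forall fun y => by simp only; ring)
      · simp_rw [mul_sub]
        exact hx2.sub (i1.mul_const κ)
    have h2 : ‖∫ y, (a x - b y) * (k x y - κ) ∂ν‖ ≤ θ * ‖κ‖ * ∫ y, ‖a x - b y‖ ∂ν := by
      rw [← integral_const_mul]
      refine norm_integral_le_of_norm_le (i1.norm.const_mul _) ?_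
      filter_upwards [hx] with y hy
      rw [norm_mul, mul_comm]
      gcongr
    calc ‖κ‖ * (V * ‖a x - (V : ℂ)⁻¹ * ∫ y, b y ∂ν‖) = ‖κ * ∫ y, (a x - b y) ∂ν‖ := by
          rw [← e, norm_mul, norm_mul, Complex.norm_real, Real.norm_of_nonneg hV0.le]
      _ ≤ _ := by
          rw [h1]
          exact (norm_sub_le _ _).trans (by gcongr)
  have i3 : Integrable (fun x => ∫ y, ‖a x - b y‖ ∂ν) μ := hI.norm.integral_prod_left
  have i4 : Integrable (fun x => ‖∫ y, (a x - b y) * k x y ∂ν‖) μ := hIk.integral_prod_left.norm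
  have h := integral_mono_ae (((ha.sub (integrable_const _)).norm.const_mul _).const_mul _)
    (i4.add (i3.const_mul _)) hpt
  rw [integral_const_mul, integral_const_mul] at h
  simp only [Pi.add_apply] at h
  rw [integral_add i4 (i3.const_mul _), integral_const_mul] at h
  refine le_of_mul_le_mul_left (a := ‖κ‖) ?_ hκ'
  simp only [Pi.sub_apply] at h
  nlinarith

/-- Apply the one-sided estimate to both variables. The double oscillation `D` is in turn bounded by
the two single oscillations and the difference of the means, so its occurrence with factor `θ` can
be absorbed. -/
theorem integral_norm_sub_le_of_kernel_of_swap (ha : Integrable a μ) (hb : Integrable b ν)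
    (hk : Measurable (Function.uncurry k)) (hκ : κ ≠ 0)
    (hkκ : ∀ᵐ z ∂μ.prod ν, ‖k z.1 z.2 - κ‖ ≤ θ * ‖κ‖) (hθ : θ ≤ 1 / 12)
    (hμ : μ.real Set.univ = V) (hν : ν.real Set.univ = V) (hV0 : 0 < V) {A : ℝ}
    (hA : ∫ x, ‖∫ y, (a x - b y) * k x y ∂ν‖ ∂μ ≤ A * ‖κ‖)
    (hA' : ∫ y, ‖∫ x, (a x - b y) * k x y ∂μ‖ ∂ν ≤ A * ‖κ‖) :
    V * ∫ x, ‖a x - (V : ℂ)⁻¹ * ∫ y, b y ∂ν‖ ∂μ ≤ 2 * A := by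
  have hI : Integrable (fun z : X × Y => a z.1 - b z.2) (μ.prod ν) :=
    (ha.comp_fst ν).sub (hb.comp_snd μ)
  have hb' : ∀ᵐ z ∂μ.prod ν, ‖k z.1 z.2‖ ≤ θ * ‖κ‖ + ‖κ‖ := by
    filter_upwards [hkκ] with z hz
    calc ‖k z.1 z.2‖ = ‖(k z.1 z.2 - κ) + κ‖ := by rw [sub_add_cancel]
      _ ≤ _ := (norm_add_le _ _).trans (by gcongr)
  have hkκs : ∀ᵐ z ∂ν.prod μ, ‖k z.2 z.1 - κ‖ ≤ θ * ‖κ‖ :=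
    Measure.measurePreserving_swap.quasiMeasurePreserving.ae hkκ
  have hbs : ∀ᵐ z ∂ν.prod μ, ‖k z.2 z.1‖ ≤ θ * ‖κ‖ + ‖κ‖ :=
    Measure.measurePreserving_swap.quasiMeasurePreserving.ae hb'
  have h1 := integral_norm_sub_le_of_kernel ha hb hk hκ (Measure.ae_ae_of_ae_prod hkκ) hb' hν hV0 hA
  have h2 := integral_norm_sub_le_of_kernel (a := b) (b := a) (k := fun y x => k x y) (A := A)
    hb ha (hk.comp measurable_swap) hκ
    (Measure.ae_ae_of_ae_prod hkκs) hbs hμ hV0 (by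
      refine le_trans (le_of_eq ?_) hA'
      refine integral_congr_ae (.of_forall fun y => ?_)
      simp only
      rw [← norm_neg, ← integral_neg]
      congr 1
      exact integral_congr_ae (.of_forall fun x => by simp only; ring))
  have hsw : ∫ y, ∫ x, ‖b y - a x‖ ∂μ ∂ν = ∫ x, ∫ y, ‖a x - b y‖ ∂ν ∂μ := by
    rw [integral_integral_swap (f := fun y x => ‖b y - a x‖)]
    · simp_rw [norm_sub_rev]
    · exact ((hb.comp_fst μ).sub (ha.comp_snd ν)).norm
  rw [hsw] at h2
  set β := (V : ℂ)⁻¹ * ∫ y, b y ∂ν with hβ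
  set γ := (V : ℂ)⁻¹ * ∫ x, a x ∂μ with hγ
  set D := ∫ x, ∫ y, ‖a x - b y‖ ∂ν ∂μ with hD
  have hD0 : 0 ≤ D := integral_nonneg fun x => integral_nonneg fun y => norm_nonneg _
  have i1 : Integrable (fun x => ‖a x - β‖) μ := (ha.sub (integrable_const _)).norm
  have i2 : Integrable (fun y => ‖b y - γ‖) ν := (hb.sub (integrable_const _)).norm
  have hVc : (V : ℂ) ≠ 0 := by exact_mod_cast hV0.ne'
  have h3 : V * ‖γ - β‖ ≤ ∫ x, ‖a x - β‖ ∂μ := by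
    refine le_trans (le_of_eq ?_) (norm_integral_le_integral_norm _)
    rw [integral_sub ha (integrable_const _), integral_const, hμ, Complex.real_smul]
    rw [← Real.norm_of_nonneg hV0.le, ← Complex.norm_real, ← norm_mul, mul_sub, hγ, ← mul_assoc,
      Complex.norm_real, Real.norm_of_nonneg hV0.le, mul_inv_cancel₀ hVc, one_mul]
  have h4 : D ≤ V * ∫ x, ‖a x - β‖ ∂μ + V * (V * ‖γ - β‖) + V * ∫ y, ‖b y - γ‖ ∂ν := by
    have : ∀ x, ∫ y, ‖a x - b y‖ ∂ν ≤ V * ‖a x - β‖ + V * ‖γ - β‖ + ∫ y, ‖b y - γ‖ ∂ν := by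
      intro x
      have : ∫ y, (‖a x - β‖ + ‖γ - β‖ + ‖b y - γ‖) ∂ν =
          V * ‖a x - β‖ + V * ‖γ - β‖ + ∫ y, ‖b y - γ‖ ∂ν := by
        rw [integral_add (integrable_const _) i2, integral_const, hν, smul_eq_mul, mul_add]
      rw [← this]
      refine integral_mono_of_nonneg (.of_forall fun y => norm_nonneg _)
        ((integrable_const _).add i2) (.of_forall fun y => ?_)
      calc ‖a x - b y‖ = ‖(a x - β) - (γ - β) - (b y - γ)‖ := by congr 1; ring
        _ ≤ _ := (norm_sub_le _ _).trans (add_le_add (norm_sub_le _ _) le_rfl)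
    calc D ≤ ∫ x, (V * ‖a x - β‖ + V * ‖γ - β‖ + ∫ y, ‖b y - γ‖ ∂ν) ∂μ :=
          integral_mono_of_nonneg (.of_forall fun x => integral_nonneg fun y => norm_nonneg _)
            (((i1.const_mul V).add (integrable_const _)).add (integrable_const _)) (.of_forall this)
      _ = _ := by
          have j1 : Integrable (fun x => V * ‖a x - β‖) μ := i1.const_mul V
          rw [integral_add (f := fun x => V * ‖a x - β‖ + V * ‖γ - β‖)
            (j1.add (integrable_const _)) (integrable_const _),
            integral_add j1 (integrable_const _), integral_const_mul, integral_const,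
            integral_const, hμ, smul_eq_mul, smul_eq_mul]
  -- With this, `D ≤ 3 A + 3 θ D ≤ 3 A + D / 4`, so `D ≤ 4 A` and the left side is at most `A + D /
  -- 12 ≤ 2 A`.
  have h5 : V * (V * ‖γ - β‖) ≤ V * ∫ x, ‖a x - β‖ ∂μ := by gcongr
  nlinarith

end Oscillation

/-! ### From boundedness of the commutator to oscillation of the symbol -/

theorem singularIntegral_eq_integral {f : Rn n → ℂ} {x : Rn n} {ρ : ℝ} (hρ : 0 < ρ)
    (hf : ∀ y, ‖x - y‖ < ρ → f y = 0) :
    singularIntegral Ω f x = ∫ y, kernel Ω (x - y) * f y := by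
  refine Tendsto.limUnder_eq (tendsto_const_nhds.congr' ?_)
  filter_upwards [Ioo_mem_nhdsGT hρ] with ε hε
  refine (setIntegral_eq_integral_of_forall_compl_eq_zero fun y hy => ?_).symm
  rw [hf y ((not_lt.1 hy).trans_lt hε.2), mul_zero]

theorem commutator_eq_integral {b f : Rn n → ℂ} {x : Rn n} {ρ : ℝ} (hρ : 0 < ρ)
    {E : Set (Rn n)} (hfE : ∀ y ∉ E, f y = 0)
    (hx : ∀ y ∈ E, ρ ≤ ‖x - y‖)
    (h1 : IntegrableOn (fun y => kernel Ω (x - y) * f y) E)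
    (h2 : IntegrableOn (fun y => kernel Ω (x - y) * (b y * f y)) E) :
    commutator Ω b f x = ∫ y in E, (b x - b y) * (kernel Ω (x - y) * f y) := by
  have hz : ∀ y, ‖x - y‖ < ρ → f y = 0 := fun y hy => hfE y fun h => (hx y h).not_gt hy
  rw [commutator, singularIntegral_eq_integral hρ hz,
    singularIntegral_eq_integral hρ (fun y hy => by rw [hz y hy, mul_zero]),
    ← setIntegral_eq_integral_of_forall_compl_eq_zero (s := E)
      (fun y hy => by rw [hfE y hy, mul_zero]),
    ← setIntegral_eq_integral_of_forall_compl_eq_zero (s := E) (f := fun y => _ * (b y * f y))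
      (fun y hy => by rw [hfE y hy, mul_zero, mul_zero]), ← integral_const_mul,
    ← integral_sub (h1.const_mul _) h2]
  exact integral_congr_ae (.of_forall fun y => by simp only; ring)

theorem norm_kernel_sub_le_of_balls {C A r : ℝ} (hC : ∀ u v : Rn n, ‖u - v‖ ≤ ‖u‖ / 2 →
      ‖kernel Ω u - kernel Ω v‖ ≤ C * ‖u - v‖ / ‖u‖ ^ (n + 1)) (hC0 : 0 ≤ C) (hr : 0 < r)
    (hA : 4 ≤ A) {e : Rn n} (he : ‖e‖ = 1) {x₀ x y : Rn n} (hx : x ∈ Metric.closedBall x₀ r)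
    (hy : y ∈ Metric.closedBall (x₀ - (A * r) • e) r) :
    ‖kernel Ω (x - y) - kernel Ω ((A * r) • e)‖ ≤ (2 * C / A) / (A * r) ^ n := by
  have hA0 : 0 < A := by linarith
  have hu : ‖(A * r) • e‖ = A * r := by
    rw [norm_smul, he, mul_one, Real.norm_of_nonneg (by positivity)]
  have huv : ‖(A * r) • e - (x - y)‖ ≤ 2 * r := by
    rw [mem_closedBall_iff_norm] at hx hy
    calc ‖(A * r) • e - (x - y)‖ = ‖(y - (x₀ - (A * r) • e)) - (x - x₀)‖ := by congr 1; module
      _ ≤ r + r := (norm_sub_le _ _).trans (add_le_add hy hx)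
      _ = _ := by ring
  rw [norm_sub_rev]
  refine (hC _ _ (huv.trans ?_)).trans ?_
  · rw [hu]; nlinarith
  · rw [hu, pow_succ]
    calc C * ‖(A * r) • e - (x - y)‖ / ((A * r) ^ n * (A * r))
        ≤ C * (2 * r) / ((A * r) ^ n * (A * r)) := by gcongr
      _ = _ := by field_simp

/-- Test functions supported in the displaced ball `B'` and bounded by one have norm at most
`|B'|^(1/p)`, and their commutators are absolutely convergent integrals on `B`. Two of them supply
the hypotheses of the absorption argument, so no expansion of the reciprocal of the kernel is
needed. -/
theorem exists_oscillation_le (hn : 1 ≤ n) (hΩ : IsAngular Ω) (hΩ0 : ∃ x : Rn n, x ≠ 0 ∧ Ω x ≠ 0)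
    {b : Rn n → ℂ} (hb : LocallyIntegrable b volume) {α p q s t : ℝ}
    (hq : 1 < q) (hqp : q ≤ p) (ht : 1 < t) (hs_eq : 1 / s = 1 / p - α / (n : ℝ))
    (h : CommutatorBounded Ω b (morreyNorm p q) (weakMorreyNorm s t)) :
    ∃ C : ℝ, 0 ≤ C ∧ ∀ (x₀ : Rn n) (r : ℝ), 0 < r →
      ∃ c : ℂ, ∫ y in Metric.closedBall x₀ r, ‖b y - c‖ ≤ C * r ^ ((n : ℝ) + α) := by
  obtain ⟨C, hC0, hC⟩ := hΩ.exists_norm_kernel_sub_le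
  obtain ⟨C₂, h₂⟩ := h
  obtain ⟨e, he, heΩ⟩ : ∃ e : Rn n, ‖e‖ = 1 ∧ Ω e ≠ 0 := by
    obtain ⟨x, hx, hxΩ⟩ := hΩ0
    refine ⟨‖x‖⁻¹ • x, by simp [norm_smul, hx], ?_⟩
    rwa [hΩ.homogeneous _ _ (by positivity)]
  have hke : kernel Ω e ≠ 0 := by simp [kernel, he, heΩ]
  set κ := ‖kernel Ω e‖ with hκ
  have hκ0 : 0 < κ := norm_pos_iff.2 hke
  -- The entry `4` puts the two balls in the range of the regularity estimate and keeps them apart;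
  -- the entry `24 C / κ` makes the relative error of the kernel at most `1/12`.
  set A := max 4 (24 * C / κ) with hA
  have hA4 : 4 ≤ A := le_max_left _ _
  have hA0 : 0 < A := by linarith
  have hAC : 2 * C / A ≤ 1 / 12 * κ := by
    have : 24 * C / κ ≤ A := le_max_right _ _
    rw [div_le_iff₀ hκ0] at this
    rw [div_le_iff₀ hA0]
    linarith
  set v := unitBallVolume n with hv
  have hv0 : 0 < v := unitBallVolume_pos
  have hn0 : (0 : ℝ) < n := by exact_mod_cast hn
  have hp0 : 0 < p := by linarith
  set Cf := 2 * (t / (t - 1) * ((C₂ + 1) * v ^ (1 / p)) * ((4 : ℝ) ^ n) ^ (1 - 1 / s)) * A ^ n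
    / κ / v with hCf
  have ht1 : 0 < t - 1 := by linarith
  have ht0 : 0 < t := by linarith
  refine ⟨Cf, by positivity, fun x₀ r hr => ?_⟩
  set B := Metric.closedBall x₀ r with hB
  set B' := Metric.closedBall (x₀ - (A * r) • e) r with hB'
  set V := v * r ^ n with hV
  have hV0 : 0 < V := by positivity
  have hκr : ‖kernel Ω ((A * r) • e)‖ = κ / (A * r) ^ n := by
    rw [hΩ.kernel_smul (by positivity), norm_mul, norm_inv, Complex.norm_real,
      Real.norm_of_nonneg (by positivity), inv_mul_eq_div]
  have hκr0 : kernel Ω ((A * r) • e) ≠ 0 := by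
    rw [← norm_pos_iff, hκr]; positivity
  have hker : ∀ x ∈ B, ∀ y ∈ B', ‖kernel Ω (x - y) - kernel Ω ((A * r) • e)‖ ≤
      1 / 12 * ‖kernel Ω ((A * r) • e)‖ := by
    intro x hx y hy
    refine (norm_kernel_sub_le_of_balls hC hC0 hr hA4 he hx hy).trans ?_
    rw [hκr, ← mul_div_assoc]
    gcongr
  set M := 1 / 12 * ‖kernel Ω ((A * r) • e)‖ + ‖kernel Ω ((A * r) • e)‖ with hM
  have hkM : ∀ x ∈ B, ∀ y ∈ B', ‖kernel Ω (x - y)‖ ≤ M := by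
    intro x hx y hy
    calc ‖kernel Ω (x - y)‖ = ‖(kernel Ω (x - y) - kernel Ω ((A * r) • e)) +
          kernel Ω ((A * r) • e)‖ := by rw [sub_add_cancel]
      _ ≤ _ := (norm_add_le _ _).trans (add_le_add (hker x hx y hy) le_rfl)
  have hdist : ∀ x ∈ B, ∀ y ∈ B', r ≤ ‖x - y‖ := by
    intro x hx y hy
    rw [hB, mem_closedBall_iff_norm] at hx
    rw [hB', mem_closedBall_iff_norm] at hy
    have h1 : ‖(A * r) • e‖ = A * r := by
      rw [norm_smul, he, mul_one, Real.norm_of_nonneg (by positivity)]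
    have h2 : ‖(A * r) • e‖ ≤ ‖x - y‖ + ‖y - (x₀ - (A * r) • e)‖ + ‖x - x₀‖ := by
      calc ‖(A * r) • e‖ = ‖(x - y) + (y - (x₀ - (A * r) • e)) - (x - x₀)‖ := by congr 1; module
        _ ≤ _ := (norm_sub_le _ _).trans (add_le_add (norm_add_le _ _) le_rfl)
    nlinarith
  have hBm : MeasurableSet B := measurableSet_closedBall
  have hBm' : MeasurableSet B' := measurableSet_closedBall
  have hVB : volume B = ENNReal.ofReal V := volume_closedBall _ hr.le
  have hVB' : volume B' = ENNReal.ofReal V := volume_closedBall _ hr.le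
  have hbB : IntegrableOn b B := hb.integrableOn_isCompact (isCompact_closedBall _ _)
  have hbB' : IntegrableOn b B' := hb.integrableOn_isCompact (isCompact_closedBall _ _)
  have : IsFiniteMeasure (volume.restrict B) := ⟨by simp [hVB]⟩
  have : IsFiniteMeasure (volume.restrict B') := ⟨by simp [hVB']⟩
  have hKm : Measurable (fun z : Rn n × Rn n => kernel Ω (z.1 - z.2)) :=
    hΩ.measurable_kernel.comp (measurable_fst.sub measurable_snd)
  have hprod : (volume.restrict B).prod (volume.restrict B') =
      ((volume : Measure (Rn n)).prod volume).restrict (B ×ˢ B') := Measure.prod_restrict _ _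
  set Y := t / (t - 1) * ((C₂ + 1) * V ^ (1 / p)) * ((2 * (2 * r)) ^ n) ^ (1 - 1 / s) with hY
  have hY0 : 0 ≤ Y := by positivity
  -- the test functions
  have test : ∀ f : Rn n → ℂ, AEStronglyMeasurable f volume → (∀ y, ‖f y‖ ≤ 1) →
      (∀ y ∉ B', f y = 0) →
      ∫ x in B, ‖∫ y in B', (b x - b y) * (kernel Ω (x - y) * f y)‖ ≤ Y := by
    intro f hfm hf1 hfB
    have hN := morreyNorm_le_of_support hq hqp hBm' hf1 hfB
      (by rw [hVB']; exact (ENNReal.ofReal_pos.2 hV0).ne')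
    rw [hVB', ENNReal.ofReal_rpow_of_pos hV0] at hN
    obtain ⟨-, -, ⟨hm, -⟩, hle⟩ := h₂ f ⟨hfm, hN.trans_lt ENNReal.ofReal_lt_top⟩
    have hle' : weakMorreyNorm s t (commutator Ω b f) ≤
        ENNReal.ofReal ((C₂ + 1) * V ^ (1 / p)) := by
      refine (hle.trans (mul_le_mul_right hN _)).trans ?_
      rw [← ENNReal.ofReal_coe_nnreal, ← ENNReal.ofReal_mul (NNReal.coe_nonneg C₂)]
      refine ENNReal.ofReal_le_ofReal ?_
      gcongr
      linarith
    have hint := lintegral_cube_le_of_weakMorreyNorm_le ht hm (by positivity) hle' x₀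
      (r := 2 * r) (by positivity)
    have hsub : B ⊆ cube x₀ (2 * r) :=
      (Metric.closedBall_subset_ball (by linarith)).trans (ball_subset_cube _ _)
    have e1 : ∀ x ∈ B, commutator Ω b f x =
        ∫ y in B', (b x - b y) * (kernel Ω (x - y) * f y) := by
      intro x hx
      have hkm : Measurable fun y => kernel Ω (x - y) := hΩ.measurable_kernel.comp (by fun_prop)
      have hkb : ∀ᵐ y ∂volume.restrict B', ‖kernel Ω (x - y)‖ ≤ M :=
        (ae_restrict_iff' hBm').2 (.of_forall fun y hy => hkM x hx y hy)
      have hf1' : IntegrableOn f B' :=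
        Integrable.mono' (integrable_const (1 : ℝ)) hfm.restrict (.of_forall hf1)
      refine commutator_eq_integral hr hfB (hdist x hx) ?_ ?_
      · exact hf1'.bdd_mul hkm.aestronglyMeasurable hkb
      · exact (hbB'.mul_bdd hfm.restrict (.of_forall hf1)).bdd_mul hkm.aestronglyMeasurable hkb
    rw [integral_norm_eq_lintegral_enorm]
    · refine ENNReal.toReal_le_of_le_ofReal hY0 ?_
      rw [← setLIntegral_congr_fun (f := fun x => ‖commutator Ω b f x‖ₑ) hBm
        (fun x hx => by simp only [e1 x hx])]
      exact (lintegral_mono_set hsub).trans hint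
    · exact (hm.restrict (s := B)).congr ((ae_restrict_iff' hBm).2 (.of_forall e1))
  have hI : Integrable (fun z : Rn n × Rn n => (b z.1 - b z.2) * kernel Ω (z.1 - z.2))
      ((volume.restrict B).prod (volume.restrict B')) := by
    refine ((hbB.comp_fst _).sub (hbB'.comp_snd _)).mul_bdd (c := M) hKm.aestronglyMeasurable ?_
    rw [hprod]
    exact (ae_restrict_iff' (hBm.prod hBm')).2 (.of_forall fun z hz => hkM _ hz.1 _ hz.2)
  have main := integral_norm_sub_le_of_kernel_of_swap (μ := volume.restrict B)
    (ν := volume.restrict B') (a := b) (b := b) (k := fun x y => kernel Ω (x - y))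
    (κ := kernel Ω ((A * r) • e)) (θ := 1 / 12) (V := V)
    (A := Y / ‖kernel Ω ((A * r) • e)‖) hbB hbB' hKm hκr0
    (by
      rw [hprod]
      exact (ae_restrict_iff' (hBm.prod hBm')).2 (.of_forall fun z hz => hker _ hz.1 _ hz.2))
    le_rfl (by simp [Measure.real, hVB, hV0.le]) (by simp [Measure.real, hVB', hV0.le]) hV0
    (by
      rw [div_mul_cancel₀ _ (norm_pos_iff.2 hκr0).ne']
      refine le_trans (le_of_eq ?_) (test (B'.indicator 1)
        (stronglyMeasurable_one.indicator hBm').aestronglyMeasurable (fun y => ?_) (fun y hy => ?_))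
      · refine integral_congr_ae (.of_forall fun x => ?_)
        simp only
        congr 1
        refine setIntegral_congr_fun hBm' fun y hy => ?_
        simp [Set.indicator_of_mem hy]
      · by_cases hy : y ∈ B' <;> simp [hy]
      · simp [hy])
    (by
      rw [div_mul_cancel₀ _ (norm_pos_iff.2 hκr0).ne']
      set G : Rn n → ℂ := fun y => ∫ x in B, (b x - b y) * kernel Ω (x - y) with hG
      have hGi : Integrable G (volume.restrict B') := hI.integral_prod_right
      -- The phase with `f G = |G|`; by Fubini the integral of `|G|` equals the integral over `B` of
      -- the commutator applied to `f`. Where `G` vanishes the quotient is `0 / 0 = 0`, which does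
      -- no harm.
      set f : Rn n → ℂ := B'.indicator fun y => (starRingEnd ℂ) (G y) / (‖G y‖ : ℂ) with hf
      have hf1 : ∀ y, ‖f y‖ ≤ 1 := by
        intro y
        by_cases hy : y ∈ B'
        · rw [hf, Set.indicator_of_mem hy, norm_div, RCLike.norm_conj, Complex.norm_real, norm_norm]
          exact div_self_le_one _
        · simp [hf, hy]
      have hfm : AEStronglyMeasurable f volume := by
        rw [hf, aestronglyMeasurable_indicator_iff hBm']
        have := hGi.aestronglyMeasurable
        exact ((Complex.continuous_conj.comp_aestronglyMeasurable this).aemeasurable.div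
          (Complex.continuous_ofReal.comp_aestronglyMeasurable
            this.norm).aemeasurable).aestronglyMeasurable
      have hfG : ∀ y ∈ B', f y * G y = (‖G y‖ : ℂ) := by
        intro y hy
        rw [hf, Set.indicator_of_mem hy, div_mul_eq_mul_div, mul_comm, Complex.mul_conj,
          Complex.normSq_eq_norm_sq]
        rcases eq_or_ne (‖G y‖) 0 with h0 | h0
        · simp [h0]
        · push_cast
          field_simp
      have hnn : 0 ≤ ∫ y in B', ‖G y‖ := integral_nonneg fun y => norm_nonneg _
      have hkey : ((∫ y in B', ‖G y‖ : ℝ) : ℂ) =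
          ∫ x in B, ∫ y in B', (b x - b y) * (kernel Ω (x - y) * f y) := by
        have hF : Integrable (fun z : Rn n × Rn n => (b z.1 - b z.2) *
            (kernel Ω (z.1 - z.2) * f z.2)) ((volume.restrict B).prod (volume.restrict B')) := by
          simp_rw [← mul_assoc]
          exact hI.mul_bdd hfm.restrict.comp_snd (.of_forall fun z => hf1 _)
        rw [integral_integral_swap (f := fun x y => (b x - b y) * (kernel Ω (x - y) * f y)) hF,
          ← integral_complex_ofReal]
        refine setIntegral_congr_fun hBm' fun y hy => ?_
        rw [← hfG y hy, hG, ← integral_const_mul]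
        exact integral_congr_ae (.of_forall fun x => by simp only; ring)
      calc ∫ y in B', ‖G y‖ = ‖((∫ y in B', ‖G y‖ : ℝ) : ℂ)‖ := by
            rw [Complex.norm_real, Real.norm_of_nonneg hnn]
        _ ≤ _ := by
            rw [hkey]
            exact (norm_integral_le_integral_norm _).trans
              (test f hfm hf1 fun y hy => by simp [hf, hy]))
  refine ⟨(V : ℂ)⁻¹ * ∫ y in B', b y, ?_⟩
  rw [mul_comm, ← le_div_iff₀ hV0] at main
  refine main.trans (le_of_eq ?_)
  have e1 : V ^ (1 / p) = v ^ (1 / p) * r ^ ((n : ℝ) / p) := by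
    rw [hV, Real.mul_rpow hv0.le (by positivity), ← Real.rpow_natCast r n, ← Real.rpow_mul hr.le,
      mul_one_div]
  have e2 : ((2 * (2 * r)) ^ n) ^ (1 - 1 / s) =
      ((4 : ℝ) ^ n) ^ (1 - 1 / s) * r ^ ((n : ℝ) * (1 - 1 / s)) := by
    rw [show 2 * (2 * r) = 4 * r by ring, mul_pow, Real.mul_rpow (by positivity) (by positivity),
      ← Real.rpow_natCast r n, ← Real.rpow_mul hr.le]
  -- The relation between `s`, `p` and `α` is used exactly here: `n/p + n (1 - 1/s) = n + α`.
  have e3 : r ^ ((n : ℝ) + α) = r ^ ((n : ℝ) / p) * r ^ ((n : ℝ) * (1 - 1 / s)) := by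
    rw [← Real.rpow_add hr]
    congr 1
    rw [hs_eq]
    field_simp
    ring
  rw [hκr, hCf, hY, e1, e2, e3, hV, mul_pow]
  field_simp

/-! ### Campanato's characterisation of Hölder continuity -/

theorem norm_average_sub_le {b : Rn n → ℂ} (hb : LocallyIntegrable b volume) {α C : ℝ}
    (hC : 0 ≤ C) {x x' : Rn n} {r r' : ℝ} (hr : 0 < r)
    (hr' : 0 < r') (hrr' : r ≤ 4 * r')
    (hsub : Metric.closedBall x' r' ⊆ Metric.closedBall x r) {c : ℂ}
    (h : ∫ y in Metric.closedBall x r, ‖b y - c‖ ≤ C * r ^ ((n : ℝ) + α)) :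
    ‖(⨍ y in Metric.closedBall x' r', b y) - c‖ ≤ C * 4 ^ n / unitBallVolume n * r ^ α := by
  have hv := unitBallVolume_pos (n := n)
  have hV : volume.real (Metric.closedBall x' r') = unitBallVolume n * r' ^ n := by
    rw [Measure.real, volume_closedBall x' hr'.le, ENNReal.toReal_ofReal (by positivity)]
  have hV0 : 0 < unitBallVolume n * r' ^ n := by positivity
  have hbi : IntegrableOn b (Metric.closedBall x' r') :=
    hb.integrableOn_isCompact (isCompact_closedBall _ _)
  have hbi2 : IntegrableOn b (Metric.closedBall x r) :=
    hb.integrableOn_isCompact (isCompact_closedBall _ _)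
  have hci : ∀ (z : Rn n) (ρ : ℝ), IntegrableOn (fun _ : Rn n => c) (Metric.closedBall z ρ) :=
    fun z ρ => integrableOn_const measure_closedBall_lt_top.ne
  have e : (⨍ y in Metric.closedBall x' r', b y) - c =
      (unitBallVolume n * r' ^ n)⁻¹ • ∫ y in Metric.closedBall x' r', (b y - c) := by
    rw [integral_sub hbi (hci _ _), setAverage_eq, setIntegral_const, hV, smul_sub, smul_smul,
      inv_mul_cancel₀ hV0.ne', one_smul]
  rw [e, norm_smul, norm_inv, Real.norm_of_nonneg hV0.le, inv_mul_eq_div, div_le_iff₀ hV0]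
  calc ‖∫ y in Metric.closedBall x' r', (b y - c)‖
      ≤ ∫ y in Metric.closedBall x' r', ‖b y - c‖ := norm_integral_le_integral_norm _
    _ ≤ ∫ y in Metric.closedBall x r, ‖b y - c‖ :=
        setIntegral_mono_set (hbi2.sub (hci _ _)).norm (.of_forall fun y => norm_nonneg _)
          hsub.eventuallyLE
    _ ≤ C * r ^ ((n : ℝ) + α) := h
    _ = C * r ^ α * r ^ n := by rw [Real.rpow_add hr, Real.rpow_natCast]; ring
    _ ≤ C * r ^ α * (4 * r') ^ n := by gcongr
    _ = _ := by rw [mul_pow]; field_simp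

/-- Averages over consecutive dyadic balls differ by `O(r^α)`, so they converge geometrically at
every point. The limit is the Hölder representative, and it agrees with `b` almost everywhere by
Lebesgue differentiation. -/
theorem memLip_of_oscillation_le {b : Rn n → ℂ} (hb : LocallyIntegrable b volume) {α C : ℝ}
    (hα : 0 < α) (hC : 0 ≤ C)
    (h : ∀ (x₀ : Rn n) (r : ℝ), 0 < r →
      ∃ c : ℂ, ∫ y in Metric.closedBall x₀ r, ‖b y - c‖ ≤ C * r ^ ((n : ℝ) + α)) :
    MemLip α b := by
  set m : Rn n → ℝ → ℂ := fun x r => ⨍ y in Metric.closedBall x r, b y with hm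
  set C₁ := C * 4 ^ n / unitBallVolume n with hC₁
  have hv := unitBallVolume_pos (n := n)
  have hC₁0 : 0 ≤ C₁ := by positivity
  have h1 : ∀ (x z w : Rn n) (r s t : ℝ), 0 < s → 0 < t → r ≤ 4 * s → r ≤ 4 * t → 0 < r →
      Metric.closedBall z s ⊆ Metric.closedBall x r →
      Metric.closedBall w t ⊆ Metric.closedBall x r →
      ‖m z s - m w t‖ ≤ 2 * C₁ * r ^ α := by
    intro x z w r s t hs ht hrs hrt hr h1 h2
    obtain ⟨c, hc⟩ := h x r hr
    have a1 := norm_average_sub_le hb hC hr hs hrs h1 hc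
    have a2 := norm_average_sub_le hb hC hr ht hrt h2 hc
    calc ‖m z s - m w t‖ = ‖(m z s - c) - (m w t - c)‖ := by congr 1; ring
      _ ≤ _ := (norm_sub_le _ _).trans (add_le_add a1 a2)
      _ = _ := by ring
  set ρ : ℝ := 2 ^ (-α) with hρ
  have hρ1 : ρ < 1 := Real.rpow_lt_one_of_one_lt_of_neg one_lt_two (by linarith)
  set a : Rn n → ℤ → ℂ := fun x j => m x (2 ^ (-j)) with ha
  have hstep : ∀ (x : Rn n) (j : ℤ) (k : ℕ), dist (a x (j + k)) (a x (j + (k + 1 : ℕ))) ≤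
      2 * C₁ * ((2 : ℝ) ^ (-j)) ^ α * ρ ^ k := by
    intro x j k
    have e0 : (2 : ℝ) ^ (-(j + k)) = 2 ^ (-j) * ((2 : ℝ) ^ k)⁻¹ := by
      rw [neg_add, zpow_add₀ two_ne_zero, zpow_neg _ (k : ℤ), zpow_natCast]
    have e1 : (2 : ℝ) ^ (-(j + (k + 1 : ℕ))) = 2 ^ (-(j + k)) / 2 := by
      rw [Nat.cast_add, Nat.cast_one, ← add_assoc, neg_add (j + k : ℤ) 1,
        zpow_add₀ two_ne_zero, zpow_neg_one, div_eq_mul_inv]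
    have hp : (0 : ℝ) < 2 ^ (-(j + k)) := by positivity
    rw [dist_eq_norm]
    refine (h1 x x x (2 ^ (-(j + k))) _ _ hp (by rw [e1]; positivity) (by linarith)
      (by rw [e1]; linarith) hp subset_rfl
      (Metric.closedBall_subset_closedBall (by rw [e1]; linarith))).trans (le_of_eq ?_)
    rw [e0, Real.mul_rpow (by positivity) (by positivity), hρ, ← Real.rpow_natCast 2 k,
      ← Real.rpow_neg two_pos.le, ← Real.rpow_natCast _ k, ← Real.rpow_mul two_pos.le,
      ← Real.rpow_mul two_pos.le]
    ring_nf
  have hex : ∀ x, ∃ g, Tendsto (a x) atTop (𝓝 g) := by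
    intro x
    obtain ⟨g, hg⟩ := cauchySeq_tendsto_of_complete
      (cauchySeq_of_le_geometric ρ _ hρ1 (hstep x 0))
    refine ⟨g, ?_⟩
    rw [← Nat.map_cast_int_atTop, tendsto_map'_iff]
    simpa [Function.comp_def] using hg
  choose g hg using hex
  have hdist : ∀ (x : Rn n) (j : ℤ), ‖a x j - g x‖ ≤
      2 * C₁ / (1 - ρ) * ((2 : ℝ) ^ (-j)) ^ α := by
    intro x j
    have ht : Tendsto (fun k : ℕ => a x (j + k)) atTop (𝓝 (g x)) :=
      (hg x).comp (tendsto_atTop_add_const_left _ _ tendsto_natCast_atTop_atTop)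
    have := dist_le_of_le_geometric_of_tendsto₀ ρ _ hρ1 (hstep x j) ht
    rw [dist_eq_norm] at this
    simp only [Nat.cast_zero, add_zero] at this
    refine this.trans (le_of_eq ?_)
    ring
  refine ⟨g, ?_, (2 * (2 * C₁ / (1 - ρ)) + 2 * C₁ * 2 ^ α) * 2 ^ α, fun x h hh => ?_⟩
  · filter_upwards [IsUnifLocDoublingMeasure.ae_tendsto_average volume hb 1] with x hx
    have hδ : Tendsto (fun j : ℤ => (2 : ℝ) ^ (-j)) atTop (𝓝[>] 0) := by
      refine tendsto_nhdsWithin_iff.2 ⟨?_, .of_forall fun j => by simp; positivity⟩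
      rw [← Nat.map_cast_int_atTop, tendsto_map'_iff]
      simpa [Function.comp_def] using tendsto_inv_atTop_zero.comp
        (tendsto_pow_atTop_atTop_of_one_lt (one_lt_two (α := ℝ)))
    exact tendsto_nhds_unique (hx (fun _ => x) _ hδ (.of_forall fun j => by
      simp; positivity)) (hg x)
  · have hd : 0 < ‖h‖ := norm_pos_iff.2 hh
    -- The dyadic radius `R = 2^(k+1)` satisfies `‖h‖ < R ≤ 2 ‖h‖`, so the balls of radius `R` about
    -- `x` and `x + h` both lie in the ball of radius `2 R` about `x`.
    obtain ⟨k, hk1, hk2⟩ := exists_mem_Ico_zpow hd (one_lt_two (α := ℝ))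
    set R : ℝ := 2 ^ (k + 1) with hR
    have hR0 : 0 < R := by positivity
    have hRd : R ≤ 2 * ‖h‖ := by
      rw [hR, zpow_add₀ two_ne_zero, zpow_one]; linarith
    have b1 := hdist x (-(k + 1))
    have b2 := hdist (x + h) (-(k + 1))
    rw [neg_neg, ← hR] at b1 b2
    have b3 : ‖a x (-(k + 1)) - a (x + h) (-(k + 1))‖ ≤ 2 * C₁ * (2 * R) ^ α := by
      simp only [ha, neg_neg, ← hR]
      refine h1 x x (x + h) (2 * R) R R hR0 hR0 (by linarith) (by linarith) (by linarith)
        (Metric.closedBall_subset_closedBall (by linarith))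
        (Metric.closedBall_subset_closedBall' ?_)
      rw [dist_eq_norm, add_sub_cancel_left]
      linarith
    rw [div_le_iff₀ (by positivity)]
    calc ‖g (x + h) - g x‖ = ‖(a x (-(k + 1)) - g x) - (a x (-(k + 1)) - a (x + h) (-(k + 1)))
          - (a (x + h) (-(k + 1)) - g (x + h))‖ := by congr 1; ring
      _ ≤ 2 * C₁ / (1 - ρ) * R ^ α + 2 * C₁ * (2 * R) ^ α + 2 * C₁ / (1 - ρ) * R ^ α :=
          (norm_sub_le _ _).trans (add_le_add ((norm_sub_le _ _).trans (add_le_add b1 b3)) b2)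
      _ = (2 * (2 * C₁ / (1 - ρ)) + 2 * C₁ * 2 ^ α) * R ^ α := by
          rw [Real.mul_rpow two_pos.le hR0.le]; ring
      _ ≤ (2 * (2 * C₁ / (1 - ρ)) + 2 * C₁ * 2 ^ α) * (2 * ‖h‖) ^ α := by
          have : 0 < 1 - ρ := by linarith
          gcongr
      _ = _ := by rw [Real.mul_rpow two_pos.le hd.le]; ring

/-! ### Inclusions between Morrey and weak Morrey spaces -/

theorem CommutatorBounded.mono {b : Rn n → ℂ} {N₁ N₂ N₃ : (Rn n → ℂ) → ℝ≥0∞}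
    (h : CommutatorBounded Ω b N₁ N₂)
    (hN : ∀ F, AEStronglyMeasurable F volume → N₃ F ≤ N₂ F) : CommutatorBounded Ω b N₁ N₃ := by
  obtain ⟨C, hC⟩ := h
  refine ⟨C, fun f hf => ?_⟩
  obtain ⟨h1, h2, ⟨h3, h4⟩, h5⟩ := hC f hf
  exact ⟨h1, h2, ⟨h3, (hN _ h3).trans_lt h4⟩, (hN _ h3).trans h5⟩

theorem morreyNorm_le_morreyNorm {s t l : ℝ} (ht : 0 < t) (htl : t ≤ l)
    {F : Rn n → ℂ} (hF : AEStronglyMeasurable F volume) :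
    morreyNorm s t F ≤ morreyNorm s l F := by
  refine iSup_le fun x => iSup_le fun r => iSup_le fun hr => ?_
  refine le_trans ?_ (le_iSup_of_le x (le_iSup_of_le r (le_iSup_of_le hr le_rfl)))
  set V := volume (cube x r) with hV
  have hV' : V = ENNReal.ofReal ((2 * r) ^ n) := volume_cube x hr.le
  have hV0 : V ≠ 0 := by rw [hV']; exact (ENNReal.ofReal_pos.2 (by positivity)).ne'
  have hVt : V ≠ ⊤ := by rw [hV']; exact ENNReal.ofReal_ne_top
  have h := eLpNorm'_le_eLpNorm'_mul_rpow_measure_univ ht htl (hF.restrict (s := cube x r))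
  simp only [eLpNorm', Measure.restrict_apply_univ, ← hV] at h
  calc (V ^ (1 / t - 1 / s))⁻¹ * (∫⁻ y in cube x r, ‖F y‖ₑ ^ t) ^ (1 / t)
      ≤ (V ^ (1 / t - 1 / s))⁻¹ *
        ((∫⁻ y in cube x r, ‖F y‖ₑ ^ l) ^ (1 / l) * V ^ (1 / t - 1 / l)) := by gcongr
    _ = _ := by
        rw [← ENNReal.rpow_neg, ← ENNReal.rpow_neg, mul_left_comm, ← ENNReal.rpow_add _ _ hV0 hVt,
          mul_comm]
        congr 2; ring

theorem weakMorreyNorm_le_morreyNorm {s t : ℝ} (ht : 0 < t)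
    {F : Rn n → ℂ} (hF : AEStronglyMeasurable F volume) :
    weakMorreyNorm s t F ≤ morreyNorm s t F := by
  refine iSup_le fun x => iSup_le fun r => iSup_le fun hr => ?_
  refine le_trans ?_ (le_iSup_of_le x (le_iSup_of_le r (le_iSup_of_le hr le_rfl)))
  gcongr
  refine iSup_le fun c => iSup_le fun hc => ?_
  gcongr
  have h := mul_meas_ge_le_lintegral₀ (μ := volume.restrict (cube x r))
    (hF.enorm.restrict.pow_const t) ((c : ℝ≥0∞) ^ t)
  refine le_trans ?_ h
  refine mul_le_mul_right ?_ _
  rw [Measure.restrict_apply' (measurableSet_cube x r)]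
  refine measure_mono fun y hy => ⟨?_, hy.1⟩
  exact ENNReal.rpow_le_rpow hy.2.le ht.le

/-! ### The Hardy–Littlewood maximal function -/

/-- The centred Hardy–Littlewood maximal function over balls. -/
def maximal (F : Rn n → ℝ≥0∞) (x : Rn n) : ℝ≥0∞ :=
  ⨆ (r : ℝ) (_ : 0 < r), (∫⁻ y in Metric.ball x r, F y) / ENNReal.ofReal (unitBallVolume n * r ^ n)

theorem lintegral_ball_le_maximal (F : Rn n → ℝ≥0∞) (x : Rn n) {r : ℝ} (hr : 0 < r) :
    ∫⁻ y in Metric.ball x r, F y ≤ maximal F x * ENNReal.ofReal (unitBallVolume n * r ^ n) := by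
  have hv := unitBallVolume_pos (n := n)
  rw [← ENNReal.div_le_iff (ENNReal.ofReal_pos.2 (by positivity)).ne' ENNReal.ofReal_ne_top]
  exact le_iSup_of_le r (le_iSup_of_le hr le_rfl)

theorem lt_maximal_iff {F : Rn n → ℝ≥0∞} {x : Rn n} {c : ℝ≥0∞} :
    c < maximal F x ↔ ∃ r : ℝ, 0 < r ∧
      c * ENNReal.ofReal (unitBallVolume n * r ^ n) < ∫⁻ y in Metric.ball x r, F y := by
  have hv := unitBallVolume_pos (n := n)
  simp only [maximal, lt_iSup_iff, exists_prop]
  refine exists_congr fun r => and_congr_right fun hr => ?_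
  rw [ENNReal.lt_div_iff_mul_lt (.inl (ENNReal.ofReal_pos.2 (by positivity)).ne')
    (.inl ENNReal.ofReal_ne_top)]

/-- A strict inequality for radius `r` survives a slight enlargement of `r` in the volume factor,
and the enlarged ball about a nearby point contains the original one. -/
theorem isOpen_lt_maximal (F : Rn n → ℝ≥0∞) (c : ℝ≥0∞) : IsOpen {x | c < maximal F x} := by
  rw [isOpen_iff_mem_nhds]
  intro x hx
  obtain ⟨r, hr, h⟩ := lt_maximal_iff.1 hx
  have hcne : c ≠ ⊤ := (lt_of_lt_of_le (show c < maximal F x from hx) le_top).ne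
  have hcont : Tendsto (fun ρ : ℝ => c * ENNReal.ofReal (unitBallVolume n * ρ ^ n)) (𝓝[>] r)
      (𝓝 (c * ENNReal.ofReal (unitBallVolume n * r ^ n))) := by
    refine ENNReal.Tendsto.const_mul ?_ (.inr hcne)
    exact (ENNReal.continuous_ofReal.comp (by fun_prop)).continuousWithinAt
  obtain ⟨ρ, hρ, hρr⟩ := ((hcont.eventually_lt_const h).and self_mem_nhdsWithin).exists
  have hρr' : r < ρ := hρr
  filter_upwards [Metric.ball_mem_nhds x (sub_pos.2 hρr')] with z hz
  refine lt_maximal_iff.2 ⟨ρ, hr.trans hρr', hρ.trans_le (lintegral_mono_set ?_)⟩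
  refine Metric.ball_subset_ball' ?_
  rw [Metric.mem_ball, dist_comm] at hz
  linarith

theorem measurable_maximal (F : Rn n → ℝ≥0∞) : Measurable (maximal F) :=
  measurable_of_Ioi fun c => (isOpen_lt_maximal F c).measurableSet

/-- The weak (1,1) inequality by Vitali's covering lemma with enlargement factor `5`. -/
theorem measure_lt_maximal_le (hn : 1 ≤ n) (F : Rn n → ℝ≥0∞) {c : ℝ} (hc : 0 < c) :
    ENNReal.ofReal c * volume {x | ENNReal.ofReal c < maximal F x} ≤ 5 ^ n * ∫⁻ y, F y := by
  have hv := unitBallVolume_pos (n := n)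
  rcases eq_or_ne (∫⁻ y, F y) ⊤ with htop | hfin
  · rw [htop, ENNReal.mul_top (by simp)]; exact le_top
  set E := {x | ENNReal.ofReal c < maximal F x} with hE
  choose! r hr0 hr using fun x (hx : x ∈ E) => lt_maximal_iff.1 hx
  set D := (∫⁻ y, F y).toReal with hD
  -- The covering lemma needs bounded radii. Finiteness of the integral bounds `r ^ n`, and `r ≤ r ^
  -- n` when `r ≥ 1`.
  have hbd : ∀ x ∈ E, r x ≤ max 1 (D / (c * unitBallVolume n)) := by
    intro x hx
    rcases le_total (r x) 1 with h1 | h1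
    · exact h1.trans (le_max_left _ _)
    refine le_trans ?_ (le_max_right _ _)
    have h2 := (hr x hx).le.trans (setLIntegral_le_lintegral _ _)
    rw [← ENNReal.ofReal_mul hc.le] at h2
    have h3 := ENNReal.ofReal_le_iff_le_toReal hfin |>.1 h2
    rw [le_div_iff₀ (by positivity)]
    calc r x * (c * unitBallVolume n) ≤ r x ^ n * (c * unitBallVolume n) := by
          gcongr
          exact le_self_pow₀ h1 (by omega)
      _ ≤ D := by rw [hD]; linarith
  obtain ⟨u, huE, hdisj, hcov⟩ := Vitali.exists_disjoint_subfamily_covering_enlargement_closedBall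
    E (fun x => x) r _ hbd 5 (by norm_num)
  have hucount : u.Countable := by
    refine hdisj.countable_of_nonempty_interior fun x hx => ?_
    rw [interior_closedBall _ (hr0 x (huE hx)).ne']
    exact Metric.nonempty_ball.2 (hr0 x (huE hx))
  have hdisj' : u.PairwiseDisjoint fun x => Metric.ball x (r x) := fun x hx y hy hxy =>
    (hdisj hx hy hxy).mono Metric.ball_subset_closedBall Metric.ball_subset_closedBall
  have hsub : E ⊆ ⋃ x ∈ u, Metric.closedBall x (5 * r x) := fun x hx => by
    obtain ⟨y, hy, hxy⟩ := hcov x hx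
    exact Set.mem_biUnion hy (hxy (Metric.mem_closedBall_self (hr0 x hx).le))
  calc ENNReal.ofReal c * volume E
      ≤ ENNReal.ofReal c * ∑' x : u, volume (Metric.closedBall (x : Rn n) (5 * r x)) := by
        gcongr
        exact (measure_mono hsub).trans (measure_biUnion_le volume hucount _)
    _ = ∑' x : u, 5 ^ n * (ENNReal.ofReal c * ENNReal.ofReal (unitBallVolume n * r x ^ n)) := by
        rw [← ENNReal.tsum_mul_left]
        congr 1; ext x
        have := hr0 x (huE x.2)
        rw [volume_closedBall _ (by positivity), mul_pow, mul_left_comm,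
          ENNReal.ofReal_mul (by positivity), ENNReal.ofReal_pow (by norm_num)]
        simp only [ENNReal.ofReal_ofNat]
        ring
    _ ≤ ∑' x : u, 5 ^ n * ∫⁻ y in Metric.ball (x : Rn n) (r x), F y := by
        gcongr with x
        exact (hr x (huE x.2)).le
    _ = 5 ^ n * ∫⁻ y in ⋃ x ∈ u, Metric.ball x (r x), F y := by
        rw [ENNReal.tsum_mul_left,
          lintegral_biUnion hucount (fun x _ => measurableSet_ball) hdisj']
    _ ≤ _ := by gcongr; exact Measure.restrict_le_self

theorem maximal_mono {F G : Rn n → ℝ≥0∞} (h : ∀ x, F x ≤ G x) (x : Rn n) :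
    maximal F x ≤ maximal G x := by
  unfold maximal
  gcongr with r hr y
  exact h y

theorem maximal_add_le {F G : Rn n → ℝ≥0∞} (hF : Measurable F) (x : Rn n) :
    maximal (fun y => F y + G y) x ≤ maximal F x + maximal G x := by
  refine iSup_le fun r => iSup_le fun hr => ?_
  rw [lintegral_add_left hF, ENNReal.add_div]
  exact add_le_add (le_iSup_of_le r (le_iSup_of_le hr le_rfl))
    (le_iSup_of_le r (le_iSup_of_le hr le_rfl))

theorem maximal_const_le (c : ℝ≥0∞) (x : Rn n) : maximal (fun _ => c) x ≤ c := by
  refine iSup_le fun r => iSup_le fun hr => ?_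
  rw [setLIntegral_const, volume_ball x hr]
  exact ENNReal.div_le_of_le_mul le_rfl

theorem lintegral_Ioi_indicator_lt {a : ℝ} (ha : 0 < a) {g : ℝ} (hg : 0 ≤ g) :
    ∫⁻ s in Set.Ioi (0 : ℝ), (Set.Iio g).indicator (fun s => ENNReal.ofReal (s ^ (a - 1))) s =
      ENNReal.ofReal (g ^ a / a) := by
  rw [setLIntegral_indicator measurableSet_Iio, Set.Iio_inter_Ioi,
    ← ofReal_integral_eq_lintegral_ofReal]
  · rw [← integral_Ioc_eq_integral_Ioo, ← intervalIntegral.integral_of_le hg,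
      integral_rpow (.inl (by linarith))]
    simp [Real.zero_rpow ha.ne']
  · change IntegrableOn _ _ _
    rw [← integrableOn_Ioc_iff_integrableOn_Ioo,
      ← intervalIntegrable_iff_integrableOn_Ioc_of_le hg]
    exact intervalIntegral.intervalIntegrable_rpow' (by linarith)
  · exact (ae_restrict_iff' measurableSet_Ioo).2 (.of_forall fun s hs =>
      Real.rpow_nonneg hs.1.le _)

theorem rpow_le_lintegral_Ioi {a : ℝ} (ha : 0 < a) (G : ℝ≥0∞) :
    G ^ a ≤ ENNReal.ofReal a * ∫⁻ s in Set.Ioi (0 : ℝ),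
      {s : ℝ | ENNReal.ofReal s < G}.indicator (fun s => ENNReal.ofReal (s ^ (a - 1))) s := by
  have key : ∀ g : ℝ≥0, (g : ℝ≥0∞) ≤ G → (g : ℝ≥0∞) ^ a ≤ ENNReal.ofReal a *
      ∫⁻ s in Set.Ioi (0 : ℝ),
      {s : ℝ | ENNReal.ofReal s < G}.indicator (fun s => ENNReal.ofReal (s ^ (a - 1))) s := by
    intro g hg
    have h1 := lintegral_Ioi_indicator_lt ha g.2
    calc (g : ℝ≥0∞) ^ a = ENNReal.ofReal a * ENNReal.ofReal ((g : ℝ) ^ a / a) := by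
          rw [← ENNReal.ofReal_mul ha.le, mul_div_cancel₀ _ ha.ne',
            ← ENNReal.ofReal_rpow_of_nonneg (NNReal.coe_nonneg g) ha.le]
          simp
      _ ≤ _ := by
          rw [← NNReal.val_eq_coe, ← h1]
          refine mul_le_mul_right (setLIntegral_mono' measurableSet_Ioi fun s hs => ?_) _
          by_cases h : s < g
          · have h2 : s ∈ {s : ℝ | ENNReal.ofReal s < G} := by
              refine lt_of_lt_of_le ?_ hg
              rw [← ENNReal.ofReal_coe_nnreal]
              exact (ENNReal.ofReal_lt_ofReal_iff (lt_trans hs h)).2 h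
            rw [Set.indicator_of_mem h2, Set.indicator_of_mem (by exact h)]
          · rw [Set.indicator_of_notMem (by exact h)]
            exact zero_le
  rcases eq_or_ne G ⊤ with rfl | hG
  -- When `G` is infinite, the bound for every finite `g ≤ G` forces the right side to be infinite.
  · refine le_top.trans (ENNReal.eq_top_of_forall_nnreal_le fun r => ?_).ge
    have := key (r ^ (1 / a)) le_top
    rw [← ENNReal.coe_rpow_of_nonneg _ ha.le, ← NNReal.rpow_mul, one_div, inv_mul_cancel₀ ha.ne',
      NNReal.rpow_one] at this
    exact this
  · lift G to ℝ≥0 using hG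
    exact key G le_rfl

/-- Cut `F` at height `s / 2`: the lower part contributes at most `s / 2` to the maximal function,
so only the upper part enters the weak-type bound. This is the Marcinkiewicz interpolation step,
weighted for integration in `s`. -/
theorem volume_lt_maximal_mul_le (hn : 1 ≤ n) {F : Rn n → ℝ≥0∞} (hF : Measurable F)
    {s : ℝ} (hs : 0 < s) (a : ℝ) :
    ENNReal.ofReal (s ^ (a - 1)) * volume {x | ENNReal.ofReal s < maximal F x} ≤
      2 * 5 ^ n * ∫⁻ x, {y | ENNReal.ofReal s < 2 * F y}.indicator F x *
        ENNReal.ofReal (s ^ (a - 2)) := by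
  set G := {y | ENNReal.ofReal s < 2 * F y}.indicator F with hG
  have hm : MeasurableSet {y | ENNReal.ofReal s < 2 * F y} :=
    measurableSet_lt measurable_const (hF.const_mul _)
  have hGm : Measurable G := hF.indicator hm
  have hs2 : ENNReal.ofReal s = 2 * ENNReal.ofReal (s / 2) := by
    rw [← ENNReal.ofReal_ofNat, ← ENNReal.ofReal_mul (by norm_num), mul_div_cancel₀ _ two_ne_zero]
  have hsub : {x | ENNReal.ofReal s < maximal F x} ⊆ {x | ENNReal.ofReal (s / 2) < maximal G x} := by
    intro x hx
    by_contra hx'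
    refine absurd (show ENNReal.ofReal s < maximal F x from hx) (not_lt.2 ?_)
    calc maximal F x ≤ maximal (fun y => G y + ENNReal.ofReal (s / 2)) x := by
          refine maximal_mono (fun y => ?_) x
          by_cases hy : y ∈ {y | ENNReal.ofReal s < 2 * F y}
          · rw [hG, Set.indicator_of_mem hy]; exact le_self_add
          · rw [hG, Set.indicator_of_notMem hy, zero_add]
            have : 2 * F y ≤ 2 * ENNReal.ofReal (s / 2) := by rw [← hs2]; exact not_lt.1 hy
            exact (ENNReal.mul_le_mul_iff_right (by simp) (by simp)).1 this
      _ ≤ maximal G x + maximal (fun _ => ENNReal.ofReal (s / 2)) x := maximal_add_le hGm x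
      _ ≤ ENNReal.ofReal (s / 2) + ENNReal.ofReal (s / 2) :=
          add_le_add (not_lt.1 hx') (maximal_const_le _ x)
      _ = ENNReal.ofReal s := by rw [hs2, two_mul]
  have hw := measure_lt_maximal_le hn G (half_pos hs)
  have e : ENNReal.ofReal (s ^ (a - 1)) =
      2 * ENNReal.ofReal (s ^ (a - 2)) * ENNReal.ofReal (s / 2) := by
    rw [mul_right_comm, ← hs2, ← ENNReal.ofReal_mul hs.le, mul_comm s,
      ← Real.rpow_add_one hs.ne']
    congr 2; ring
  calc ENNReal.ofReal (s ^ (a - 1)) * volume {x | ENNReal.ofReal s < maximal F x}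
      ≤ ENNReal.ofReal (s ^ (a - 1)) * volume {x | ENNReal.ofReal (s / 2) < maximal G x} := by
        gcongr
    _ = 2 * ENNReal.ofReal (s ^ (a - 2)) *
        (ENNReal.ofReal (s / 2) * volume {x | ENNReal.ofReal (s / 2) < maximal G x}) := by
        rw [e, mul_assoc]
    _ ≤ 2 * ENNReal.ofReal (s ^ (a - 2)) * (5 ^ n * ∫⁻ x, G x) := by gcongr
    _ = _ := by rw [lintegral_mul_const _ hGm]; ring

/-- The Hardy–Littlewood maximal theorem. -/
theorem lintegral_maximal_rpow_le (hn : 1 ≤ n) {q : ℝ} (hq : 1 < q) {F : Rn n → ℝ≥0∞}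
    (hF : Measurable F) (hF' : ∀ x, F x ≠ ⊤) :
    ∫⁻ x, maximal F x ^ q ≤
      ENNReal.ofReal (q * (2 * 5 ^ n * (2 ^ (q - 1) / (q - 1)))) * ∫⁻ x, F x ^ q := by
  have hq0 : 0 < q := by linarith
  have hq1 : 0 < q - 1 := by linarith
  have hmeas : ∀ {G : Rn n → ℝ≥0∞}, Measurable G → ∀ c : ℝ,
      Measurable (Function.uncurry fun (x : Rn n) (s : ℝ) =>
      {s : ℝ | ENNReal.ofReal s < G x}.indicator (fun s => ENNReal.ofReal (s ^ c)) s) := by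
    intro G hG c
    have : (Function.uncurry fun (x : Rn n) (s : ℝ) =>
        {s : ℝ | ENNReal.ofReal s < G x}.indicator (fun s => ENNReal.ofReal (s ^ c)) s) =
        {z : Rn n × ℝ | ENNReal.ofReal z.2 < G z.1}.indicator
          (fun z => ENNReal.ofReal (z.2 ^ c)) := by
      ext ⟨x, s⟩
      simp [Set.indicator, Function.uncurry]
    rw [this]
    exact (ENNReal.measurable_ofReal.comp (measurable_snd.pow_const c)).indicator
      (measurableSet_lt (ENNReal.measurable_ofReal.comp measurable_snd) (hG.comp measurable_fst))
  have e1 : ∀ s : ℝ, ∫⁻ x : Rn n, {s : ℝ | ENNReal.ofReal s < maximal F x}.indicator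
      (fun s => ENNReal.ofReal (s ^ (q - 1))) s =
      ENNReal.ofReal (s ^ (q - 1)) * volume {x | ENNReal.ofReal s < maximal F x} := by
    intro s
    rw [← lintegral_indicator_const (isOpen_lt_maximal F _).measurableSet]
    rfl
  have e2 : ∀ x, ∫⁻ s in Set.Ioi (0 : ℝ), {y | ENNReal.ofReal s < 2 * F y}.indicator F x *
      ENNReal.ofReal (s ^ (q - 2)) = ENNReal.ofReal (2 ^ (q - 1) / (q - 1)) * F x ^ q := by
    intro x
    obtain ⟨g, hg⟩ : ∃ g : ℝ≥0, F x = g := ⟨(F x).toNNReal, (ENNReal.coe_toNNReal (hF' x)).symm⟩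
    have hg2 : 2 * F x = ENNReal.ofReal (2 * g) := by
      rw [hg, ENNReal.ofReal_mul (by norm_num)]; simp
    calc _ = ∫⁻ s in Set.Ioi (0 : ℝ), F x * (Set.Iio (2 * (g : ℝ))).indicator
          (fun s => ENNReal.ofReal (s ^ (q - 1 - 1))) s := by
          refine setLIntegral_congr_fun measurableSet_Ioi fun s hs => ?_
          have hiff : ENNReal.ofReal s < 2 * F x ↔ s < 2 * (g : ℝ) := by
            rw [hg2, ENNReal.ofReal_lt_ofReal_iff_of_nonneg (le_of_lt hs)]
          rw [show q - 1 - 1 = q - 2 by ring]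
          by_cases h : s < 2 * (g : ℝ)
          · rw [Set.indicator_of_mem (by exact hiff.2 h), Set.indicator_of_mem (by exact h)]
          · rw [Set.indicator_of_notMem (by exact fun h' => h (hiff.1 h')),
              Set.indicator_of_notMem (by exact h), zero_mul, mul_zero]
      _ = F x * ENNReal.ofReal ((2 * g) ^ (q - 1) / (q - 1)) := by
          rw [lintegral_const_mul' _ _ (hF' x), lintegral_Ioi_indicator_lt hq1 (by positivity)]
      _ = _ := by
          rw [hg, Real.mul_rpow (by norm_num) (NNReal.coe_nonneg g), mul_div_right_comm,
            ENNReal.ofReal_mul (by positivity), mul_left_comm,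
            ← ENNReal.ofReal_rpow_of_nonneg (NNReal.coe_nonneg g) hq1.le, ENNReal.ofReal_coe_nnreal]
          congr 1
          nth_rw 1 [← ENNReal.rpow_one (g : ℝ≥0∞)]
          rw [← ENNReal.rpow_add_of_nonneg _ _ zero_le_one hq1.le]
          congr 1; ring
  calc ∫⁻ x, maximal F x ^ q
      ≤ ∫⁻ x, ENNReal.ofReal q * ∫⁻ s in Set.Ioi (0 : ℝ),
        {s : ℝ | ENNReal.ofReal s < maximal F x}.indicator
          (fun s => ENNReal.ofReal (s ^ (q - 1))) s :=
        lintegral_mono fun x => rpow_le_lintegral_Ioi hq0 _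
    _ = ENNReal.ofReal q * ∫⁻ s in Set.Ioi (0 : ℝ),
        ENNReal.ofReal (s ^ (q - 1)) * volume {x | ENNReal.ofReal s < maximal F x} := by
        rw [lintegral_const_mul' _ _ ENNReal.ofReal_ne_top,
          lintegral_lintegral_swap (hmeas (measurable_maximal F) _).aemeasurable]
        simp_rw [e1]
    _ ≤ ENNReal.ofReal q * ∫⁻ s in Set.Ioi (0 : ℝ), 2 * 5 ^ n *
        ∫⁻ x, {y | ENNReal.ofReal s < 2 * F y}.indicator F x * ENNReal.ofReal (s ^ (q - 2)) := by
        refine mul_le_mul_right (setLIntegral_mono' measurableSet_Ioi fun s hs => ?_) _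
        exact volume_lt_maximal_mul_le hn hF (Set.mem_Ioi.1 hs) q
    _ = ENNReal.ofReal q * (2 * 5 ^ n * ∫⁻ x, ENNReal.ofReal (2 ^ (q - 1) / (q - 1)) * F x ^ q) := by
        rw [lintegral_const_mul' _ _ (by finiteness), lintegral_lintegral_swap]
        · simp_rw [e2]
        · have h := ((hF.comp measurable_fst).mul (hmeas (hF.const_mul 2) (q - 2))).comp
            (measurable_swap (α := ℝ) (β := Rn n))
          refine Measurable.aemeasurable ?_
          convert h using 1
          ext ⟨s, x⟩
          by_cases h : ENNReal.ofReal s < 2 * F x <;>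
            simp [Function.uncurry, Set.indicator, h]
    _ = _ := by
        rw [lintegral_const_mul' _ _ ENNReal.ofReal_ne_top, ENNReal.ofReal_mul hq0.le,
          ENNReal.ofReal_mul (by positivity), ENNReal.ofReal_mul (by norm_num),
          ENNReal.ofReal_pow (by norm_num)]
        simp only [ENNReal.ofReal_ofNat]
        ring

/-! ### Fractional integrals on Morrey spaces -/

theorem lintegral_Ioi_rpow_mul_le {α d p M N : ℝ} (hα : 0 < α) (hd : 0 < d) (hp : 0 < p)
    (hβ : 0 < d / p - α) (hM : 0 < M) (hN : 0 < N) {φ : ℝ → ℝ≥0∞}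
    (h1 : ∀ R, 0 < R → φ R ≤ ENNReal.ofReal (M * R ^ d))
    (h2 : ∀ R, 0 < R → φ R ≤ ENNReal.ofReal (N * R ^ (d - d / p))) :
    ∫⁻ R in Set.Ioi (0 : ℝ), ENNReal.ofReal (R ^ (α - d - 1)) * φ R ≤
      ENNReal.ofReal ((1 / α + 1 / (d / p - α)) * (N ^ (α * p / d) * M ^ (1 - α * p / d))) := by
  set β := d / p - α with hβd
  -- The radius where the two bounds `M R^d` and `N R^(d - d/p)` coincide. Below it the first is
  -- integrable against the weight because `α > 0`, above it the second because `d/p > α`.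
  set R₀ := (N / M) ^ (p / d) with hR₀
  have hR₀0 : 0 < R₀ := by positivity
  have i1 : ∫⁻ R in Set.Ioc 0 R₀, ENNReal.ofReal (R ^ (α - d - 1)) * φ R ≤
      ENNReal.ofReal (M * (R₀ ^ α / α)) := by
    have hint : IntegrableOn (fun R : ℝ => R ^ (α - 1)) (Set.Ioc 0 R₀) := by
      rw [← intervalIntegrable_iff_integrableOn_Ioc_of_le hR₀0.le]
      exact intervalIntegral.intervalIntegrable_rpow' (by linarith)
    have e : ∫ R in Set.Ioc 0 R₀, M * R ^ (α - 1) = M * (R₀ ^ α / α) := by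
      rw [integral_const_mul, ← intervalIntegral.integral_of_le hR₀0.le,
        integral_rpow (.inl (by linarith))]
      simp [Real.zero_rpow hα.ne']
    rw [← e, ofReal_integral_eq_lintegral_ofReal (hint.const_mul M)
      ((ae_restrict_iff' measurableSet_Ioc).2 (.of_forall fun R hR => by
        have := hR.1; positivity))]
    refine setLIntegral_mono' measurableSet_Ioc fun R hR => ?_
    have hR' : 0 < R := hR.1
    refine (mul_le_mul_right (h1 R hR') _).trans ?_
    rw [← ENNReal.ofReal_mul (by positivity)]
    refine ENNReal.ofReal_le_ofReal (le_of_eq ?_)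
    rw [mul_left_comm, ← Real.rpow_add hR']
    congr 2; ring
  have i2 : ∫⁻ R in Set.Ioi R₀, ENNReal.ofReal (R ^ (α - d - 1)) * φ R ≤
      ENNReal.ofReal (N * (R₀ ^ (-β) / β)) := by
    have hint : IntegrableOn (fun R : ℝ => R ^ (-β - 1)) (Set.Ioi R₀) :=
      integrableOn_Ioi_rpow_of_lt (by linarith) hR₀0
    have e : ∫ R in Set.Ioi R₀, N * R ^ (-β - 1) = N * (R₀ ^ (-β) / β) := by
      rw [integral_const_mul, integral_Ioi_rpow_of_lt (by linarith) hR₀0, sub_add_cancel,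
        neg_div_neg_eq]
    rw [← e, ofReal_integral_eq_lintegral_ofReal (hint.const_mul N)
      ((ae_restrict_iff' measurableSet_Ioi).2 (.of_forall fun R hR => by
        have : 0 < R := hR₀0.trans hR
        positivity))]
    refine setLIntegral_mono' measurableSet_Ioi fun R hR => ?_
    have hR' : 0 < R := hR₀0.trans hR
    refine (mul_le_mul_right (h2 R hR') _).trans ?_
    rw [← ENNReal.ofReal_mul (by positivity)]
    refine ENNReal.ofReal_le_ofReal (le_of_eq ?_)
    rw [mul_left_comm, ← Real.rpow_add hR', hβd]
    congr 2; ring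
  rw [← Set.Ioc_union_Ioi_eq_Ioi hR₀0.le, lintegral_union measurableSet_Ioi
    (Set.disjoint_left.2 fun c h1 h2 => not_lt.2 h1.2 h2)]
  refine (add_le_add i1 i2).trans ?_
  rw [← ENNReal.ofReal_add (by positivity) (by positivity)]
  refine ENNReal.ofReal_le_ofReal (le_of_eq ?_)
  have a1 : M * R₀ ^ α = N ^ (α * p / d) * M ^ (1 - α * p / d) := by
    rw [hR₀, ← Real.rpow_mul (by positivity), Real.div_rpow hN.le hM.le, Real.rpow_sub hM,
      Real.rpow_one, show p / d * α = α * p / d by ring]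
    field_simp
  have a2 : N * R₀ ^ (-β) = N ^ (α * p / d) * M ^ (1 - α * p / d) := by
    have : p / d * -β = α * p / d - 1 := by rw [hβd]; field_simp; ring
    rw [hR₀, ← Real.rpow_mul (by positivity), this, Real.div_rpow hN.le hM.le, Real.rpow_sub hN,
      Real.rpow_one, show 1 - α * p / d = -(α * p / d - 1) by ring, Real.rpow_neg hM.le]
    field_simp
  rw [← mul_div_assoc, ← mul_div_assoc, a1, a2]
  ring

/-- The fractional integral `∫ |x - y|^(α - n) F(y) dy`. -/
def riesz (α : ℝ) (F : Rn n → ℝ≥0∞) (x : Rn n) : ℝ≥0∞ :=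
  ∫⁻ y, ENNReal.ofReal (‖x - y‖ ^ (α - n)) * F y

/-- Write `|x - y|^(α - n)` as `(n - α)` times the integral of `R^(α - n - 1)` over `R > |x - y|`
and exchange the integrals. -/
theorem riesz_le_lintegral {α : ℝ} (hα : α < n) {F : Rn n → ℝ≥0∞} (hF : Measurable F) (x : Rn n) :
    riesz α F x ≤ ENNReal.ofReal (n - α) * ∫⁻ R in Set.Ioi (0 : ℝ),
      ENNReal.ofReal (R ^ (α - n - 1)) * ∫⁻ y in Metric.ball x R, F y := by
  have hpt : ∀ y, ENNReal.ofReal (‖x - y‖ ^ (α - n)) ≤ ENNReal.ofReal (n - α) *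
      ∫⁻ R in Set.Ioi (0 : ℝ), (Set.Ioi ‖x - y‖).indicator
        (fun R => ENNReal.ofReal (R ^ (α - n - 1))) R := by
    intro y
    rcases eq_or_ne x y with rfl | hxy
    -- On the diagonal the negative power of zero is zero by convention, so the bound is trivial.
    · simp [Real.zero_rpow (sub_ne_zero.2 hα.ne)]
    have hc : 0 < ‖x - y‖ := norm_pos_iff.2 (sub_ne_zero.2 hxy)
    have hint : IntegrableOn (fun R : ℝ => R ^ (α - n - 1)) (Set.Ioi ‖x - y‖) :=
      integrableOn_Ioi_rpow_of_lt (by linarith) hc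
    rw [setLIntegral_indicator measurableSet_Ioi, Set.inter_eq_self_of_subset_left
      (Set.Ioi_subset_Ioi hc.le), ← ofReal_integral_eq_lintegral_ofReal hint
      ((ae_restrict_iff' measurableSet_Ioi).2 (.of_forall fun R hR => by
        have : 0 < R := hc.trans hR
        positivity)), integral_Ioi_rpow_of_lt (by linarith) hc, sub_add_cancel,
      ← ENNReal.ofReal_mul (by linarith)]
    refine ENNReal.ofReal_le_ofReal (le_of_eq ?_)
    have : α - n ≠ 0 := sub_ne_zero.2 hα.ne
    field_simp
    ring
  have hm : Measurable (Function.uncurry fun (y : Rn n) (R : ℝ) => (Set.Ioi ‖x - y‖).indicator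
        (fun R => ENNReal.ofReal (R ^ (α - n - 1))) R * F y) := by
    refine Measurable.mul ?_ (hF.comp measurable_fst)
    have : (fun z : Rn n × ℝ => (Set.Ioi ‖x - z.1‖).indicator
        (fun R => ENNReal.ofReal (R ^ (α - n - 1))) z.2) =
        {z : Rn n × ℝ | ‖x - z.1‖ < z.2}.indicator
          (fun z => ENNReal.ofReal (z.2 ^ (α - n - 1))) := by
      ext ⟨y, R⟩
      simp [Set.indicator]
    rw [this]
    exact (ENNReal.measurable_ofReal.comp (measurable_snd.pow_const _)).indicator
      (measurableSet_lt (by fun_prop) measurable_snd)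
  calc riesz α F x ≤ ∫⁻ y, ENNReal.ofReal (n - α) *
        ∫⁻ R in Set.Ioi (0 : ℝ), (Set.Ioi ‖x - y‖).indicator
          (fun R => ENNReal.ofReal (R ^ (α - n - 1))) R * F y := by
        refine lintegral_mono fun y => ?_
        simp only
        rw [lintegral_mul_const]
        · rw [← mul_assoc]; gcongr; exact hpt y
        · exact (ENNReal.measurable_ofReal.comp (measurable_id.pow_const _)).indicator
            measurableSet_Ioi
    _ = _ := by
        rw [lintegral_const_mul' _ _ ENNReal.ofReal_ne_top, lintegral_lintegral_swap hm.aemeasurable]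
        congr 1
        refine setLIntegral_congr_fun measurableSet_Ioi fun R hR => ?_
        rw [← lintegral_const_mul' _ _ ENNReal.ofReal_ne_top, ← lintegral_indicator measurableSet_ball]
        refine lintegral_congr fun y => ?_
        have : y ∈ Metric.ball x R ↔ R ∈ Set.Ioi ‖x - y‖ := by
          rw [mem_ball_iff_norm, norm_sub_rev, Set.mem_Ioi]
        by_cases h : R ∈ Set.Ioi ‖x - y‖
        · rw [Set.indicator_of_mem h, Set.indicator_of_mem (this.2 h)]
        · rw [Set.indicator_of_notMem h, Set.indicator_of_notMem (fun h' => h (this.1 h')), zero_mul]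

theorem lintegral_ball_le_of_rpow {p q N : ℝ} (hq : 1 < q) (hN : 0 < N) {F : Rn n → ℝ≥0∞}
    (hF : Measurable F) (hFN : ∀ (x : Rn n) (R : ℝ), 0 < R →
      ∫⁻ y in Metric.ball x R, F y ^ q ≤ ENNReal.ofReal (N ^ q * R ^ (n * (1 - q / p))))
    (x : Rn n) {R : ℝ} (hR : 0 < R) :
    ∫⁻ y in Metric.ball x R, F y ≤
      ENNReal.ofReal (unitBallVolume n ^ (1 - 1 / q) * N * R ^ ((n : ℝ) - n / p)) := by
  have hv := unitBallVolume_pos (n := n)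
  have hq0 : 0 < q := by linarith
  have h := eLpNorm'_le_eLpNorm'_mul_rpow_measure_univ one_pos hq.le
    (μ := volume.restrict (Metric.ball x R)) (f := F) hF.aestronglyMeasurable
  simp only [eLpNorm', enorm_eq_self, ENNReal.rpow_one, div_one, Measure.restrict_apply_univ,
    volume_ball x hR] at h
  refine h.trans ?_
  refine (mul_le_mul_left (ENNReal.rpow_le_rpow (hFN x R hR) (by positivity)) _).trans ?_
  have h0 : 0 ≤ 1 - 1 / q := by
    rw [sub_nonneg, div_le_one hq0]; exact hq.le
  rw [ENNReal.ofReal_rpow_of_nonneg (by positivity) (by positivity),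
    ENNReal.ofReal_rpow_of_nonneg (by positivity) h0, ← ENNReal.ofReal_mul (by positivity)]
  refine ENNReal.ofReal_le_ofReal (le_of_eq ?_)
  rw [Real.mul_rpow (by positivity) (by positivity), Real.mul_rpow (by positivity) (by positivity),
    ← Real.rpow_mul hN.le, mul_one_div_cancel hq0.ne', Real.rpow_one, ← Real.rpow_mul hR.le,
    ← Real.rpow_natCast R n, ← Real.rpow_mul hR.le,
    show (n : ℝ) - n / p = n * (1 - q / p) * (1 / q) + n * (1 - 1 / q) by field_simp; ring,
    Real.rpow_add hR]
  ring

/-- From a point of the inner ball, balls of radius at most `R` do not reach the far part. Larger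
balls have averages of order `N r^(-n/p)`, decreasing in `r`. -/
theorem maximal_indicator_compl_le {p N C : ℝ} (hp : 0 < p) (hN : 0 < N) (hC : 0 ≤ C)
    {F : Rn n → ℝ≥0∞} (hF : ∀ (x : Rn n) (R : ℝ), 0 < R →
      ∫⁻ y in Metric.ball x R, F y ≤ ENNReal.ofReal (C * N * R ^ ((n : ℝ) - n / p)))
    {x₀ x : Rn n} {R : ℝ} (hR : 0 < R) (hx : x ∈ Metric.ball x₀ R) :
    maximal ((Metric.ball x₀ (2 * R))ᶜ.indicator F) x ≤
      ENNReal.ofReal (C / unitBallVolume n * N * R ^ (-(n / p))) := by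
  have hv := unitBallVolume_pos (n := n)
  refine iSup_le fun r => iSup_le fun hr => ?_
  refine ENNReal.div_le_of_le_mul ?_
  rcases le_total r R with h | h
  · have hz : ∫⁻ y in Metric.ball x r, (Metric.ball x₀ (2 * R))ᶜ.indicator F y = 0 := by
      rw [← lintegral_indicator measurableSet_ball, ← lintegral_zero]
      refine lintegral_congr fun y => ?_
      by_cases hy : y ∈ Metric.ball x r
      · rw [Set.indicator_of_mem hy, Set.indicator_of_notMem]
        rw [Set.notMem_compl_iff]
        rw [Metric.mem_ball] at hx hy ⊢
        linarith [dist_triangle y x x₀]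
      · rw [Set.indicator_of_notMem hy]
    rw [hz]; exact zero_le
  · refine (lintegral_mono (fun y => Set.indicator_le_self _ _ _)).trans ((hF x r hr).trans ?_)
    rw [← ENNReal.ofReal_mul (by positivity)]
    refine ENNReal.ofReal_le_ofReal ?_
    rw [sub_eq_add_neg, Real.rpow_add hr, Real.rpow_natCast]
    have h1 : r ^ (-((n : ℝ) / p)) ≤ R ^ (-((n : ℝ) / p)) :=
      Real.rpow_le_rpow_of_nonpos hR h (neg_nonpos.2 (by positivity))
    calc C * N * (r ^ n * r ^ (-((n : ℝ) / p))) ≤ C * N * (r ^ n * R ^ (-((n : ℝ) / p))) := by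
          gcongr
      _ = _ := by field_simp

/-- The maximal operator preserves the Morrey growth condition: split `F` at the doubled ball, use
the `L^q` maximal theorem on the near part and the uniform bound on the far part. -/
theorem exists_lintegral_maximal_rpow_le (hn : 1 ≤ n) {p q : ℝ} (hq : 1 < q) (hp : 0 < p) :
    ∃ C : ℝ, 0 < C ∧ ∀ (N : ℝ) (F : Rn n → ℝ≥0∞), 0 < N → Measurable F → (∀ x, F x ≠ ⊤) →
      (∀ (x : Rn n) (R : ℝ), 0 < R →
        ∫⁻ y in Metric.ball x R, F y ^ q ≤ ENNReal.ofReal (N ^ q * R ^ (n * (1 - q / p)))) →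
      ∀ (x : Rn n) (R : ℝ), 0 < R →
        ∫⁻ y in Metric.ball x R, maximal F y ^ q ≤
          ENNReal.ofReal (C * N ^ q * R ^ (n * (1 - q / p))) := by
  have hv := unitBallVolume_pos (n := n)
  have hq0 : 0 < q := by linarith
  have hq1 : 0 < q - 1 := by linarith
  set C₁ := q * (2 * 5 ^ n * (2 ^ (q - 1) / (q - 1))) with hC₁
  set C₂ := unitBallVolume n ^ (1 - 1 / q) / unitBallVolume n with hC₂
  have hC₂0 : 0 < C₂ := by positivity
  refine ⟨2 ^ (q - 1) * (C₁ * 2 ^ (n * (1 - q / p)) + C₂ ^ q * unitBallVolume n), by positivity,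
    fun N F hN hF hF' hFN x R hR => ?_⟩
  set B := Metric.ball x (2 * R) with hB
  have hBm : MeasurableSet B := measurableSet_ball
  have hpt : ∀ y ∈ Metric.ball x R, maximal F y ^ q ≤ ENNReal.ofReal (2 ^ (q - 1)) *
      (maximal (B.indicator F) y ^ q + ENNReal.ofReal ((C₂ * N * R ^ (-(n / p))) ^ q)) := by
    intro y hy
    have h1 : maximal F y ≤ maximal (B.indicator F) y + maximal (Bᶜ.indicator F) y := by
      refine le_trans (le_of_eq ?_) (maximal_add_le (hF.indicator hBm) y)
      congr 1; ext z
      exact congrFun (Set.indicator_self_add_compl B F).symm z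
    have h2 := maximal_indicator_compl_le hp hN (by positivity)
      (fun x R hR => lintegral_ball_le_of_rpow hq hN hF hFN x hR) hR hy
    rw [← hB, ← hC₂] at h2
    calc maximal F y ^ q ≤ (maximal (B.indicator F) y +
          ENNReal.ofReal (C₂ * N * R ^ (-(n / p)))) ^ q := by
          gcongr
          exact h1.trans (by gcongr)
      _ ≤ _ := by
          refine (ENNReal.rpow_add_le_mul_rpow_add_rpow _ _ hq.le).trans (le_of_eq ?_)
          rw [ENNReal.ofReal_rpow_of_nonneg (by positivity) hq0.le,
            ← ENNReal.ofReal_rpow_of_pos two_pos, ENNReal.ofReal_ofNat]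
  have hloc : ∫⁻ y, (B.indicator F y) ^ q = ∫⁻ y in B, F y ^ q := by
    rw [← lintegral_indicator hBm]
    refine lintegral_congr fun y => ?_
    by_cases hy : y ∈ B <;> simp [hy, hq0]
  calc ∫⁻ y in Metric.ball x R, maximal F y ^ q
      ≤ ∫⁻ y in Metric.ball x R, ENNReal.ofReal (2 ^ (q - 1)) *
        (maximal (B.indicator F) y ^ q + ENNReal.ofReal ((C₂ * N * R ^ (-(n / p))) ^ q)) :=
        setLIntegral_mono' measurableSet_ball hpt
    _ = ENNReal.ofReal (2 ^ (q - 1)) * ((∫⁻ y in Metric.ball x R, maximal (B.indicator F) y ^ q) +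
        ENNReal.ofReal ((C₂ * N * R ^ (-(n / p))) ^ q) *
          ENNReal.ofReal (unitBallVolume n * R ^ n)) := by
        rw [lintegral_const_mul' _ _ ENNReal.ofReal_ne_top, lintegral_add_right _ measurable_const,
          setLIntegral_const, volume_ball x hR]
    _ ≤ ENNReal.ofReal (2 ^ (q - 1)) * (ENNReal.ofReal C₁ *
        ENNReal.ofReal (N ^ q * (2 * R) ^ (n * (1 - q / p))) +
        ENNReal.ofReal ((C₂ * N * R ^ (-(n / p))) ^ q) *
          ENNReal.ofReal (unitBallVolume n * R ^ n)) := by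
        gcongr
        refine (setLIntegral_le_lintegral _ _).trans
          ((lintegral_maximal_rpow_le hn hq (hF.indicator hBm) fun y => ?_).trans ?_)
        · by_cases hy : y ∈ B <;> simp [hy, hF' y]
        · rw [hloc]
          gcongr
          exact hFN x _ (by positivity)
    _ = _ := by
        rw [← ENNReal.ofReal_mul (by positivity), ← ENNReal.ofReal_mul (by positivity),
          ← ENNReal.ofReal_add (by positivity) (by positivity), ← ENNReal.ofReal_mul (by positivity)]
        congr 1
        have e : (C₂ * N * R ^ (-(n / p))) ^ q * (unitBallVolume n * R ^ n) =
            C₂ ^ q * unitBallVolume n * (N ^ q * R ^ (n * (1 - q / p))) := by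
          rw [Real.mul_rpow (by positivity) (by positivity), Real.mul_rpow (by positivity) hN.le,
            ← Real.rpow_mul hR.le, show (n : ℝ) * (1 - q / p) = -(n / p) * q + n by ring,
            Real.rpow_add hR, Real.rpow_natCast]
          ring
        rw [e, Real.mul_rpow two_pos.le hR.le]
        ring

/-- Hedberg's inequality. Ball integrals of `F` have two bounds, one through the maximal function
and one through the Morrey growth, and the fractional integral is optimised between them. -/
theorem exists_riesz_le (hn : 1 ≤ n) {α p q : ℝ} (hα : 0 < α) (hα1 : α < 1) (hq : 1 < q)
    (hp : 0 < p) (hβ : 0 < (n : ℝ) / p - α) :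
    ∃ C : ℝ, 0 < C ∧ ∀ (N : ℝ) (F : Rn n → ℝ≥0∞), 0 < N → Measurable F →
      (∀ (x : Rn n) (R : ℝ), 0 < R →
        ∫⁻ y in Metric.ball x R, F y ^ q ≤ ENNReal.ofReal (N ^ q * R ^ (n * (1 - q / p)))) →
      ∀ x, riesz α F x ≤
        ENNReal.ofReal (C * N ^ (α * p / n)) * maximal F x ^ (1 - α * p / n) := by
  have hv := unitBallVolume_pos (n := n)
  have hn0 : (0 : ℝ) < n := by exact_mod_cast hn
  have hαn : α < n := hα1.trans_le (by exact_mod_cast hn)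
  have hκ : 0 < 1 - α * p / n := by
    rw [sub_pos, div_lt_one hn0]
    rw [sub_pos, lt_div_iff₀ hp] at hβ
    exact hβ
  set v := unitBallVolume n
  set D := v ^ (1 - 1 / q) with hD
  have hD0 : 0 < D := by positivity
  have hnα : 0 < n - α := by linarith
  refine ⟨(n - α) * ((1 / α + 1 / (n / p - α)) * (D ^ (α * p / n) * v ^ (1 - α * p / n))),
    by positivity, fun N F hN hF hFN x => ?_⟩
  refine (riesz_le_lintegral hαn hF x).trans ?_
  have h2 : ∀ R, 0 < R → ∫⁻ y in Metric.ball x R, F y ≤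
      ENNReal.ofReal (D * N * R ^ ((n : ℝ) - n / p)) :=
    fun R hR => lintegral_ball_le_of_rpow hq hN hF hFN x hR
  rcases eq_or_ne (maximal F x) 0 with h0 | h0
  · have hz : ∀ R ∈ Set.Ioi (0 : ℝ),
        ENNReal.ofReal (R ^ (α - n - 1)) * ∫⁻ y in Metric.ball x R, F y = 0 := by
      intro R hR
      have := lintegral_ball_le_maximal F x (Set.mem_Ioi.1 hR)
      rw [h0, zero_mul, nonpos_iff_eq_zero] at this
      rw [this, mul_zero]
    rw [setLIntegral_congr_fun measurableSet_Ioi hz]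
    simp
  rcases eq_or_ne (maximal F x) ⊤ with ht | ht
  · rw [ht, ENNReal.top_rpow_of_pos hκ, ENNReal.mul_top]
    · exact le_top
    · exact (ENNReal.ofReal_pos.2 (by positivity)).ne'
  obtain ⟨M, hM⟩ : ∃ M : ℝ≥0, maximal F x = M := ⟨_, (ENNReal.coe_toNNReal ht).symm⟩
  have hM0 : 0 < M := by
    rw [hM] at h0
    exact pos_iff_ne_zero.2 (by simpa using h0)
  have h1 : ∀ R, 0 < R → ∫⁻ y in Metric.ball x R, F y ≤ ENNReal.ofReal (M * v * R ^ (n : ℝ)) := by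
    intro R hR
    refine (lintegral_ball_le_maximal F x hR).trans (le_of_eq ?_)
    rw [hM, ← ENNReal.ofReal_coe_nnreal, ← ENNReal.ofReal_mul (NNReal.coe_nonneg M), mul_assoc,
      Real.rpow_natCast]
  have hM' : (0 : ℝ) < M := hM0
  refine (mul_le_mul_right (lintegral_Ioi_rpow_mul_le hα hn0 hp hβ (M := M * v) (N := D * N)
    (by positivity) (by positivity) h1 h2) _).trans (le_of_eq ?_)
  rw [hM, ← ENNReal.ofReal_coe_nnreal, ENNReal.ofReal_rpow_of_nonneg hM'.le hκ.le,
    ← ENNReal.ofReal_mul hnα.le, ← ENNReal.ofReal_mul (by positivity),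
    Real.mul_rpow hM'.le hv.le, Real.mul_rpow hD0.le hN.le]
  congr 1
  ring

theorem lintegral_ball_rpow_le_of_morreyNorm_le {p q N : ℝ} (hq : 1 < q) (hqp : q ≤ p)
    (hN : 0 < N) {f : Rn n → ℂ} (h : morreyNorm p q f ≤ ENNReal.ofReal N) (x : Rn n) {R : ℝ}
    (hR : 0 < R) :
    ∫⁻ y in Metric.ball x R, ‖f y‖ₑ ^ q ≤
      ENNReal.ofReal ((N * (2 ^ n) ^ (1 / q - 1 / p)) ^ q * R ^ (n * (1 - q / p))) := by
  have hq0 : 0 < q := by linarith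
  have hp0 : 0 < p := by linarith
  have h1 : (volume (cube x R) ^ (1 / q - 1 / p))⁻¹ * (∫⁻ y in cube x R, ‖f y‖ₑ ^ q) ^ (1 / q)
      ≤ ENNReal.ofReal N := by
    refine le_trans ?_ h
    refine le_iSup_of_le x (le_iSup_of_le R ?_)
    rw [iSup_pos hR]
  have hV0 : 0 < (2 * R) ^ n := by positivity
  rw [volume_cube x hR.le, ENNReal.ofReal_rpow_of_pos hV0, mul_comm, ← div_eq_mul_inv,
    ENNReal.div_le_iff (ENNReal.ofReal_pos.2 (by positivity)).ne' ENNReal.ofReal_ne_top,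
    ← ENNReal.ofReal_mul hN.le] at h1
  have h2 := ENNReal.rpow_le_rpow h1 hq0.le
  rw [← ENNReal.rpow_mul, one_div, inv_mul_cancel₀ hq0.ne', ENNReal.rpow_one,
    ENNReal.ofReal_rpow_of_nonneg (by positivity) hq0.le] at h2
  refine (lintegral_mono_set (ball_subset_cube x R)).trans (h2.trans (le_of_eq ?_))
  congr 1
  have e : ((2 : ℝ) ^ n * R ^ n) ^ (q⁻¹ - 1 / p) =
      (2 ^ n) ^ (q⁻¹ - 1 / p) * R ^ (n * (q⁻¹ - 1 / p)) := by
    rw [Real.mul_rpow (by positivity) (by positivity), Real.rpow_mul hR.le, Real.rpow_natCast]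
  rw [mul_pow, e, one_div q, ← mul_assoc,
    Real.mul_rpow (x := N * (2 ^ n) ^ (q⁻¹ - 1 / p)) (by positivity) (by positivity),
    ← Real.rpow_mul hR.le]
  congr 2
  field_simp

/-- Adams' theorem. The exponent relations make the `l`-th power of Hedberg's bound proportional to
`(M F)^q`, whose ball integrals are known. Finiteness almost everywhere comes out of the same bound
and later gives absolute convergence. -/
theorem exists_morreyNorm_le_of_riesz (hn : 1 ≤ n) {α p q s l : ℝ} (hα : 0 < α) (hα1 : α < 1)
    (hq : 1 < q) (hqp : q ≤ p) (hl : 1 < l) (hls : l ≤ s) (hs_eq : 1 / s = 1 / p - α / (n : ℝ))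
    (hl_eq : l / s = q / p) (C₀ : ℝ) (hC₀ : 0 ≤ C₀) :
    ∃ C : ℝ, 0 < C ∧ ∀ (N : ℝ) (f : Rn n → ℂ), 0 < N → AEStronglyMeasurable f volume →
      morreyNorm p q f ≤ ENNReal.ofReal N →
      (∀ᵐ x, riesz α (fun y => ‖f y‖ₑ) x < ⊤) ∧ ∀ g : Rn n → ℂ,
      (∀ᵐ x, ‖g x‖ₑ ≤ ENNReal.ofReal C₀ * riesz α (fun y => ‖f y‖ₑ) x) →
        morreyNorm s l g ≤ ENNReal.ofReal (C * N) := by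
  have hn0 : (0 : ℝ) < n := by exact_mod_cast hn
  have hq0 : 0 < q := by linarith
  have hp0 : 0 < p := by linarith
  have hl0 : 0 < l := by linarith
  have hs0 : 0 < s := by linarith
  have hβs : (n : ℝ) / p - α = n / s := by
    have : (n : ℝ) / s = n * (1 / s) := by ring
    rw [this, hs_eq]; field_simp
  have hκs : 1 - α * p / n = p / s := by
    have : p / s = p * (1 / s) := by ring
    rw [this, hs_eq]; field_simp
  have hκl : p / s * l = q := by
    rw [div_mul_eq_mul_div, mul_div_assoc, hl_eq]; field_simp
  have hκ1 : α * p / n = 1 - p / s := by linarith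
  obtain ⟨C₁, hC₁, H₁⟩ := exists_riesz_le hn hα hα1 hq hp0 (by rw [hβs]; positivity)
  obtain ⟨C₂, hC₂, H₂⟩ := exists_lintegral_maximal_rpow_le hn hq hp0
  set D := ((2 : ℝ) ^ n) ^ (1 / q - 1 / p) with hD
  have hD0 : 0 < D := by positivity
  -- `C₀ + 1` rather than `C₀` keeps the constant positive. The power of `n ^ n` pays for covering a
  -- cube of half-side `r` by a ball of radius `2 n r`.
  set E := (C₀ + 1) * C₁ * C₂ ^ (1 / l) * D * ((n : ℝ) ^ n) ^ (1 / l - 1 / s) with hE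
  refine ⟨E, by positivity, fun N f hN hf hfN => ?_⟩
  obtain ⟨f', hf'm, hff'⟩ := hf
  set F : Rn n → ℝ≥0∞ := fun y => ‖f' y‖ₑ with hF
  have hFm : Measurable F := hf'm.measurable.enorm
  have hr : ∀ x, riesz α (fun y => ‖f y‖ₑ) x = riesz α F x := fun x =>
    lintegral_congr_ae (hff'.mono fun y hy => by simp only [hF, hy])
  have hFN : ∀ (x : Rn n) (R : ℝ), 0 < R →
      ∫⁻ y in Metric.ball x R, F y ^ q ≤ ENNReal.ofReal ((N * D) ^ q * R ^ (n * (1 - q / p))) := by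
    intro x R hR
    refine le_trans (le_of_eq ?_) (lintegral_ball_rpow_le_of_morreyNorm_le hq hqp hN hfN x hR)
    exact lintegral_congr_ae (ae_restrict_of_ae (hff'.mono fun y hy => by simp only [hF, hy]))
  have hND : 0 < N * D := by positivity
  have hR1 := H₁ (N * D) F hND hFm hFN
  have hR2 := H₂ (N * D) F hND hFm (fun x => enorm_ne_top) hFN
  rw [hκs, hκ1] at hR1
  have hps : 0 < p / s := by positivity
  constructor
  · have hfin : ∀ k : ℕ, ∀ᵐ x, x ∈ Metric.ball (0 : Rn n) (k + 1) → maximal F x ^ q < ⊤ := by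
      intro k
      rw [← ae_restrict_iff' measurableSet_ball]
      refine ae_lt_top ((measurable_maximal F).pow_const q) ?_
      exact ((hR2 0 (k + 1) (by positivity)).trans_lt ENNReal.ofReal_lt_top).ne
    filter_upwards [ae_all_iff.2 hfin] with x hx
    rw [hr]
    obtain ⟨k, hk⟩ := exists_nat_gt ‖x‖
    have h1 := hx k (mem_ball_zero_iff.2 (by linarith))
    have h2 : maximal F x < ⊤ := by
      by_contra h
      rw [not_lt_top_iff.1 h, ENNReal.top_rpow_of_pos hq0] at h1
      exact lt_irrefl _ h1
    refine (hR1 x).trans_lt (ENNReal.mul_lt_top ENNReal.ofReal_lt_top ?_)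
    exact ENNReal.rpow_lt_top_of_nonneg hps.le h2.ne
  · intro g hg
    refine iSup_le fun x => iSup_le fun r => iSup_le fun hr0 => ?_
    set A := (C₀ + 1) * (C₁ * (N * D) ^ (1 - p / s)) with hA
    have hA0 : 0 < A := by positivity
    have hpt : ∀ᵐ y, ‖g y‖ₑ ^ l ≤ ENNReal.ofReal (A ^ l) * maximal F y ^ q := by
      filter_upwards [hg] with y hy
      rw [hr] at hy
      calc ‖g y‖ₑ ^ l ≤ (ENNReal.ofReal A * maximal F y ^ (p / s)) ^ l := by
            gcongr
            refine hy.trans ?_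
            rw [hA, ENNReal.ofReal_mul (by positivity), mul_assoc]
            gcongr
            · linarith
            · exact hR1 y
        _ = _ := by
            rw [ENNReal.mul_rpow_of_nonneg _ _ hl0.le, ← ENNReal.rpow_mul, hκl,
              ENNReal.ofReal_rpow_of_pos hA0]
    have hsub : cube x r ⊆ Metric.ball x (2 * n * r) :=
      (cube_subset_closedBall x hr0.le).trans (Metric.closedBall_subset_ball (by
        have : 0 < n * r := by positivity
        nlinarith))
    have hJ : ∫⁻ y in cube x r, ‖g y‖ₑ ^ l ≤
        ENNReal.ofReal (A ^ l * (C₂ * (N * D) ^ q * (2 * n * r) ^ (n * (1 - q / p)))) := by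
      calc ∫⁻ y in cube x r, ‖g y‖ₑ ^ l
          ≤ ∫⁻ y in cube x r, ENNReal.ofReal (A ^ l) * maximal F y ^ q :=
            lintegral_mono_ae (ae_restrict_of_ae hpt)
        _ ≤ ∫⁻ y in Metric.ball x (2 * n * r), ENNReal.ofReal (A ^ l) * maximal F y ^ q :=
            lintegral_mono_set hsub
        _ ≤ _ := by
            rw [lintegral_const_mul' _ _ ENNReal.ofReal_ne_top, ENNReal.ofReal_mul (by positivity)]
            gcongr
            exact hR2 x _ (by positivity)
    have hV0 : 0 < (2 * r) ^ n := by positivity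
    rw [volume_cube x hr0.le, ENNReal.ofReal_rpow_of_pos hV0, mul_comm, ← div_eq_mul_inv,
      ENNReal.div_le_iff (ENNReal.ofReal_pos.2 (by positivity)).ne' ENNReal.ofReal_ne_top,
      ← ENNReal.ofReal_mul (by positivity)]
    refine (ENNReal.rpow_le_rpow hJ (by positivity)).trans ?_
    rw [ENNReal.ofReal_rpow_of_nonneg (by positivity) (by positivity)]
    refine ENNReal.ofReal_le_ofReal (le_of_eq ?_)
    have e1 : (n : ℝ) * (1 - q / p) * (1 / l) = n * (1 / l - 1 / s) := by
      rw [← hl_eq]; field_simp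
    have e2 : ((2 * n * r) ^ ((n : ℝ) * (1 - q / p))) ^ (1 / l) =
        ((n : ℝ) ^ n) ^ (1 / l - 1 / s) * ((2 * r) ^ n) ^ (1 / l - 1 / s) := by
      rw [← Real.rpow_mul (by positivity), e1, Real.rpow_mul (by positivity), Real.rpow_natCast,
        show 2 * (n : ℝ) * r = n * (2 * r) by ring, mul_pow,
        Real.mul_rpow (by positivity) (by positivity)]
    have e3 : ((N * D) ^ q) ^ (1 / l) = (N * D) ^ (p / s) := by
      rw [← Real.rpow_mul hND.le, ← hκl]
      congr 1; field_simp
    have e4 : (A ^ l) ^ (1 / l) = A := by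
      rw [← Real.rpow_mul hA0.le, mul_one_div_cancel hl0.ne', Real.rpow_one]
    have e5 : (N * D) ^ (1 - p / s) * (N * D) ^ (p / s) = N * D := by
      rw [← Real.rpow_add hND, sub_add_cancel, Real.rpow_one]
    rw [Real.mul_rpow (x := A ^ l) (by positivity) (by positivity),
      Real.mul_rpow (x := C₂ * (N * D) ^ q) (by positivity) (by positivity),
      Real.mul_rpow (x := C₂) (by positivity) (by positivity), e2, e3, e4, hA, hE]
    calc _ = (C₀ + 1) * C₁ * C₂ ^ (1 / l) * ((N * D) ^ (1 - p / s) * (N * D) ^ (p / s)) *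
          (((n : ℝ) ^ n) ^ (1 / l - 1 / s) * ((2 * r) ^ n) ^ (1 / l - 1 / s)) := by ring
      _ = _ := by rw [e5]; ring

/-! ### Weak convergence through the Fourier transform -/

open scoped FourierTransform SchwartzMap InnerProductSpace in
-- By Plancherel the pairing becomes an integral in which only the multiplier `𝓕 (κ N)` varies. It
-- converges boundedly, so dominated convergence applies and `G` is read off from the limiting
-- multiplier.
theorem exists_weak_limit_of_fourier (κ : ℕ → 𝓢(Rn n, ℂ)) {C : ℝ}
    (hC : ∀ N ξ, ‖𝓕 (κ N) ξ‖ ≤ C) (hlim : ∀ ξ, ∃ m, Tendsto (fun N => 𝓕 (κ N) ξ) atTop (𝓝 m))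
    {h : Rn n → ℂ} (hh : MemLp h 2 volume) :
    ∃ G : Rn n → ℂ, MemLp G 2 volume ∧ ∀ ψ : 𝓢(Rn n, ℂ),
      Tendsto (fun N => ∫ y, h y * ∫ z, κ N (y - z) * ψ z) atTop (𝓝 (∫ z, G z * ψ z)) := by
  choose m hm using hlim
  have hmC : ∀ ξ, ‖m ξ‖ ≤ C := fun ξ =>
    le_of_tendsto (hm ξ).norm (.of_forall fun N => hC N ξ)
  have hmm : AEStronglyMeasurable m volume :=
    aestronglyMeasurable_of_tendsto_ae atTop
      (fun N => (𝓕 (κ N)).continuous.aestronglyMeasurable) (.of_forall hm)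
  -- The inner product conjugates its first argument, hence the conjugates on `h`, on the multiplier
  -- and on the final `G`.
  have hc : MemLp (fun y => (starRingEnd ℂ) (h y)) 2 volume :=
    hh.of_le (Complex.continuous_conj.comp_aestronglyMeasurable hh.1)
      (.of_forall fun y => by simp)
  set H : Lp ℂ 2 (volume : Measure (Rn n)) := hc.toLp _ with hH
  set P : Lp ℂ 2 (volume : Measure (Rn n)) := 𝓕 H with hP
  have hQ : MemLp (fun ξ => (starRingEnd ℂ) (m ξ) * P ξ) 2 volume := by
    refine (Lp.memLp P).of_le_mul (c := C)
      ((Complex.continuous_conj.comp_aestronglyMeasurable hmm).mul (Lp.aestronglyMeasurable P))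
      (.of_forall fun ξ => ?_)
    rw [norm_mul, RCLike.norm_conj]
    gcongr
    exact hmC ξ
  set Q : Lp ℂ 2 (volume : Measure (Rn n)) := hQ.toLp _ with hQdef
  set G : Lp ℂ 2 (volume : Measure (Rn n)) := 𝓕⁻ Q with hG
  have hGQ : 𝓕 G = Q := by simp [hG]
  refine ⟨fun z => (starRingEnd ℂ) (G z), (Lp.memLp G).of_le
    (Complex.continuous_conj.comp_aestronglyMeasurable (Lp.aestronglyMeasurable G))
    (.of_forall fun y => by simp), fun ψ => ?_⟩
  have e1 : ∀ N, ∫ y, h y * ∫ z, κ N (y - z) * ψ z =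
      ∫ ξ, (starRingEnd ℂ) (P ξ) * (𝓕 (κ N) ξ * 𝓕 ψ ξ) := by
    intro N
    set g := SchwartzMap.convolution (ContinuousLinearMap.mul ℂ ℂ) (κ N) ψ with hg
    have hgy : ∀ y, ∫ z, κ N (y - z) * ψ z = g y := by
      intro y
      rw [hg, SchwartzMap.convolution_apply, convolution_eq_swap]
      rfl
    have hgF : ∀ ξ, 𝓕 g ξ = 𝓕 (κ N) ξ * 𝓕 ψ ξ := by
      intro ξ
      rw [hg, SchwartzMap.fourier_convolution]
      rfl
    have h1 : ∫ y, h y * ∫ z, κ N (y - z) * ψ z = ⟪H, g.toLp 2⟫_ℂ := by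
      rw [L2.inner_def]
      refine integral_congr_ae ?_
      filter_upwards [hc.coeFn_toLp, g.coeFn_toLp 2] with y hy1 hy2
      rw [hy2, hH, hy1, hgy]
      simp [mul_comm]
    rw [h1, ← Lp.inner_fourier_eq, SchwartzMap.toLp_fourier_eq, L2.inner_def]
    refine integral_congr_ae ?_
    filter_upwards [(𝓕 g).coeFn_toLp 2] with ξ hξ
    rw [hξ, ← hP, hgF]
    simp [mul_comm]
  have e2 : ∫ z, (starRingEnd ℂ) (G z) * ψ z = ∫ ξ, (starRingEnd ℂ) (P ξ) * (m ξ * 𝓕 ψ ξ) := by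
    have h1 : ∫ z, (starRingEnd ℂ) (G z) * ψ z = ⟪G, ψ.toLp 2⟫_ℂ := by
      rw [L2.inner_def]
      refine integral_congr_ae ?_
      filter_upwards [ψ.coeFn_toLp 2] with y hy
      rw [hy]
      simp [mul_comm]
    rw [h1, ← Lp.inner_fourier_eq, hGQ, SchwartzMap.toLp_fourier_eq, L2.inner_def]
    refine integral_congr_ae ?_
    filter_upwards [(𝓕 ψ).coeFn_toLp 2, hQ.coeFn_toLp] with ξ hξ hξ2
    rw [hξ, hQdef, hξ2]
    simp only [RCLike.inner_apply, map_mul, RCLike.conj_conj]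
    ring
  simp_rw [e1]
  rw [e2]
  have hPψ : Integrable (fun ξ => ‖P ξ‖ * ‖𝓕 ψ ξ‖) volume :=
    (Lp.memLp P).norm.integrable_mul ((𝓕 ψ).memLp 2 volume).norm
  refine tendsto_integral_of_dominated_convergence (fun ξ => C * (‖P ξ‖ * ‖𝓕 ψ ξ‖))
    (fun N => ?_) (hPψ.const_mul C) (fun N => .of_forall fun ξ => ?_) (.of_forall fun ξ => ?_)
  · exact (Complex.continuous_conj.comp_aestronglyMeasurable (Lp.aestronglyMeasurable P)).mul
      ((𝓕 (κ N)).continuous.mul (𝓕 ψ).continuous).aestronglyMeasurable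
  · rw [norm_mul, norm_mul, RCLike.norm_conj]
    calc ‖P ξ‖ * (‖𝓕 (κ N) ξ‖ * ‖𝓕 ψ ξ‖) ≤ ‖P ξ‖ * (C * ‖𝓕 ψ ξ‖) := by
          gcongr
          exact hC N ξ
      _ = _ := by ring
  · exact ((hm ξ).mul_const _).const_mul _

open scoped FourierTransform SchwartzMap in
-- Mean zero makes the transform vanish at the origin, and it is Lipschitz; decay at infinity is
-- that of a Schwartz function. Together these make the dilates of `φ` almost orthogonal.
theorem exists_norm_fourier_le (φ : 𝓢(Rn n, ℂ)) (hφ : ∫ x, φ x = 0) :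
    ∃ C : ℝ, 0 ≤ C ∧ ∀ ξ, ‖𝓕 φ ξ‖ ≤ C * ‖ξ‖ ∧ ‖𝓕 φ ξ‖ * ‖ξ‖ ≤ C := by
  obtain ⟨C₁, -, h₁⟩ := (𝓕 φ).decay 0 1
  obtain ⟨C₂, -, h₂⟩ := (𝓕 φ).decay 1 0
  have h0 : 𝓕 φ 0 = 0 := by
    rw [SchwartzMap.fourier_coe, Real.fourier_eq]
    simpa using hφ
  refine ⟨max (max C₁ C₂) 0, le_max_right _ _, fun ξ => ⟨?_, ?_⟩⟩
  · have := convex_univ.norm_image_sub_le_of_norm_fderiv_le (𝕜 := ℝ)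
      (f := ((𝓕 φ : 𝓢(Rn n, ℂ)) : Rn n → ℂ)) (C := C₁) (fun x _ => (𝓕 φ).differentiableAt) (fun x _ => by
        have := h₁ x
        rwa [pow_zero, one_mul, norm_iteratedFDeriv_one] at this) (Set.mem_univ 0) (Set.mem_univ ξ)
    rw [h0, sub_zero, sub_zero] at this
    refine this.trans ?_
    gcongr
    exact (le_max_left _ _).trans (le_max_left _ _)
  · have := h₂ ξ
    rw [pow_one, norm_iteratedFDeriv_zero, mul_comm] at this
    exact this.trans ((le_max_right _ _).trans (le_max_left _ _))

theorem sum_min_pow_le {a : ℝ} (ha : 0 < a) (N : ℕ) :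
    ∑ j ∈ Finset.range N, min (a / 2 ^ j) (2 ^ j / a) ≤ 12 := by
  -- A bounded function whose dyadic increments `θ (2 u) - θ u` dominate `min u (1 / u)` up to a
  -- factor, so that the sum telescopes.
  set θ : ℝ → ℝ := fun u => u / (1 + u) with hθ
  have key : ∀ u : ℝ, 0 < u → min u (1 / u) ≤ 6 * (θ (2 * u) - θ u) := by
    intro u hu
    have e : θ (2 * u) - θ u = u / ((1 + u) * (1 + 2 * u)) := by
      simp only [hθ]
      field_simp
      ring
    rw [e, ← mul_div_assoc, le_div_iff₀ (by positivity)]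
    rcases le_total u 1 with h | h
    · calc min u (1 / u) * ((1 + u) * (1 + 2 * u)) ≤ u * ((1 + u) * (1 + 2 * u)) := by
            gcongr; exact min_le_left _ _
        _ ≤ u * 6 := by gcongr; nlinarith
        _ = _ := by ring
    · calc min u (1 / u) * ((1 + u) * (1 + 2 * u)) ≤ 1 / u * ((1 + u) * (1 + 2 * u)) := by
            gcongr; exact min_le_right _ _
        _ ≤ 1 / u * (6 * u * u) := by
            have : (1 + u) * (1 + 2 * u) ≤ 6 * u * u := by nlinarith
            gcongr
        _ = _ := by field_simp
  have h1 : ∀ j : ℕ, min (a / 2 ^ j) (2 ^ j / a) ≤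
      6 * θ (2 * (a / 2 ^ j)) - 6 * θ (2 * (a / 2 ^ (j + 1))) := by
    intro j
    have := key (a / 2 ^ j) (by positivity)
    rw [one_div_div] at this
    have e : 2 * (a / 2 ^ (j + 1)) = a / 2 ^ j := by field_simp; ring
    rw [e]
    linarith
  refine (Finset.sum_le_sum fun j _ => h1 j).trans ?_
  rw [Finset.sum_range_sub' (fun j => 6 * θ (2 * (a / 2 ^ j)))]
  have h2 : ∀ u : ℝ, 0 < u → 0 ≤ θ u ∧ θ u ≤ 1 := fun u hu =>
    ⟨by positivity, by simp only [hθ]; rw [div_le_one (by positivity)]; linarith⟩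
  have h3 := h2 (2 * (a / 2 ^ 0)) (by positivity)
  have h4 := h2 (2 * (a / 2 ^ N)) (by positivity)
  linarith

open scoped FourierTransform SchwartzMap RealInnerProductSpace in
theorem fourier_comp_smul (φ : Rn n → ℂ) {c : ℝ} (hc : c ≠ 0) (ξ : Rn n) :
    𝓕 (fun x => ((|c| ^ n : ℝ) : ℂ) * φ (c • x)) ξ = 𝓕 φ (c⁻¹ • ξ) := by
  rw [Real.fourier_eq, Real.fourier_eq]
  have h := Measure.integral_comp_smul (volume : Measure (Rn n))
    (fun v => Real.fourierChar (-⟪v, c⁻¹ • ξ⟫) • φ v) c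
  rw [finrank_euclideanSpace_fin] at h
  have hc' : (0 : ℝ) < |c| ^ n := by positivity
  rw [abs_inv, abs_pow, eq_inv_smul_iff₀ hc'.ne', ← integral_smul] at h
  rw [← h]
  refine integral_congr_ae (.of_forall fun v => ?_)
  simp only
  rw [real_inner_smul_left, real_inner_smul_right, mul_inv_cancel_left₀ hc, ← Complex.real_smul,
    smul_comm]

open scoped FourierTransform SchwartzMap in
theorem exists_weak_limit_of_dilates {φ : Rn n → ℂ} (hφ : ContDiff ℝ ∞ φ)
    (hφc : HasCompactSupport φ) (hφ0 : ∫ x, φ x = 0) {h : Rn n → ℂ} (hh : MemLp h 2 volume) :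
    ∃ G : Rn n → ℂ, MemLp G 2 volume ∧ ∀ ψ : 𝓢(Rn n, ℂ),
      Tendsto (fun N => ∫ y, h y * ∫ z, (∑ j ∈ Finset.range N, (((2 ^ j) ^ n : ℝ) : ℂ) *
        φ ((2 ^ j : ℝ) • (z - y))) * ψ z) atTop (𝓝 (∫ z, G z * ψ z)) := by
  -- The dilation factor is negative because the pairing evaluates `φ` at multiples of `z - y`,
  -- while the convolution kernel is evaluated at `y - z`.
  set D : ℕ → Rn n → ℂ := fun j x => ((|-(2 ^ j : ℝ)| ^ n : ℝ) : ℂ) * φ (-(2 ^ j : ℝ) • x) with hD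
  have hDs : ∀ j, ContDiff ℝ ∞ (D j) := fun j =>
    contDiff_const.mul (hφ.comp (contDiff_const_smul _))
  have hDc : ∀ j, HasCompactSupport (D j) := fun j =>
    (hφc.comp_smul (by simp)).mul_left
  set κ : ℕ → 𝓢(Rn n, ℂ) := fun N => ∑ j ∈ Finset.range N, (hDc j).toSchwartzMap (hDs j) with hκ
  set φS : 𝓢(Rn n, ℂ) := hφc.toSchwartzMap hφ with hφS
  have hκF : ∀ N ξ, 𝓕 (κ N) ξ = ∑ j ∈ Finset.range N, 𝓕 φS ((-(2 ^ j : ℝ))⁻¹ • ξ) := by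
    intro N ξ
    rw [hκ, FourierTransform.fourier_sum, sum_apply]
    refine Finset.sum_congr rfl fun j _ => ?_
    exact fourier_comp_smul φ (by simp) ξ
  obtain ⟨C, hC0, hC⟩ := exists_norm_fourier_le φS hφ0
  have hb : ∀ (j : ℕ) (ξ : Rn n), ‖𝓕 φS ((-(2 ^ j : ℝ))⁻¹ • ξ)‖ ≤
      C * min (‖ξ‖ / 2 ^ j) (2 ^ j / ‖ξ‖) := by
    intro j ξ
    obtain ⟨h1, h2⟩ := hC ((-(2 ^ j : ℝ))⁻¹ • ξ)
    have e : ‖(-(2 ^ j : ℝ))⁻¹ • ξ‖ = ‖ξ‖ / 2 ^ j := by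
      rw [norm_smul, norm_inv, norm_neg, Real.norm_of_nonneg (by positivity), inv_mul_eq_div]
    rw [e] at h1 h2
    rcases eq_or_ne ξ 0 with rfl | hξ
    · simpa using h1
    have hξ' : 0 < ‖ξ‖ := norm_pos_iff.2 hξ
    rw [mul_min_of_nonneg _ _ hC0]
    refine le_min h1 ?_
    rw [← le_div_iff₀ (by positivity)] at h2
    refine h2.trans (le_of_eq ?_)
    field_simp
  obtain ⟨G, hG, hlim⟩ := exists_weak_limit_of_fourier κ (C := C * 12) (fun N ξ => by
      rw [hκF]
      refine (norm_sum_le _ _).trans ((Finset.sum_le_sum fun j _ => hb j ξ).trans ?_)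
      rw [← Finset.mul_sum]
      gcongr
      rcases eq_or_ne ξ 0 with rfl | hξ
      · simp
      · exact sum_min_pow_le (norm_pos_iff.2 hξ) N) (fun ξ => by
      have hs : Summable fun j : ℕ => 𝓕 φS ((-(2 ^ j : ℝ))⁻¹ • ξ) := by
        refine Summable.of_norm_bounded (g := fun j : ℕ => C * ‖ξ‖ * (1 / 2) ^ j)
          ((summable_geometric_two).mul_left _) fun j => (hb j ξ).trans ?_
        rw [mul_assoc, one_div, inv_pow, ← div_eq_mul_inv]
        gcongr
        exact min_le_left _ _
      refine ⟨∑' j : ℕ, 𝓕 φS ((-(2 ^ j : ℝ))⁻¹ • ξ), ?_⟩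
      simp_rw [hκF]
      exact hs.hasSum.tendsto_sum_nat) hh
  refine ⟨G, hG, fun ψ => ?_⟩
  refine (hlim ψ).congr fun N => ?_
  congr 1; ext y; congr 2; ext z; congr 1
  rw [hκ, sum_apply]
  refine Finset.sum_congr rfl fun j _ => ?_
  change D j (y - z) = _
  rw [hD]
  simp only [abs_neg, abs_pow, Nat.abs_ofNat, neg_smul, ← smul_neg, neg_sub]

/-! ### Lebesgue points and approximate identities -/

/-- `x` is a Lebesgue point of `f`. -/
def IsLebesguePoint (f : Rn n → ℂ) (x : Rn n) : Prop :=
  Tendsto (fun r : ℝ => (r ^ n)⁻¹ * ∫ y in Metric.closedBall x r, ‖f y - f x‖) (𝓝[>] 0) (𝓝 0)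

theorem ae_isLebesguePoint {f : Rn n → ℂ} (hf : LocallyIntegrable f volume) :
    ∀ᵐ x, IsLebesguePoint f x := by
  have hv := unitBallVolume_pos (n := n)
  filter_upwards [IsUnifLocDoublingMeasure.ae_tendsto_average_norm_sub volume hf 1] with x hx
  have h := (hx (fun _ => x) (fun r : ℝ => r) tendsto_id (by
    filter_upwards [self_mem_nhdsWithin] with r hr
    have : (0 : ℝ) < r := hr
    exact Metric.mem_closedBall_self (by linarith))).const_mul (unitBallVolume n)
  rw [mul_zero] at h
  refine h.congr' ?_
  filter_upwards [self_mem_nhdsWithin] with r hr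
  have hr' : (0 : ℝ) < r := hr
  rw [setAverage_eq, Measure.real, volume_closedBall x hr'.le,
    ENNReal.toReal_ofReal (by positivity), smul_eq_mul, mul_inv, ← mul_assoc, ← mul_assoc,
    mul_inv_cancel₀ hv.ne', one_mul]

theorem tendsto_integral_mul_sub_of_isLebesguePoint {f : Rn n → ℂ}
    (hf : LocallyIntegrable f volume) {x : Rn n} (hx : IsLebesguePoint f x) {C R : ℝ} (hR : 0 < R)
    {k : ℝ → Rn n → ℂ} (hk : ∀ ε, 0 < ε → ∀ y, ‖k ε y‖ ≤ C * (ε ^ n)⁻¹)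
    (hk0 : ∀ ε, 0 < ε → ∀ y, R * ε < ‖y - x‖ → k ε y = 0) :
    Tendsto (fun ε => ∫ y, k ε y * (f y - f x)) (𝓝[>] 0) (𝓝 0) := by
  have ht : Tendsto (fun ε : ℝ => R * ε) (𝓝[>] 0) (𝓝[>] 0) := by
    refine tendsto_nhdsWithin_iff.2 ⟨?_, ?_⟩
    · have : Tendsto (fun ε : ℝ => R * ε) (𝓝 0) (𝓝 (R * 0)) := tendsto_id.const_mul R
      rw [mul_zero] at this
      exact this.mono_left nhdsWithin_le_nhds
    · filter_upwards [self_mem_nhdsWithin] with ε hε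
      exact mul_pos hR hε
  have h := (hx.comp ht).const_mul (C * R ^ n)
  rw [mul_zero] at h
  refine squeeze_zero_norm' ?_ h
  filter_upwards [self_mem_nhdsWithin] with ε hε
  have hε' : (0 : ℝ) < ε := hε
  have hint : IntegrableOn (fun y => ‖f y - f x‖) (Metric.closedBall x (R * ε)) :=
    ((hf.integrableOn_isCompact (isCompact_closedBall _ _)).sub
      (integrableOn_const measure_closedBall_lt_top.ne)).norm
  calc ‖∫ y, k ε y * (f y - f x)‖
      = ‖∫ y in Metric.closedBall x (R * ε), k ε y * (f y - f x)‖ := by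
        rw [setIntegral_eq_integral_of_forall_compl_eq_zero fun y hy => ?_]
        rw [mem_closedBall_iff_norm, not_le] at hy
        rw [hk0 ε hε' y hy, zero_mul]
    _ ≤ ∫ y in Metric.closedBall x (R * ε), C * (ε ^ n)⁻¹ * ‖f y - f x‖ := by
        refine norm_integral_le_of_norm_le (hint.const_mul _) (.of_forall fun y => ?_)
        rw [norm_mul]
        gcongr
        exact hk ε hε' y
    _ = _ := by
        rw [integral_const_mul]
        simp only [Function.comp]
        rw [mul_pow]
        field_simp

/-- The weight need not have compact support. Its tail beyond a large radius `k` has small integral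
and is paired with the bound `2 M` on the oscillation; on the ball of radius `k ε` the Lebesgue
point property suffices. -/
theorem tendsto_integral_dilate_mul_sub {f : Rn n → ℂ} (hf : LocallyIntegrable f volume) {M : ℝ}
    (hM : ∀ y, ‖f y‖ ≤ M) {x : Rn n} (hx : IsLebesguePoint f x) {w : Rn n → ℝ}
    (hw : Integrable w volume) (hw0 : ∀ u, 0 ≤ w u) {C : ℝ} (hC : ∀ u, w u ≤ C) :
    Tendsto (fun ε : ℝ => ∫ y, (ε ^ n)⁻¹ * w (ε⁻¹ • (x - y)) * ‖f y - f x‖) (𝓝[>] 0) (𝓝 0) := by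
  have hC0 : 0 ≤ C := (hw0 0).trans (hC 0)
  have hM0 : 0 ≤ M := (norm_nonneg _).trans (hM 0)
  have hscale : ∀ (v : Rn n → ℝ) (ε : ℝ), 0 < ε →
      ∫ y, (ε ^ n)⁻¹ * v (ε⁻¹ • (x - y)) = ∫ u, v u := by
    intro v ε hε
    rw [integral_const_mul, integral_sub_left_eq_self (fun u => v (ε⁻¹ • u)) volume x,
      Measure.integral_comp_smul, finrank_euclideanSpace_fin, smul_eq_mul,
      abs_of_pos (by positivity), inv_pow, inv_inv, inv_mul_cancel_left₀ (by positivity)]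
  have hscalei : ∀ (v : Rn n → ℝ) (ε : ℝ), 0 < ε → Integrable v volume →
      Integrable (fun y => (ε ^ n)⁻¹ * v (ε⁻¹ • (x - y))) volume := by
    intro v ε hε hv
    exact ((hv.comp_smul (inv_ne_zero hε.ne')).comp_sub_left x).const_mul _
  rw [Metric.tendsto_nhds]
  intro η hη
  -- the tail of `w`
  have htail : Tendsto (fun k : ℕ => ∫ u, (Metric.closedBall (0 : Rn n) k)ᶜ.indicator w u) atTop
      (𝓝 (∫ _ : Rn n, (0 : ℝ))) := by
    refine tendsto_integral_of_dominated_convergence w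
      (fun k => hw.aestronglyMeasurable.indicator measurableSet_closedBall.compl) hw
      (fun k => .of_forall fun u => ?_) (.of_forall fun u => ?_)
    · rw [Real.norm_of_nonneg (Set.indicator_nonneg (fun u _ => hw0 u) _)]
      exact Set.indicator_le_self' (fun u _ => hw0 u) _
    · refine tendsto_const_nhds.congr' ?_
      filter_upwards [eventually_ge_atTop ⌈‖u‖⌉₊] with k hk
      rw [Set.indicator_of_notMem]
      simpa using Nat.ceil_le.1 hk
  rw [integral_zero] at htail
  obtain ⟨k, hk, hk0⟩ := (((htail.const_mul (2 * M)).eventually_lt_const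
    (show 2 * M * 0 < η / 2 by simpa using half_pos hη)).and (eventually_gt_atTop 0)).exists
  have hk0' : (0 : ℝ) < k := by exact_mod_cast hk0
  have ht : Tendsto (fun ε : ℝ => (k : ℝ) * ε) (𝓝[>] 0) (𝓝[>] 0) := by
    refine tendsto_nhdsWithin_iff.2 ⟨?_, ?_⟩
    · have : Tendsto (fun ε : ℝ => (k : ℝ) * ε) (𝓝 0) (𝓝 (k * 0)) := tendsto_id.const_mul _
      rw [mul_zero] at this
      exact this.mono_left nhdsWithin_le_nhds
    · filter_upwards [self_mem_nhdsWithin] with ε hε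
      exact mul_pos hk0' hε
  have h1 := (hx.comp ht).const_mul (C * k ^ n)
  rw [mul_zero] at h1
  filter_upwards [self_mem_nhdsWithin, h1.eventually_lt_const (half_pos hη)] with ε hε h2
  have hε' : (0 : ℝ) < ε := hε
  rw [dist_zero_right, Real.norm_of_nonneg (integral_nonneg fun y => by
    have := hw0 (ε⁻¹ • (x - y)); positivity)]
  have hint : IntegrableOn (fun y => ‖f y - f x‖) (Metric.closedBall x (k * ε)) :=
    ((hf.integrableOn_isCompact (isCompact_closedBall _ _)).sub
      (integrableOn_const measure_closedBall_lt_top.ne)).norm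
  set wt := (Metric.closedBall (0 : Rn n) k)ᶜ.indicator w with hwt
  have hwt0 : ∀ u, 0 ≤ wt u := fun u => Set.indicator_nonneg (fun u _ => hw0 u) _
  have hwti : Integrable wt volume := hw.indicator measurableSet_closedBall.compl
  have hpt : ∀ y, (ε ^ n)⁻¹ * w (ε⁻¹ • (x - y)) * ‖f y - f x‖ ≤
      (Metric.closedBall x (k * ε)).indicator (fun y => C * (ε ^ n)⁻¹ * ‖f y - f x‖) y +
        2 * M * ((ε ^ n)⁻¹ * wt (ε⁻¹ • (x - y))) := by
    intro y
    have hnorm : ‖ε⁻¹ • (x - y)‖ = ‖y - x‖ / ε := by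
      rw [norm_smul, norm_inv, Real.norm_of_nonneg hε'.le, norm_sub_rev, inv_mul_eq_div]
    by_cases hy : y ∈ Metric.closedBall x (k * ε)
    · rw [Set.indicator_of_mem hy]
      have := hwt0 (ε⁻¹ • (x - y))
      refine le_trans ?_ (le_add_of_nonneg_right (by positivity))
      rw [mul_comm C]
      gcongr
      exact hC _
    · rw [Set.indicator_of_notMem hy, zero_add, hwt, Set.indicator_of_mem]
      · rw [mul_comm (2 * M)]
        have := hw0 (ε⁻¹ • (x - y))
        gcongr
        exact (norm_sub_le _ _).trans (by linarith [hM y, hM x])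
      · rw [mem_closedBall_iff_norm, not_le] at hy
        rw [Set.mem_compl_iff, mem_closedBall_zero_iff, not_le, hnorm, lt_div_iff₀ hε']
        exact hy
  have hi1 : Integrable ((Metric.closedBall x (k * ε)).indicator
      (fun y => C * (ε ^ n)⁻¹ * ‖f y - f x‖)) volume :=
    (integrable_indicator_iff measurableSet_closedBall).2 (hint.const_mul _)
  have hi2 := (hscalei wt ε hε' hwti).const_mul (2 * M)
  calc ∫ y, (ε ^ n)⁻¹ * w (ε⁻¹ • (x - y)) * ‖f y - f x‖
      ≤ ∫ y, ((Metric.closedBall x (k * ε)).indicator (fun y => C * (ε ^ n)⁻¹ * ‖f y - f x‖) y +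
        2 * M * ((ε ^ n)⁻¹ * wt (ε⁻¹ • (x - y)))) :=
        integral_mono_of_nonneg (.of_forall fun y => by
          have := hw0 (ε⁻¹ • (x - y)); positivity) (hi1.add hi2) (.of_forall hpt)
    _ = C * (ε ^ n)⁻¹ * (∫ y in Metric.closedBall x (k * ε), ‖f y - f x‖) +
        2 * M * ∫ u, wt u := by
        rw [integral_add hi1 hi2, integral_indicator measurableSet_closedBall, integral_const_mul,
          integral_const_mul, hscale wt ε hε']
    _ < η / 2 + η / 2 := by
        refine add_lt_add ?_ hk
        refine lt_of_le_of_lt (le_of_eq ?_) h2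
        simp only [Function.comp]
        rw [mul_pow]
        field_simp
    _ = η := by ring

/-! ### Mollified truncations -/

theorem smoothKernel_eq_radial {ε : ℝ} (hε : 0 < ε) (x : Rn n) :
    smoothKernel Ω ε x = kernel Ω x *
      ((Real.smoothTransition (((ε⁻¹ * ‖x‖) ^ 2 - 1) / 3) : ℝ) : ℂ) := by
  rw [smoothKernel, cutoff, norm_smul, norm_inv, Real.norm_of_nonneg hε.le, mul_comm]

theorem hasCompactSupport_smoothKernel_sub {ε δ : ℝ} (hε : 0 < ε)
    (hδ : 0 < δ) : HasCompactSupport fun x => smoothKernel Ω ε x - smoothKernel Ω δ x :=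
  HasCompactSupport.of_support_subset_isCompact
    (isCompact_closedBall (0 : Rn n) (2 * max ε δ)) fun x hx => by
      by_contra hx'
      rw [mem_closedBall_zero_iff, not_le] at hx'
      refine hx ?_
      simp only
      rw [smoothKernel_eq_kernel hε, smoothKernel_eq_kernel hδ, sub_self]
      · exact le_trans (by gcongr; exact le_max_right _ _) hx'.le
      · exact le_trans (by gcongr; exact le_max_left _ _) hx'.le

namespace IsAngular

theorem integral_smoothKernel_sub (hΩ : IsAngular Ω) (hn : 1 ≤ n) {ε δ : ℝ} (hε : 0 < ε)
    (hδ : 0 < δ) : ∫ x, (smoothKernel Ω ε x - smoothKernel Ω δ x) = 0 := by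
  rw [← hΩ.integral_kernel_mul_comp_norm hn fun r =>
    ((Real.smoothTransition (((ε⁻¹ * r) ^ 2 - 1) / 3) : ℝ) : ℂ) -
    ((Real.smoothTransition (((δ⁻¹ * r) ^ 2 - 1) / 3) : ℝ) : ℂ)]
  refine integral_congr_ae (.of_forall fun x => ?_)
  simp only
  rw [smoothKernel_eq_radial hε, smoothKernel_eq_radial hδ, mul_sub]

/-- Homogeneity turns consecutive dyadic truncations into dilates of the single bump `S_{1/2} -
S_1`, and the sum telescopes. This is the form required by the Fourier argument. -/
theorem smoothKernel_sub_eq_sum (hΩ : IsAngular Ω) (N : ℕ) (u : Rn n) :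
    smoothKernel Ω ((2 ^ N)⁻¹) u - smoothKernel Ω 1 u = ∑ j ∈ Finset.range N,
      (((2 ^ j) ^ n : ℝ) : ℂ) *
        (smoothKernel Ω (1 / 2) ((2 ^ j : ℝ) • u) - smoothKernel Ω 1 ((2 ^ j : ℝ) • u)) := by
  have key : ∀ (j : ℕ) (ε : ℝ), (((2 ^ j) ^ n : ℝ) : ℂ) * smoothKernel Ω ε ((2 ^ j : ℝ) • u) =
      smoothKernel Ω ((2 ^ j)⁻¹ * ε) u := by
    intro j ε
    have h := hΩ.smoothKernel_eq_smul (ε := (2 ^ j)⁻¹ * ε) (c := 2 ^ j) (by positivity) u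
    rw [mul_inv_cancel_left₀ (by positivity)] at h
    rw [h, mul_inv_cancel_left₀]
    exact_mod_cast (by positivity : ((2 : ℝ) ^ j) ^ n ≠ 0)
  simp_rw [mul_sub, key]
  have e : ∀ j : ℕ, ((2 : ℝ) ^ j)⁻¹ * (1 / 2) = (2 ^ (j + 1))⁻¹ := fun j => by
    rw [pow_succ, mul_inv]; ring
  simp_rw [e, mul_one]
  rw [Finset.sum_range_sub (fun j => smoothKernel Ω ((2 ^ j)⁻¹) u)]
  simp

end IsAngular

/-- One factor of the norm just beats the singularity of the kernel: in polar coordinates the radial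
integrand is `1`. -/
theorem integrableOn_closedBall_norm_div_pow (hn : 1 ≤ n) (R : ℝ) :
    IntegrableOn (fun w : Rn n => ‖w‖ / ‖w‖ ^ n) (Metric.closedBall 0 R) := by
  have : Nonempty (Fin n) := ⟨⟨0, hn⟩⟩
  have hnt : Nontrivial (Rn n) := inferInstance
  refine IntegrableOn.mono_set (t := Metric.ball 0 (R + 1)) ?_
    (Metric.closedBall_subset_ball (by linarith))
  rw [integrableOn_fun_norm_addHaar volume (f := fun r => r / r ^ n), finrank_euclideanSpace_fin]
  have h1 : IntegrableOn (fun _ : ℝ => (1 : ℝ)) (Set.Ioo 0 (R + 1)) :=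
    integrableOn_const (by simp)
  refine h1.congr_fun (fun r hr => ?_) measurableSet_Ioo
  have hr' : 0 < r := hr.1
  simp only [smul_eq_mul]
  rw [← mul_div_assoc, ← pow_succ, Nat.sub_add_cancel hn, div_self (by positivity)]

/-- A smooth probability density supported in the unit ball. -/
structure IsMollifier (Φ : Rn n → ℝ) : Prop where
  contDiff : ContDiff ℝ ∞ Φ
  nonneg : ∀ v, 0 ≤ Φ v
  eq_zero : ∀ v, 1 < ‖v‖ → Φ v = 0
  integral_eq_one : ∫ v, Φ v = 1

theorem exists_isMollifier (n : ℕ) : ∃ Φ : Rn n → ℝ, IsMollifier Φ := by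
  let f : ContDiffBump (0 : Rn n) := ⟨1 / 2, 1, by norm_num, by norm_num⟩
  refine ⟨f.normed volume, f.contDiff_normed, f.nonneg_normed, fun v hv => ?_, f.integral_normed⟩
  have : v ∉ Function.support (f.normed volume) := by
    rw [f.support_normed_eq, mem_ball_zero_iff, not_lt]
    exact hv.le
  exact Function.notMem_support.1 this

namespace IsMollifier

variable {Φ : Rn n → ℝ}

theorem hasCompactSupport (hΦ : IsMollifier Φ) : HasCompactSupport Φ :=
  HasCompactSupport.of_support_subset_isCompact (isCompact_closedBall (0 : Rn n) 1) fun v hv => by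
    by_contra h
    rw [mem_closedBall_zero_iff, not_le] at h
    exact hv (hΦ.eq_zero v h)

theorem integrable (hΦ : IsMollifier Φ) : Integrable Φ volume :=
  hΦ.contDiff.continuous.integrable_of_hasCompactSupport hΦ.hasCompactSupport

theorem integrable_ofReal (hΦ : IsMollifier Φ) : Integrable (fun v => (Φ v : ℂ)) volume :=
  hΦ.integrable.ofReal

theorem integral_ofReal_eq_one (hΦ : IsMollifier Φ) : ∫ v, (Φ v : ℂ) = 1 := by
  rw [integral_complex_ofReal, hΦ.integral_eq_one, Complex.ofReal_one]

theorem exists_lipschitz (hΦ : IsMollifier Φ) :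
    ∃ L : ℝ, 0 ≤ L ∧ ∀ u v, |Φ u - Φ v| ≤ L * ‖u - v‖ := by
  obtain ⟨C, hC⟩ := ContDiff.lipschitzWith_of_hasCompactSupport hΦ.hasCompactSupport
    hΦ.contDiff (by simp : (∞ : WithTop ℕ∞) ≠ 0)
  refine ⟨C, C.2, fun u v => ?_⟩
  have := hC.dist_le_mul u v
  rwa [dist_eq_norm, dist_eq_norm, Real.norm_eq_abs] at this

theorem exists_le (hΦ : IsMollifier Φ) : ∃ C : ℝ, 0 ≤ C ∧ ∀ v, Φ v ≤ C := by
  obtain ⟨C, hC⟩ := hΦ.hasCompactSupport.exists_bound_of_continuous hΦ.contDiff.continuous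
  exact ⟨C, (norm_nonneg _).trans (hC 0), fun v => (le_abs_self _).trans (hC v)⟩

end IsMollifier

/-- The truncated kernel at scale `δ`, averaged at scale `ε`. -/
def mollified (Ω : Rn n → ℂ) (Φ : Rn n → ℝ) (ε δ : ℝ) (u : Rn n) : ℂ :=
  ∫ v, (Φ v : ℂ) * smoothKernel Ω δ (u - ε • v)

namespace IsMollifier

variable {Φ : Rn n → ℝ}

theorem integrable_mul_smoothKernel (hΦ : IsMollifier Φ) (hΩ : IsAngular Ω) (hn : 1 ≤ n)
    {δ : ℝ} (hδ : 0 < δ) (ε : ℝ) (u : Rn n) :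
    Integrable (fun v => (Φ v : ℂ) * smoothKernel Ω δ (u - ε • v)) volume := by
  obtain ⟨C, hC0, hC⟩ := hΩ.exists_norm_smoothKernel_le hn
  exact hΦ.integrable_ofReal.mul_bdd (c := C / δ ^ n)
    ((hΩ.contDiff_smoothKernel hδ).continuous.comp (by fun_prop)).aestronglyMeasurable
    (.of_forall fun v => hC δ _ hδ)

theorem measurable_mollified (hΦ : IsMollifier Φ) (hΩ : IsAngular Ω)
    {δ : ℝ} (hδ : 0 < δ) (ε : ℝ) : StronglyMeasurable (mollified Ω Φ ε δ) := by
  have hS := (hΩ.contDiff_smoothKernel hδ).continuous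
  have hc : Continuous fun z : Rn n × Rn n => (Φ z.2 : ℂ) * smoothKernel Ω δ (z.1 - ε • z.2) :=
    (Complex.continuous_ofReal.comp (hΦ.contDiff.continuous.comp continuous_snd)).mul
      (hS.comp (by fun_prop))
  exact hc.stronglyMeasurable.integral_prod_right

theorem norm_mollified_le (hΦ : IsMollifier Φ) {δ C : ℝ}
    (hC : ∀ u, ‖smoothKernel Ω δ u‖ ≤ C) (ε : ℝ) (u : Rn n) : ‖mollified Ω Φ ε δ u‖ ≤ C := by
  calc ‖mollified Ω Φ ε δ u‖ ≤ ∫ v, Φ v * C :=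
        norm_integral_le_of_norm_le (hΦ.integrable.mul_const C) (.of_forall fun v => by
          rw [norm_mul, Complex.norm_real, Real.norm_of_nonneg (hΦ.nonneg v)]
          have := hΦ.nonneg v
          gcongr
          exact hC _)
    _ = C := by rw [integral_mul_const, hΦ.integral_eq_one, one_mul]

/-- Reduces the comparison at scale `ε` to scale `1`, with `δ` replaced by `δ / ε`. -/
theorem _root_.MorreyCommutator.IsAngular.smoothKernel_sub_mollified_eq (hΩ : IsAngular Ω) {ε : ℝ}
    (hε : 0 < ε) (δ : ℝ) (u : Rn n) :
    smoothKernel Ω ε u - mollified Ω Φ ε δ u = ((ε ^ n : ℝ) : ℂ)⁻¹ *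
      (smoothKernel Ω 1 (ε⁻¹ • u) - mollified Ω Φ 1 (δ / ε) (ε⁻¹ • u)) := by
  have h1 := hΩ.smoothKernel_eq_smul (ε := 1) hε (ε⁻¹ • u)
  rw [smul_inv_smul₀ hε.ne', mul_one] at h1
  rw [h1, mul_sub, mollified, mollified, ← integral_const_mul]
  congr 1
  refine integral_congr_ae (.of_forall fun v => ?_)
  have h2 := hΩ.smoothKernel_eq_smul (ε := δ / ε) hε (ε⁻¹ • u - v)
  rw [mul_div_cancel₀ _ hε.ne', smul_sub, smul_inv_smul₀ hε.ne'] at h2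
  simp only
  rw [h2, one_smul]
  ring

theorem mollified_sub (hΦ : IsMollifier Φ) (hΩ : IsAngular Ω) (hn : 1 ≤ n)
    {δ δ' : ℝ} (hδ : 0 < δ) (hδ' : 0 < δ') (ε : ℝ) (u : Rn n) :
    mollified Ω Φ ε δ u - mollified Ω Φ ε δ' u =
      ∫ v, (Φ v : ℂ) * (smoothKernel Ω δ (u - ε • v) - smoothKernel Ω δ' (u - ε • v)) := by
  rw [mollified, mollified, ← integral_sub (hΦ.integrable_mul_smoothKernel hΩ hn hδ ε u)
    (hΦ.integrable_mul_smoothKernel hΩ hn hδ' ε u)]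
  simp_rw [mul_sub]

/-- At distance at least `4` the unit averaging ball stays outside the region affected by either
truncation, so the average is one of `S_1` itself and kernel regularity gives decay of order `n +
1`. -/
theorem norm_smoothKernel_sub_mollified_le_of_far (hΦ : IsMollifier Φ) (hΩ : IsAngular Ω)
    (hn : 1 ≤ n) {C₂ : ℝ} (hC₂ : 0 ≤ C₂)
    (h₂ : ∀ (ε : ℝ) (u v : Rn n), 0 < ε → ‖u - v‖ ≤ ‖u‖ / 2 →
      ‖smoothKernel Ω ε u - smoothKernel Ω ε v‖ ≤ C₂ * ‖u - v‖ / ‖u‖ ^ (n + 1))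
    {δ : ℝ} {u : Rn n} (hδ : 0 < δ) (hδ1 : δ ≤ 1) (hu : 4 ≤ ‖u‖) :
    ‖smoothKernel Ω 1 u - mollified Ω Φ 1 δ u‖ ≤ C₂ / ‖u‖ ^ (n + 1) := by
  have hu0 : 0 < ‖u‖ := by linarith
  have e1 : smoothKernel Ω 1 u - mollified Ω Φ 1 δ u =
      ∫ v, (Φ v : ℂ) * (smoothKernel Ω 1 u - smoothKernel Ω 1 (u - v)) := by
    have : mollified Ω Φ 1 δ u = ∫ v, (Φ v : ℂ) * smoothKernel Ω 1 (u - v) := by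
      refine integral_congr_ae (.of_forall fun v => ?_)
      simp only [one_smul]
      rcases le_or_gt ‖v‖ 1 with hv | hv
      · have : 3 ≤ ‖u - v‖ := by linarith [norm_sub_norm_le u v]
        rw [smoothKernel_eq_kernel hδ (by linarith), smoothKernel_eq_kernel one_pos (by linarith)]
      · rw [hΦ.eq_zero v hv]; simp
    simp_rw [mul_sub]
    have hi := hΦ.integrable_mul_smoothKernel hΩ hn one_pos 1 u
    simp only [one_smul] at hi
    rw [this, integral_sub (hΦ.integrable_ofReal.mul_const _) hi, integral_mul_const,
      hΦ.integral_ofReal_eq_one, one_mul]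
  rw [e1]
  calc _ ≤ ∫ v, Φ v * (C₂ / ‖u‖ ^ (n + 1)) := by
        refine norm_integral_le_of_norm_le (hΦ.integrable.mul_const _) (.of_forall fun v => ?_)
        rw [norm_mul, Complex.norm_real, Real.norm_of_nonneg (hΦ.nonneg v)]
        rcases le_or_gt ‖v‖ 1 with hv | hv
        · have hΦv := hΦ.nonneg v
          have huv : ‖u - (u - v)‖ = ‖v‖ := by rw [sub_sub_cancel]
          have := h₂ 1 u (u - v) one_pos (by rw [huv]; linarith)
          rw [huv] at this
          gcongr
          refine this.trans ?_
          gcongr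
          exact mul_le_of_le_one_right hC₂ hv
        · rw [hΦ.eq_zero v hv]; simp
    _ = _ := by rw [integral_mul_const, hΦ.integral_eq_one, one_mul]

/-- The bound is uniform in `δ`. As `S_δ - S_1` has mean zero, `Φ (u - w)` may be replaced by `Φ (u
- w) - Φ u`, which is `O(‖w‖)` and compensates the singularity. -/
theorem norm_mollified_sub_mollified_le (hΦ : IsMollifier Φ) (hΩ : IsAngular Ω)
    (hn : 1 ≤ n) {C₀ L : ℝ} (h₀ : ∀ u, ‖kernel Ω u‖ ≤ C₀ / ‖u‖ ^ n) (hL : 0 ≤ L)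
    (hLip : ∀ u v, |Φ u - Φ v| ≤ L * ‖u - v‖)
    {δ : ℝ} (hδ : 0 < δ) (hδ1 : δ ≤ 1) (u : Rn n) :
    ‖mollified Ω Φ 1 δ u - mollified Ω Φ 1 1 u‖ ≤
      ∫ w in Metric.closedBall (0 : Rn n) 2, L * (2 * C₀) * (‖w‖ / ‖w‖ ^ n) := by
  set D : Rn n → ℂ := fun w => smoothKernel Ω δ w - smoothKernel Ω 1 w with hD
  have hDc : Continuous D :=
    (hΩ.contDiff_smoothKernel hδ).continuous.sub (hΩ.contDiff_smoothKernel one_pos).continuous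
  have hDi : Integrable D volume :=
    hDc.integrable_of_hasCompactSupport (hasCompactSupport_smoothKernel_sub hδ one_pos)
  have hD0 : ∫ w, D w = 0 := hΩ.integral_smoothKernel_sub hn hδ one_pos
  have hDb : ∀ w, ‖D w‖ ≤ 2 * C₀ / ‖w‖ ^ n := fun w => by
    refine (norm_sub_le _ _).trans ?_
    have a1 := (norm_smoothKernel_le (Ω := Ω) δ w).trans (h₀ w)
    have a2 := (norm_smoothKernel_le (Ω := Ω) 1 w).trans (h₀ w)
    rw [two_mul, add_div]
    exact add_le_add a1 a2
  obtain ⟨CΦ, hCΦ, hΦb⟩ := hΦ.exists_le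
  have e1 : mollified Ω Φ 1 δ u - mollified Ω Φ 1 1 u =
      ∫ w, (((Φ (u - w) : ℝ) : ℂ) - (Φ u : ℂ)) * D w := by
    rw [hΦ.mollified_sub hΩ hn hδ one_pos]
    have : ∫ w, (Φ u : ℂ) * D w = 0 := by rw [integral_const_mul, hD0, mul_zero]
    simp_rw [sub_mul]
    rw [integral_sub _ (hDi.const_mul _), this, sub_zero,
      ← integral_sub_left_eq_self (fun w => ((Φ (u - w) : ℝ) : ℂ) * D w) volume u]
    · simp only [one_smul, sub_sub_cancel, hD]
    · refine hDi.bdd_mul (c := CΦ) (Complex.continuous_ofReal.comp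
        (hΦ.contDiff.continuous.comp (by fun_prop))).aestronglyMeasurable (.of_forall fun w => ?_)
      rw [Complex.norm_real, Real.norm_of_nonneg (hΦ.nonneg _)]
      exact hΦb _
  rw [e1, ← setIntegral_eq_integral_of_forall_compl_eq_zero
    (s := Metric.closedBall (0 : Rn n) 2)]
  · refine norm_integral_le_of_norm_le
      ((integrableOn_closedBall_norm_div_pow hn 2).const_mul _) (.of_forall fun w => ?_)
    rw [norm_mul, ← Complex.ofReal_sub, Complex.norm_real, Real.norm_eq_abs]
    have a := hLip (u - w) u
    rw [sub_sub_cancel_left, norm_neg] at a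
    calc _ ≤ L * ‖w‖ * (2 * C₀ / ‖w‖ ^ n) := by
          gcongr
          exact hDb w
      _ = _ := by ring
  · intro w hw
    rw [mem_closedBall_zero_iff, not_le] at hw
    simp only [hD]
    rw [smoothKernel_eq_kernel hδ (by linarith), smoothKernel_eq_kernel one_pos (by linarith),
      sub_self, mul_zero]

theorem exists_norm_smoothKernel_sub_mollified_le (hΦ : IsMollifier Φ) (hΩ : IsAngular Ω)
    (hn : 1 ≤ n) : ∃ C : ℝ, 0 ≤ C ∧ ∀ (δ : ℝ) (u : Rn n), 0 < δ → δ ≤ 1 →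
      ‖smoothKernel Ω 1 u - mollified Ω Φ 1 δ u‖ ≤ C * (1 + ‖u‖) ^ (-((n : ℝ) + 1)) := by
  obtain ⟨C₀, hC₀, h₀⟩ := hΩ.exists_norm_kernel_le hn
  obtain ⟨C₁, hC₁, h₁⟩ := hΩ.exists_norm_smoothKernel_le hn
  obtain ⟨C₂, hC₂, h₂⟩ := hΩ.exists_norm_smoothKernel_sub_le hn
  obtain ⟨L, hL, hLip⟩ := hΦ.exists_lipschitz
  obtain ⟨I, hI0, hI⟩ : ∃ I : ℝ, 0 ≤ I ∧
      ∫ w in Metric.closedBall (0 : Rn n) 2, L * (2 * C₀) * (‖w‖ / ‖w‖ ^ n) = I :=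
    ⟨_, integral_nonneg fun w => by positivity, rfl⟩
  refine ⟨C₂ * 2 ^ (n + 1) + (2 * C₁ + I) * 5 ^ (n + 1), by positivity, fun δ u hδ hδ1 => ?_⟩
  have e0 : (1 + ‖u‖) ^ (-((n : ℝ) + 1)) = ((1 + ‖u‖) ^ (n + 1))⁻¹ := by
    rw [Real.rpow_neg (by positivity)]
    exact_mod_cast rfl
  rw [e0, ← div_eq_mul_inv, le_div_iff₀ (by positivity)]
  rcases le_or_gt 4 ‖u‖ with hu | hu
  · have hu0 : 0 < ‖u‖ := by linarith
    have e2 := hΦ.norm_smoothKernel_sub_mollified_le_of_far hΩ hn hC₂ h₂ hδ hδ1 hu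
    calc _ ≤ C₂ / ‖u‖ ^ (n + 1) * (2 * ‖u‖) ^ (n + 1) := by
          gcongr
          linarith
      _ = C₂ * 2 ^ (n + 1) := by rw [mul_pow]; field_simp
      _ ≤ C₂ * 2 ^ (n + 1) + (2 * C₁ + I) * 5 ^ (n + 1) :=
          le_add_of_nonneg_right (by positivity)
  · have hS1 : ∀ w, ‖smoothKernel Ω 1 w‖ ≤ C₁ := fun w => by simpa using h₁ 1 w one_pos
    have e2 := (hΦ.norm_mollified_sub_mollified_le hΩ hn h₀ hL hLip hδ hδ1 u).trans hI.le
    have e3 : ‖smoothKernel Ω 1 u - mollified Ω Φ 1 δ u‖ ≤ 2 * C₁ + I := by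
      calc _ = ‖smoothKernel Ω 1 u - mollified Ω Φ 1 1 u -
            (mollified Ω Φ 1 δ u - mollified Ω Φ 1 1 u)‖ := by congr 1; ring
        _ ≤ C₁ + C₁ + I := (norm_sub_le _ _).trans (add_le_add ((norm_sub_le _ _).trans
            (add_le_add (hS1 u) (hΦ.norm_mollified_le hS1 1 u))) e2)
        _ = _ := by ring
    calc _ ≤ (2 * C₁ + I) * 5 ^ (n + 1) := by
          gcongr
          linarith
      _ ≤ C₂ * 2 ^ (n + 1) + (2 * C₁ + I) * 5 ^ (n + 1) :=
          le_add_of_nonneg_left (by positivity)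

theorem integrable_smoothKernel_sub_mollified (hΦ : IsMollifier Φ) (hΩ : IsAngular Ω)
    (hn : 1 ≤ n) {δ : ℝ} (hδ : 0 < δ) (hδ1 : δ ≤ 1) :
    Integrable (fun u => smoothKernel Ω 1 u - mollified Ω Φ 1 δ u) volume := by
  obtain ⟨C, hC0, hC⟩ := hΦ.exists_norm_smoothKernel_sub_mollified_le hΩ hn
  refine Integrable.mono' ((integrable_one_add_norm (E := Rn n) (r := (n : ℝ) + 1)
    (by simp)).const_mul C)
    ((hΩ.contDiff_smoothKernel one_pos).continuous.stronglyMeasurable.sub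
      (hΦ.measurable_mollified hΩ hδ 1)).aestronglyMeasurable (.of_forall fun u => hC δ u hδ hδ1)

/-- Changing `δ` adds the convolution of `Φ` with a mean-zero function, whose integral vanishes by
Fubini. The constant multiplying `h x` in the limit therefore does not depend on `δ` or `ε`. -/
theorem integral_smoothKernel_sub_mollified_eq (hΦ : IsMollifier Φ) (hΩ : IsAngular Ω)
    (hn : 1 ≤ n) {δ : ℝ} (hδ : 0 < δ) (hδ1 : δ ≤ 1) :
    ∫ u, (smoothKernel Ω 1 u - mollified Ω Φ 1 δ u) =
      ∫ u, (smoothKernel Ω 1 u - mollified Ω Φ 1 1 u) := by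
  rw [← sub_eq_zero, ← integral_sub (hΦ.integrable_smoothKernel_sub_mollified hΩ hn hδ hδ1)
    (hΦ.integrable_smoothKernel_sub_mollified hΩ hn one_pos le_rfl)]
  set D : Rn n → ℂ := fun w => smoothKernel Ω 1 w - smoothKernel Ω δ w with hD
  have hDc : Continuous D :=
    (hΩ.contDiff_smoothKernel one_pos).continuous.sub (hΩ.contDiff_smoothKernel hδ).continuous
  have hDi : Integrable D volume :=
    hDc.integrable_of_hasCompactSupport (hasCompactSupport_smoothKernel_sub one_pos hδ)
  have hD0 : ∫ w, D w = 0 := hΩ.integral_smoothKernel_sub hn one_pos hδ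
  have hF := hΦ.integrable_ofReal.convolution_integrand (ContinuousLinearMap.mul ℂ ℂ) hDi
  calc ∫ u, (smoothKernel Ω 1 u - mollified Ω Φ 1 δ u -
        (smoothKernel Ω 1 u - mollified Ω Φ 1 1 u))
      = ∫ u, ∫ v, (Φ v : ℂ) * D (u - v) := by
        refine integral_congr_ae (.of_forall fun u => ?_)
        simp only
        rw [sub_sub_sub_cancel_left, hΦ.mollified_sub hΩ hn one_pos hδ]
        simp only [one_smul, hD]
    _ = ∫ v, ∫ u, (Φ v : ℂ) * D (u - v) :=
        integral_integral_swap (f := fun u v => (Φ v : ℂ) * D (u - v)) hF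
    _ = 0 := by
        simp_rw [integral_const_mul, integral_sub_right_eq_self D, hD0, mul_zero]
        simp

end IsMollifier

/-! ### Almost everywhere convergence for bounded integrable functions -/

open scoped SchwartzMap

/-- The density `Φ` rescaled to the ball with centre `x` and radius `ε`. -/
def dilatedBump (Φ : Rn n → ℝ) (ε : ℝ) (x z : Rn n) : ℂ :=
  (((ε ^ n)⁻¹ * Φ (ε⁻¹ • (x - z)) : ℝ) : ℂ)

theorem integral_dilate_sub {E : Type*} [NormedAddCommGroup E] [NormedSpace ℝ E]
    {ε : ℝ} (hε : 0 < ε) (x : Rn n) (g : Rn n → E) :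
    ∫ y, (ε ^ n)⁻¹ • g (ε⁻¹ • (x - y)) = ∫ u, g u := by
  rw [integral_smul, integral_sub_left_eq_self (fun u => g (ε⁻¹ • u)) volume x,
    Measure.integral_comp_smul, finrank_euclideanSpace_fin, inv_pow, inv_inv,
    abs_of_pos (pow_pos hε n), inv_smul_smul₀ (pow_pos hε n).ne']

theorem _root_.MeasureTheory.Integrable.dilate_sub {E : Type*} [NormedAddCommGroup E]
    [NormedSpace ℝ E] {g : Rn n → E} (hg : Integrable g volume) {ε : ℝ} (hε : 0 < ε) (x : Rn n) :
    Integrable (fun y => (ε ^ n)⁻¹ • g (ε⁻¹ • (x - y))) volume :=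
  ((hg.comp_smul (inv_ne_zero hε.ne')).comp_sub_left x).smul ((ε ^ n)⁻¹)

namespace IsMollifier

variable {Φ : Rn n → ℝ}

theorem contDiff_dilatedBump (hΦ : IsMollifier Φ) (ε : ℝ) (x : Rn n) :
    ContDiff ℝ ∞ (dilatedBump Φ ε x) :=
  Complex.ofRealCLM.contDiff.comp (contDiff_const.mul
    (hΦ.contDiff.comp ((contDiff_const.sub contDiff_id).const_smul ε⁻¹)))

theorem dilatedBump_eq_zero (hΦ : IsMollifier Φ) {ε : ℝ} (hε : 0 < ε) {x z : Rn n}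
    (hz : 1 * ε < ‖z - x‖) : dilatedBump Φ ε x z = 0 := by
  rw [dilatedBump, hΦ.eq_zero, mul_zero, Complex.ofReal_zero]
  rw [norm_smul, norm_inv, Real.norm_of_nonneg hε.le, norm_sub_rev, ← div_eq_inv_mul,
    lt_div_iff₀ hε]
  exact hz

theorem hasCompactSupport_dilatedBump (hΦ : IsMollifier Φ) {ε : ℝ} (hε : 0 < ε) (x : Rn n) :
    HasCompactSupport (dilatedBump Φ ε x) :=
  HasCompactSupport.of_support_subset_isCompact (isCompact_closedBall x (1 * ε)) fun z hz => by
    by_contra h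
    rw [mem_closedBall_iff_norm, not_le] at h
    exact hz (hΦ.dilatedBump_eq_zero hε h)

theorem integral_dilatedBump (hΦ : IsMollifier Φ) {ε : ℝ} (hε : 0 < ε) (x : Rn n) :
    ∫ z, dilatedBump Φ ε x z = 1 := by
  have h := integral_dilate_sub hε x Φ
  simp only [smul_eq_mul] at h
  simp only [dilatedBump]
  rw [integral_complex_ofReal, h, hΦ.integral_eq_one, Complex.ofReal_one]

theorem tendsto_integral_mul_dilatedBump (hΦ : IsMollifier Φ) {G : Rn n → ℂ}
    (hG : LocallyIntegrable G volume) {x : Rn n} (hx : IsLebesguePoint G x) :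
    Tendsto (fun ε => ∫ z, G z * dilatedBump Φ ε x z) (𝓝[>] 0) (𝓝 (G x)) := by
  obtain ⟨C, hC0, hC⟩ := hΦ.exists_le
  have h := tendsto_integral_mul_sub_of_isLebesguePoint hG hx (C := C) one_pos
    (k := fun ε => dilatedBump Φ ε x) (fun ε hε z => by
      rw [dilatedBump, Complex.norm_real, Real.norm_of_nonneg
        (mul_nonneg (by positivity) (hΦ.nonneg _)), mul_comm]
      gcongr
      exact hC _) (fun ε hε z hz => hΦ.dilatedBump_eq_zero hε hz)
  have h2 := h.add_const (G x)
  rw [zero_add] at h2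
  refine h2.congr' ?_
  filter_upwards [self_mem_nhdsWithin] with ε hε
  have hε' : 0 < ε := hε
  have hc := (hΦ.contDiff_dilatedBump ε x).continuous
  have hs := hΦ.hasCompactSupport_dilatedBump hε' x
  have hi : Integrable (fun z => dilatedBump Φ ε x z * G z) volume :=
    hG.integrable_smul_left_of_hasCompactSupport hc hs
  simp_rw [mul_sub]
  rw [integral_sub hi ((hc.integrable_of_hasCompactSupport hs).mul_const _), integral_mul_const,
    hΦ.integral_dilatedBump hε', one_mul, sub_add_cancel]
  simp_rw [mul_comm]

theorem mollified_sub_eq_integral_dilatedBump (hΦ : IsMollifier Φ) (hΩ : IsAngular Ω)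
    (hn : 1 ≤ n) {δ δ' ε : ℝ} (hδ : 0 < δ) (hδ' : 0 < δ') (hε : 0 < ε) (x y : Rn n) :
    mollified Ω Φ ε δ (x - y) - mollified Ω Φ ε δ' (x - y) =
      ∫ z, (smoothKernel Ω δ (z - y) - smoothKernel Ω δ' (z - y)) * dilatedBump Φ ε x z := by
  rw [hΦ.mollified_sub hΩ hn hδ hδ', ← integral_dilate_sub hε x]
  refine integral_congr_ae (.of_forall fun z => ?_)
  simp only [dilatedBump]
  rw [smul_inv_smul₀ hε.ne', show x - y - (x - z) = z - y by abel, Complex.real_smul]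
  push_cast
  ring

/-- The rescaled bump is a legitimate Schwartz test function, so the weak `L²` limit becomes a
pointwise statement after averaging at scale `ε`. -/
theorem exists_tendsto_integral_mollified_sub (hΦ : IsMollifier Φ) (hΩ : IsAngular Ω)
    (hn : 1 ≤ n) {h : Rn n → ℂ} (hh : MemLp h 2 volume) :
    ∃ G : Rn n → ℂ, MemLp G 2 volume ∧ ∀ (ε : ℝ) (x : Rn n), 0 < ε →
      Tendsto (fun N : ℕ => ∫ y, (mollified Ω Φ ε ((2 ^ N)⁻¹) (x - y) -
        mollified Ω Φ ε 1 (x - y)) * h y) atTop (𝓝 (∫ z, G z * dilatedBump Φ ε x z)) := by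
  have h2 : (0 : ℝ) < 1 / 2 := by norm_num
  obtain ⟨G, hG, hlim⟩ := exists_weak_limit_of_dilates
    ((hΩ.contDiff_smoothKernel h2).sub (hΩ.contDiff_smoothKernel one_pos))
    (hasCompactSupport_smoothKernel_sub h2 one_pos)
    (hΩ.integral_smoothKernel_sub hn h2 one_pos) hh
  refine ⟨G, hG, fun ε x hε => ?_⟩
  refine (hlim ((hΦ.hasCompactSupport_dilatedBump hε x).toSchwartzMap
    (hΦ.contDiff_dilatedBump ε x))).congr fun N => ?_
  refine integral_congr_ae (.of_forall fun y => ?_)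
  simp only
  rw [hΦ.mollified_sub_eq_integral_dilatedBump hΩ hn (by positivity) one_pos hε, mul_comm]
  congr 1
  refine integral_congr_ae (.of_forall fun z => ?_)
  simp only [hΩ.smoothKernel_sub_eq_sum N (z - y)]
  rfl

theorem integrable_and_integral_smoothKernel_sub_mollified (hΦ : IsMollifier Φ)
    (hΩ : IsAngular Ω) (hn : 1 ≤ n) {δ ε : ℝ} (hδ : 0 < δ) (hδε : δ ≤ ε) (x : Rn n) :
    Integrable (fun y => smoothKernel Ω ε (x - y) - mollified Ω Φ ε δ (x - y)) volume ∧
    ∫ y, (smoothKernel Ω ε (x - y) - mollified Ω Φ ε δ (x - y)) =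
      ∫ u, (smoothKernel Ω 1 u - mollified Ω Φ 1 1 u) := by
  have hε : 0 < ε := hδ.trans_le hδε
  have e : (fun y => smoothKernel Ω ε (x - y) - mollified Ω Φ ε δ (x - y)) = fun y =>
      (ε ^ n)⁻¹ • (fun u => smoothKernel Ω 1 u - mollified Ω Φ 1 (δ / ε) u) (ε⁻¹ • (x - y)) := by
    funext y
    rw [hΩ.smoothKernel_sub_mollified_eq hε, Complex.real_smul]
    push_cast
    rfl
  have h1 : δ / ε ≤ 1 := (div_le_one hε).2 hδε
  rw [e]
  refine ⟨(hΦ.integrable_smoothKernel_sub_mollified hΩ hn (by positivity) h1).dilate_sub hε x, ?_⟩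
  rw [integral_dilate_sub hε x (fun u => smoothKernel Ω 1 u - mollified Ω Φ 1 (δ / ε) u),
    hΦ.integral_smoothKernel_sub_mollified_eq hΩ hn (by positivity) h1]

/-- The expression on the left is exactly the integral of `(S_ε - Φ_ε * S_δ)(x - y)` against `h y -
h x`. The bound is free of `δ`, so `δ` may be sent to zero with `ε` fixed. -/
theorem exists_norm_integral_smoothKernel_sub_le (hΦ : IsMollifier Φ) (hΩ : IsAngular Ω)
    (hn : 1 ≤ n) : ∃ C : ℝ, 0 ≤ C ∧ ∀ {h : Rn n → ℂ} {M : ℝ}, Integrable h volume →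
      (∀ y, ‖h y‖ ≤ M) → ∀ (x : Rn n) (δ ε : ℝ), 0 < δ → δ ≤ ε →
      ‖(∫ y, smoothKernel Ω ε (x - y) * h y) -
        (∫ u, (smoothKernel Ω 1 u - mollified Ω Φ 1 1 u)) * h x -
        (∫ y, mollified Ω Φ ε 1 (x - y) * h y) -
        (∫ y, (mollified Ω Φ ε δ (x - y) - mollified Ω Φ ε 1 (x - y)) * h y)‖ ≤
      ∫ y, (ε ^ n)⁻¹ * (C * (1 + ‖ε⁻¹ • (x - y)‖) ^ (-((n : ℝ) + 1))) * ‖h y - h x‖ := by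
  obtain ⟨C, hC0, hC⟩ := hΦ.exists_norm_smoothKernel_sub_mollified_le hΩ hn
  refine ⟨C, hC0, fun {h M} hh hM x δ ε hδ hδε => ?_⟩
  have hε : 0 < ε := hδ.trans_le hδε
  obtain ⟨hi, hc⟩ := hΦ.integrable_and_integral_smoothKernel_sub_mollified hΩ hn hδ hδε x
  obtain ⟨B, hB0, hB⟩ := hΩ.exists_norm_smoothKernel_le hn
  have hSi : Integrable (fun y => smoothKernel Ω ε (x - y) * h y) volume :=
    hh.bdd_mul (c := B / ε ^ n) ((hΩ.contDiff_smoothKernel hε).continuous.comp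
      (by fun_prop)).aestronglyMeasurable (.of_forall fun y => hB ε _ hε)
  have hmi : ∀ δ, 0 < δ → Integrable (fun y => mollified Ω Φ ε δ (x - y) * h y) volume :=
    fun δ hδ => hh.bdd_mul (c := B / δ ^ n)
      ((hΦ.measurable_mollified hΩ hδ ε).comp_measurable (by fun_prop)).aestronglyMeasurable
      (.of_forall fun y => hΦ.norm_mollified_le (fun u => hB δ u hδ) ε _)
  have e : (∫ y, smoothKernel Ω ε (x - y) * h y) -
        (∫ u, (smoothKernel Ω 1 u - mollified Ω Φ 1 1 u)) * h x -
        (∫ y, mollified Ω Φ ε 1 (x - y) * h y) -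
        (∫ y, (mollified Ω Φ ε δ (x - y) - mollified Ω Φ ε 1 (x - y)) * h y) =
      ∫ y, (smoothKernel Ω ε (x - y) - mollified Ω Φ ε δ (x - y)) * (h y - h x) := by
    have e1 : ∀ y, (smoothKernel Ω ε (x - y) - mollified Ω Φ ε δ (x - y)) * (h y - h x) =
        smoothKernel Ω ε (x - y) * h y - mollified Ω Φ ε δ (x - y) * h y -
          (smoothKernel Ω ε (x - y) - mollified Ω Φ ε δ (x - y)) * h x := fun y => by ring
    have i1 : Integrable (fun y => smoothKernel Ω ε (x - y) * h y -
        mollified Ω Φ ε δ (x - y) * h y) volume := hSi.sub (hmi δ hδ)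
    simp_rw [e1]
    rw [integral_sub i1 (hi.mul_const _), integral_sub hSi (hmi δ hδ), integral_mul_const, hc]
    simp_rw [sub_mul (mollified Ω Φ ε δ _)]
    rw [integral_sub (hmi δ hδ) (hmi 1 one_pos)]
    ring
  rw [e]
  have hw := (integrable_one_add_norm (μ := (volume : Measure (Rn n))) (r := (n : ℝ) + 1)
    (by simp)).const_mul C
  refine norm_integral_le_of_norm_le ?_ (.of_forall fun y => ?_)
  · refine (hw.dilate_sub hε x).mul_bdd (c := M + M)
      (hh.aestronglyMeasurable.sub aestronglyMeasurable_const).norm (.of_forall fun y => ?_)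
    rw [norm_norm]
    exact (norm_sub_le _ _).trans (add_le_add (hM _) (hM _))
  · rw [norm_mul, hΩ.smoothKernel_sub_mollified_eq hε, norm_mul, norm_inv, Complex.norm_real,
      Real.norm_of_nonneg (by positivity)]
    gcongr
    exact hC _ _ (by positivity) ((div_le_one hε).2 hδε)

theorem tendsto_integral_mollified_mul (hΦ : IsMollifier Φ) (hΩ : IsAngular Ω) (hn : 1 ≤ n)
    {h : Rn n → ℂ} (hh : Integrable h volume) (x : Rn n) :
    Tendsto (fun ε => ∫ y, mollified Ω Φ ε 1 (x - y) * h y) (𝓝[>] 0)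
      (𝓝 (∫ y, smoothKernel Ω 1 (x - y) * h y)) := by
  obtain ⟨B, hB0, hB⟩ := hΩ.exists_norm_smoothKernel_le hn
  have hB1 : ∀ u, ‖smoothKernel Ω 1 u‖ ≤ B := fun u => by simpa using hB 1 u one_pos
  have hS := (hΩ.contDiff_smoothKernel one_pos).continuous
  refine tendsto_integral_filter_of_dominated_convergence (fun y => B * ‖h y‖)
    (.of_forall fun ε => ((hΦ.measurable_mollified hΩ one_pos ε).comp_measurable
      (by fun_prop)).aestronglyMeasurable.mul hh.aestronglyMeasurable)
    (.of_forall fun ε => .of_forall fun y => ?_) (hh.norm.const_mul B) (.of_forall fun y => ?_)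
  · rw [norm_mul]
    gcongr
    exact hΦ.norm_mollified_le hB1 ε _
  · refine Tendsto.mul_const (h y) ?_
    have : ∫ v, (Φ v : ℂ) * smoothKernel Ω 1 (x - y) = smoothKernel Ω 1 (x - y) := by
      rw [integral_mul_const, hΦ.integral_ofReal_eq_one, one_mul]
    rw [← this]
    refine tendsto_integral_filter_of_dominated_convergence (fun v => Φ v * B)
      (.of_forall fun ε => (hΦ.integrable_mul_smoothKernel hΩ hn one_pos ε _).aestronglyMeasurable)
      (.of_forall fun ε => .of_forall fun v => ?_) (hΦ.integrable.mul_const B)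
      (.of_forall fun v => ?_)
    · rw [norm_mul, Complex.norm_real, Real.norm_of_nonneg (hΦ.nonneg v)]
      have := hΦ.nonneg v
      gcongr
      exact hB1 _
    · refine Tendsto.const_mul _ ?_
      have hc : Continuous fun ε : ℝ => smoothKernel Ω 1 (x - y - ε • v) := hS.comp (by fun_prop)
      have := hc.tendsto 0
      simp only [zero_smul, sub_zero] at this
      exact this.mono_left nhdsWithin_le_nhds

end IsMollifier

/-- First let `δ = 2^{-N} → 0`, where the weak limit `G` appears averaged at scale `ε`; then let `ε
→ 0` at a common Lebesgue point of `G` and `h`. The limit is `G x + (S_1 * h) x + c h x`. -/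
theorem IsAngular.ae_exists_tendsto_integral_smoothKernel_of_bounded (hΩ : IsAngular Ω)
    (hn : 1 ≤ n) {h : Rn n → ℂ} (hh : Integrable h volume) {M : ℝ} (hM : ∀ y, ‖h y‖ ≤ M) :
    ∀ᵐ x, ∃ v, Tendsto (fun ε => ∫ y, smoothKernel Ω ε (x - y) * h y) (𝓝[>] 0) (𝓝 v) := by
  obtain ⟨Φ, hΦ⟩ := exists_isMollifier n
  have hh2 : MemLp h 2 volume := by
    rw [memLp_two_iff_integrable_sq_norm hh.aestronglyMeasurable]
    simp_rw [sq]
    exact hh.norm.mul_bdd (c := M) hh.aestronglyMeasurable.norm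
      (.of_forall fun y => by rw [norm_norm]; exact hM y)
  obtain ⟨G, hG, hlim⟩ := hΦ.exists_tendsto_integral_mollified_sub hΩ hn hh2
  obtain ⟨C, hC0, hC⟩ := hΦ.exists_norm_integral_smoothKernel_sub_le hΩ hn
  have hGl : LocallyIntegrable G volume := hG.locallyIntegrable (by norm_num)
  filter_upwards [ae_isLebesguePoint hGl, ae_isLebesguePoint hh.locallyIntegrable] with x hxG hxh
  set c := ∫ u, (smoothKernel Ω 1 u - mollified Ω Φ 1 1 u)
  have hw := (integrable_one_add_norm (μ := (volume : Measure (Rn n))) (r := (n : ℝ) + 1)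
    (by simp)).const_mul C
  have hE := tendsto_integral_dilate_mul_sub hh.locallyIntegrable hM hxh hw
    (fun u => by positivity) (C := C) fun u => mul_le_of_le_one_right hC0
      (Real.rpow_le_one_of_one_le_of_nonpos (by linarith [norm_nonneg u]) (by linarith))
  have hbd : ∀ ε : ℝ, 0 < ε → ‖(∫ y, smoothKernel Ω ε (x - y) * h y) - c * h x -
      (∫ y, mollified Ω Φ ε 1 (x - y) * h y) - ∫ z, G z * dilatedBump Φ ε x z‖ ≤
      ∫ y, (ε ^ n)⁻¹ * (C * (1 + ‖ε⁻¹ • (x - y)‖) ^ (-((n : ℝ) + 1))) * ‖h y - h x‖ := by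
    intro ε hε
    refine le_of_tendsto ((hlim ε x hε).const_sub _).norm ?_
    have ht : Tendsto (fun N : ℕ => ((2 : ℝ) ^ N)⁻¹) atTop (𝓝 0) :=
      tendsto_inv_atTop_zero.comp (tendsto_pow_atTop_atTop_of_one_lt one_lt_two)
    filter_upwards [ht.eventually (ge_mem_nhds hε)] with N hN
    exact hC hh hM x _ ε (by positivity) hN
  refine ⟨0 + G x + (∫ y, smoothKernel Ω 1 (x - y) * h y) + c * h x, ?_⟩
  have h0 : Tendsto (fun ε => (∫ y, smoothKernel Ω ε (x - y) * h y) - c * h x -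
      (∫ y, mollified Ω Φ ε 1 (x - y) * h y) - ∫ z, G z * dilatedBump Φ ε x z) (𝓝[>] 0) (𝓝 0) := by
    refine squeeze_zero_norm' ?_ hE
    filter_upwards [self_mem_nhdsWithin] with ε hε using hbd ε hε
  refine (((h0.add (hΦ.tendsto_integral_mul_dilatedBump hGl hxG)).add
    (hΦ.tendsto_integral_mollified_mul hΩ hn hh x)).add_const (c * h x)).congr fun ε => ?_
  ring

theorem IsAngular.ae_exists_tendsto_integral_smoothKernel_of_ae_bounded (hΩ : IsAngular Ω)
    (hn : 1 ≤ n) {h : Rn n → ℂ} (hh : Integrable h volume) {M : ℝ} (hM0 : 0 ≤ M)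
    (hM : ∀ᵐ y, ‖h y‖ ≤ M) :
    ∀ᵐ x, ∃ v, Tendsto (fun ε => ∫ y, smoothKernel Ω ε (x - y) * h y) (𝓝[>] 0) (𝓝 v) := by
  classical
  set h' : Rn n → ℂ := fun y => if ‖h y‖ ≤ M then h y else 0 with hh'
  have he : h =ᵐ[volume] h' := by
    filter_upwards [hM] with y hy
    simp only [hh', if_pos hy]
  filter_upwards [hΩ.ae_exists_tendsto_integral_smoothKernel_of_bounded hn (hh.congr he) (M := M)
    fun y => by simp only [hh']; split_ifs with hy; exacts [hy, by simpa using hM0]] with x hx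
  obtain ⟨v, hv⟩ := hx
  refine ⟨v, hv.congr fun ε => integral_congr_ae ?_⟩
  filter_upwards [he] with y hy
  rw [hy]

/-! ### Whitney averaging and almost everywhere convergence for integrable functions -/

theorem exists_lintegral_far_le (n : ℕ) : ∃ C : ℝ, 0 ≤ C ∧ ∀ (y : Rn n) (d : ℝ), 0 < d →
    ∫⁻ x in {x | d ≤ ‖x - y‖}, ENNReal.ofReal (d / ‖x - y‖ ^ (n + 1)) ≤ ENNReal.ofReal C := by
  have hw := (integrable_one_add_norm (μ := (volume : Measure (Rn n))) (r := (n : ℝ) + 1)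
    (by simp)).const_mul (2 ^ (n + 1))
  have hw0 : ∀ u : Rn n, 0 ≤ 2 ^ (n + 1) * (1 + ‖u‖) ^ (-((n : ℝ) + 1)) := fun u => by positivity
  refine ⟨∫ u : Rn n, 2 ^ (n + 1) * (1 + ‖u‖) ^ (-((n : ℝ) + 1)), integral_nonneg hw0,
    fun y d hd => ?_⟩
  rw [← integral_dilate_sub hd y, ofReal_integral_eq_lintegral_ofReal (hw.dilate_sub hd y)
    (.of_forall fun x => smul_nonneg (by positivity) (hw0 _))]
  refine (setLIntegral_mono' ?_ fun x hx => ?_).trans (setLIntegral_le_lintegral _ _)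
  · exact (isClosed_le continuous_const (by fun_prop)).measurableSet
  · have hx' : d ≤ ‖x - y‖ := hx
    refine ENNReal.ofReal_le_ofReal ?_
    have hxp : 0 < ‖x - y‖ := hd.trans_le hx'
    have e0 : ∀ t : ℝ, 0 < t → t ^ (-((n : ℝ) + 1)) = (t ^ (n + 1))⁻¹ := fun t ht => by
      rw [Real.rpow_neg ht.le]
      exact_mod_cast rfl
    have h1 : 1 + ‖d⁻¹ • (y - x)‖ ≤ 2 * ‖x - y‖ / d := by
      rw [norm_smul, norm_inv, Real.norm_of_nonneg hd.le, norm_sub_rev, le_div_iff₀ hd, add_mul,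
        mul_right_comm, inv_mul_cancel₀ hd.ne']
      linarith
    rw [smul_eq_mul, e0 _ (by positivity)]
    calc d / ‖x - y‖ ^ (n + 1) = (d ^ n)⁻¹ * (2 ^ (n + 1) * ((2 * ‖x - y‖ / d) ^ (n + 1))⁻¹) := by
          rw [div_pow, mul_pow, pow_succ d]
          field_simp
      _ ≤ _ := by gcongr

/-- The uniform probability density on the ball with centre `y` whose radius is half of the
distance of `y` to `F`. -/
def whitneyDensity (F : Set (Rn n)) (z y : Rn n) : ℝ :=
  if ‖z - y‖ < Metric.infDist y F / 2 then
    (unitBallVolume n * (Metric.infDist y F / 2) ^ n)⁻¹ else 0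

theorem whitneyDensity_of_lt {F : Set (Rn n)} {z y : Rn n}
    (h : ‖z - y‖ < Metric.infDist y F / 2) :
    whitneyDensity F z y = (unitBallVolume n * (Metric.infDist y F / 2) ^ n)⁻¹ :=
  if_pos h

theorem whitneyDensity_of_le {F : Set (Rn n)} {z y : Rn n}
    (h : Metric.infDist y F / 2 ≤ ‖z - y‖) : whitneyDensity F z y = 0 :=
  if_neg (not_lt.2 h)

theorem whitneyDensity_nonneg (F : Set (Rn n)) (z y : Rn n) : 0 ≤ whitneyDensity F z y := by
  have := unitBallVolume_pos (n := n)
  have := Metric.infDist_nonneg (x := y) (s := F)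
  rcases lt_or_ge ‖z - y‖ (Metric.infDist y F / 2) with h | h
  · rw [whitneyDensity_of_lt h]; positivity
  · rw [whitneyDensity_of_le h]

theorem measurable_whitneyDensity (F : Set (Rn n)) :
    Measurable fun w : Rn n × Rn n => whitneyDensity F w.1 w.2 := by
  have hc : Continuous fun w : Rn n × Rn n => Metric.infDist w.2 F :=
    (Metric.continuous_infDist_pt F).comp continuous_snd
  exact Measurable.ite (isOpen_lt (by fun_prop) (hc.div_const 2)).measurableSet
    (measurable_const.mul ((hc.div_const 2).pow n).measurable).inv measurable_const

theorem integrable_whitneyDensity (F : Set (Rn n)) (y : Rn n) :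
    Integrable (fun z => whitneyDensity F z y) volume := by
  have e : (fun z => whitneyDensity F z y) = (Metric.ball y (Metric.infDist y F / 2)).indicator
      fun _ => (unitBallVolume n * (Metric.infDist y F / 2) ^ n)⁻¹ := by
    funext z
    by_cases hz : z ∈ Metric.ball y (Metric.infDist y F / 2)
    · rw [Set.indicator_of_mem hz, whitneyDensity_of_lt (mem_ball_iff_norm.1 hz)]
    · rw [Set.indicator_of_notMem hz, whitneyDensity_of_le]
      rwa [mem_ball_iff_norm, not_lt] at hz
  rw [e]
  exact (integrable_indicator_iff measurableSet_ball).2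
    (integrableOn_const measure_ball_lt_top.ne)

theorem integral_whitneyDensity {F : Set (Rn n)} {y : Rn n} (hy : 0 < Metric.infDist y F) :
    ∫ z, whitneyDensity F z y = 1 := by
  have hv := unitBallVolume_pos (n := n)
  have e : (fun z => whitneyDensity F z y) = (Metric.ball y (Metric.infDist y F / 2)).indicator
      fun _ => (unitBallVolume n * (Metric.infDist y F / 2) ^ n)⁻¹ := by
    funext z
    by_cases hz : z ∈ Metric.ball y (Metric.infDist y F / 2)
    · rw [Set.indicator_of_mem hz, whitneyDensity_of_lt (mem_ball_iff_norm.1 hz)]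
    · rw [Set.indicator_of_notMem hz, whitneyDensity_of_le]
      rwa [mem_ball_iff_norm, not_lt] at hz
  rw [e, integral_indicator measurableSet_ball, setIntegral_const, measureReal_def,
    volume_ball _ (by positivity), ENNReal.toReal_ofReal (by positivity), smul_eq_mul,
    mul_inv_cancel₀ (by positivity)]

theorem integral_whitneyDensity_le_one (F : Set (Rn n)) (y : Rn n) :
    ∫ z, whitneyDensity F z y ≤ 1 := by
  rcases (Metric.infDist_nonneg (x := y) (s := F)).eq_or_lt' with h | h
  · have : ∀ z, whitneyDensity F z y = 0 := fun z =>
      whitneyDensity_of_le (by rw [h]; simp)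
    simp [this]
  · exact (integral_whitneyDensity h).le

theorem integrable_prod_whitneyDensity (F : Set (Rn n)) {f : Rn n → ℂ}
    (hf : Integrable f volume) :
    Integrable (fun w : Rn n × Rn n => (whitneyDensity F w.1 w.2 : ℂ) * f w.2)
      (volume.prod volume) := by
  have hm : AEStronglyMeasurable (fun w : Rn n × Rn n => (whitneyDensity F w.1 w.2 : ℂ) * f w.2)
      (volume.prod volume) :=
    (Complex.measurable_ofReal.comp (measurable_whitneyDensity F)).aestronglyMeasurable.mul
      hf.aestronglyMeasurable.comp_snd
  rw [integrable_prod_iff' hm]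
  refine ⟨.of_forall fun y => (integrable_whitneyDensity F y).ofReal.mul_const (f y), ?_⟩
  refine hf.norm.mono' hm.norm.prod_swap.integral_prod_right' (.of_forall fun y => ?_)
  rw [Real.norm_of_nonneg (integral_nonneg fun z => norm_nonneg _)]
  simp only [norm_mul, Complex.norm_real, Real.norm_of_nonneg (whitneyDensity_nonneg F _ y)]
  rw [integral_mul_const]
  exact mul_le_of_le_one_left (norm_nonneg _) (integral_whitneyDensity_le_one F y)

/-- The function obtained from `f` off `F` by spreading its mass over Whitney balls. -/
def whitneyAverage (F : Set (Rn n)) (f : Rn n → ℂ) (z : Rn n) : ℂ :=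
  ∫ y, (whitneyDensity F z y : ℂ) * f y

theorem integrable_whitneyAverage (F : Set (Rn n)) {f : Rn n → ℂ} (hf : Integrable f volume) :
    Integrable (whitneyAverage F f) volume :=
  (integrable_prod_whitneyDensity F hf).integral_prod_left

/-- Points `y` whose Whitney ball contains `z` have distance to `F` comparable with that of `z`. The
average is thus controlled by the mean of `|f|` over a ball centred in `F`, where growth is assumed.
-/
theorem norm_whitneyAverage_le {F : Set (Rn n)} (hF : F.Nonempty) {f : Rn n → ℂ}
    (hf : Integrable f volume) {A : ℝ} (hA : 0 ≤ A)
    (hFA : ∀ x ∈ F, ∀ r, 0 < r → ∫ y in Metric.ball x r, ‖f y‖ ≤ A * r ^ n) (z : Rn n) :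
    ‖whitneyAverage F f z‖ ≤ (unitBallVolume n)⁻¹ * 9 ^ n * A := by
  have hv := unitBallVolume_pos (n := n)
  set d := Metric.infDist z F with hd
  have hd0 : 0 ≤ d := Metric.infDist_nonneg
  -- The radius of the ball about `y` lies between `d / 3` and `d`. Since the ball of radius `d`
  -- about `z` sits in one of radius `3 d` centred in `F`, the loss is `(3 · 3)^n`.
  have hcmp : ∀ y, ‖z - y‖ < Metric.infDist y F / 2 →
      Metric.infDist y F / 2 ≤ d ∧ d / 3 ≤ Metric.infDist y F / 2 := fun y hy => by
    have h1 := Metric.infDist_le_infDist_add_dist (s := F) (x := y) (y := z)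
    have h2 := Metric.infDist_le_infDist_add_dist (s := F) (x := z) (y := y)
    rw [dist_comm, dist_eq_norm] at h1
    rw [dist_eq_norm] at h2
    constructor <;> linarith
  rcases hd0.eq_or_lt' with h0 | hpos
  · have : ∀ y, whitneyDensity F z y = 0 := fun y => whitneyDensity_of_le <| by
      by_contra! h
      have := (hcmp y h).1
      linarith [norm_nonneg (z - y)]
    simp only [whitneyAverage, this]
    simp only [Complex.ofReal_zero, zero_mul, integral_zero, norm_zero]
    positivity
  · obtain ⟨x, hxF, hx⟩ := (Metric.infDist_lt_iff hF).1 (show Metric.infDist z F < 2 * d by linarith)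
    have hsub : Metric.ball z d ⊆ Metric.ball x (3 * d) :=
      Metric.ball_subset_ball' (by linarith)
    calc ‖whitneyAverage F f z‖
        ≤ ∫ y, (Metric.ball z d).indicator
            (fun y => (unitBallVolume n * (d / 3) ^ n)⁻¹ * ‖f y‖) y := by
          refine norm_integral_le_of_norm_le ((integrable_indicator_iff measurableSet_ball).2
            (hf.norm.const_mul _).integrableOn) (.of_forall fun y => ?_)
          rcases lt_or_ge ‖z - y‖ (Metric.infDist y F / 2) with h | h
          · obtain ⟨h1, h2⟩ := hcmp y h
            rw [Set.indicator_of_mem (by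
              rw [mem_ball_iff_norm, norm_sub_rev]; exact h.trans_le h1), norm_mul,
              Complex.norm_real, Real.norm_of_nonneg (whitneyDensity_nonneg F z y),
              whitneyDensity_of_lt h]
            gcongr
          · rw [whitneyDensity_of_le h, Complex.ofReal_zero, zero_mul, norm_zero]
            exact Set.indicator_nonneg (fun y _ => by positivity) y
      _ = (unitBallVolume n * (d / 3) ^ n)⁻¹ * ∫ y in Metric.ball z d, ‖f y‖ := by
          rw [integral_indicator measurableSet_ball, integral_const_mul]
      _ ≤ (unitBallVolume n * (d / 3) ^ n)⁻¹ * (A * (3 * d) ^ n) := by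
          gcongr
          exact (setIntegral_mono_set hf.norm.integrableOn (.of_forall fun _ => norm_nonneg _)
            hsub.eventuallyLE).trans (hFA x hxF _ (by positivity))
      _ = _ := by
          rw [show (9 : ℝ) = 3 * 3 by norm_num, mul_pow, mul_pow, div_pow]
          field_simp

theorem integral_mul_whitneyAverage (F : Set (Rn n)) {f : Rn n → ℂ} (hf : Integrable f volume)
    {k : Rn n → ℂ} (hk : Continuous k) {B : ℝ} (hB : ∀ z, ‖k z‖ ≤ B) :
    Integrable (fun y => (∫ z, (whitneyDensity F z y : ℂ) * k z) * f y) volume ∧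
    ∫ z, k z * whitneyAverage F f z = ∫ y, (∫ z, (whitneyDensity F z y : ℂ) * k z) * f y := by
  have hi : Integrable (fun w : Rn n × Rn n => k w.1 * ((whitneyDensity F w.1 w.2 : ℂ) * f w.2))
      (volume.prod volume) :=
    (integrable_prod_whitneyDensity F hf).bdd_mul (c := B)
      (hk.comp continuous_fst).aestronglyMeasurable (.of_forall fun w => hB _)
  have e : ∀ y, ∫ z, k z * ((whitneyDensity F z y : ℂ) * f y) =
      (∫ z, (whitneyDensity F z y : ℂ) * k z) * f y := fun y => by
    rw [← integral_mul_const]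
    exact integral_congr_ae (.of_forall fun z => by ring)
  constructor
  · exact hi.integral_prod_right.congr (.of_forall e)
  · calc ∫ z, k z * whitneyAverage F f z
        = ∫ z, ∫ y, k z * ((whitneyDensity F z y : ℂ) * f y) := by
          simp only [whitneyAverage, integral_const_mul]
      _ = ∫ y, ∫ z, k z * ((whitneyDensity F z y : ℂ) * f y) := integral_integral_swap hi
      _ = _ := by simp_rw [e]

/-- For `x ∈ F` the radius of the Whitney ball is at most half of `‖x - y‖`, so kernel regularity
applies throughout it, uniformly in `ε`. -/
theorem IsAngular.exists_norm_smoothKernel_sub_average_le (hΩ : IsAngular Ω) (hn : 1 ≤ n) :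
    ∃ C : ℝ, 0 ≤ C ∧ ∀ (F : Set (Rn n)) (x y : Rn n) (ε : ℝ), 0 < ε → x ∈ F →
      0 < Metric.infDist y F →
      ‖smoothKernel Ω ε (x - y) - ∫ z, (whitneyDensity F z y : ℂ) * smoothKernel Ω ε (x - z)‖ ≤
        C * (Metric.infDist y F / ‖x - y‖ ^ (n + 1)) := by
  obtain ⟨C, hC0, hC⟩ := hΩ.exists_norm_smoothKernel_sub_le hn
  obtain ⟨B, hB0, hB⟩ := hΩ.exists_norm_smoothKernel_le hn
  refine ⟨C, hC0, fun F x y ε hε hx hy => ?_⟩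
  have hxy : Metric.infDist y F ≤ ‖x - y‖ := by
    rw [norm_sub_rev, ← dist_eq_norm]
    exact Metric.infDist_le_dist_of_mem hx
  have hκ : Integrable (fun z => (whitneyDensity F z y : ℂ)) volume :=
    (integrable_whitneyDensity F y).ofReal
  have hi : Integrable (fun z => (whitneyDensity F z y : ℂ) * smoothKernel Ω ε (x - z)) volume :=
    hκ.mul_bdd (c := B / ε ^ n) ((hΩ.contDiff_smoothKernel hε).continuous.comp
      (by fun_prop)).aestronglyMeasurable (.of_forall fun z => hB ε _ hε)
  have h1 : ∫ z, (whitneyDensity F z y : ℂ) = 1 := by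
    rw [integral_complex_ofReal, integral_whitneyDensity hy, Complex.ofReal_one]
  have e : smoothKernel Ω ε (x - y) - ∫ z, (whitneyDensity F z y : ℂ) * smoothKernel Ω ε (x - z) =
      ∫ z, (whitneyDensity F z y : ℂ) * (smoothKernel Ω ε (x - y) - smoothKernel Ω ε (x - z)) := by
    simp_rw [mul_sub]
    rw [integral_sub (hκ.mul_const _) hi, integral_mul_const, h1, one_mul]
  rw [e]
  calc _ ≤ ∫ z, whitneyDensity F z y * (C * (Metric.infDist y F / ‖x - y‖ ^ (n + 1))) := by
        refine norm_integral_le_of_norm_le ((integrable_whitneyDensity F y).mul_const _)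
          (.of_forall fun z => ?_)
        rw [norm_mul, Complex.norm_real, Real.norm_of_nonneg (whitneyDensity_nonneg F z y)]
        rcases lt_or_ge ‖z - y‖ (Metric.infDist y F / 2) with h | h
        · refine mul_le_mul_of_nonneg_left ?_ (whitneyDensity_nonneg F z y)
          have e1 : ‖x - y - (x - z)‖ = ‖z - y‖ := by congr 1; abel
          refine (hC ε _ _ hε (by rw [e1]; linarith)).trans ?_
          rw [e1, mul_div_assoc]
          gcongr
          linarith
        · rw [whitneyDensity_of_le h, zero_mul, zero_mul]
    _ = _ := by rw [integral_mul_const, integral_whitneyDensity hy, one_mul]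

theorem eventually_smoothKernel_sub_average_eq {F : Set (Rn n)} {x y : Rn n} (hx : x ∈ F)
    (hy : 0 < Metric.infDist y F) :
    ∀ᶠ ε in 𝓝[>] (0 : ℝ),
      smoothKernel Ω ε (x - y) - ∫ z, (whitneyDensity F z y : ℂ) * smoothKernel Ω ε (x - z) =
        kernel Ω (x - y) - ∫ z, (whitneyDensity F z y : ℂ) * kernel Ω (x - z) := by
  have hxy : Metric.infDist y F ≤ ‖x - y‖ := by
    rw [norm_sub_rev, ← dist_eq_norm]
    exact Metric.infDist_le_dist_of_mem hx
  -- Every `z` in the Whitney ball has `‖x - z‖` at least half the distance of `y` to `F`; a quarter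
  -- of that distance therefore ensures `2 ε ≤ ‖x - z‖`, where truncation has no effect.
  filter_upwards [Ioo_mem_nhdsGT (show (0 : ℝ) < Metric.infDist y F / 4 by linarith)] with ε hε
  rw [smoothKernel_eq_kernel hε.1 (by linarith [hε.2])]
  congr 1
  refine integral_congr_ae (.of_forall fun z => ?_)
  simp only
  rcases lt_or_ge ‖z - y‖ (Metric.infDist y F / 2) with h | h
  · rw [smoothKernel_eq_kernel hε.1]
    have : ‖x - y‖ ≤ ‖x - z‖ + ‖z - y‖ := norm_sub_le_norm_sub_add_norm_sub _ _ _
    linarith [hε.2]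
  · rw [whitneyDensity_of_le h, Complex.ofReal_zero, zero_mul, zero_mul]

/-- Marcinkiewicz's integral: integrating over `x ∈ F` first, each `y` contributes a bounded amount
because `‖x - y‖` is at least its distance to `F`. -/
theorem ae_lintegral_infDist_lt_top (F : Set (Rn n)) {f : Rn n → ℂ}
    (hf : Integrable f volume) :
    ∀ᵐ x ∂(volume : Measure (Rn n)).restrict F,
      ∫⁻ y, ENNReal.ofReal (Metric.infDist y F / ‖x - y‖ ^ (n + 1)) * ‖f y‖ₑ < ⊤ := by
  obtain ⟨C, hC0, hC⟩ := exists_lintegral_far_le n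
  have hm : AEMeasurable (fun w : Rn n × Rn n =>
      ENNReal.ofReal (Metric.infDist w.2 F / ‖w.1 - w.2‖ ^ (n + 1)) * ‖f w.2‖ₑ)
      ((volume.restrict F).prod volume) := by
    refine AEMeasurable.mul (Measurable.aemeasurable ?_) hf.aestronglyMeasurable.enorm.comp_snd
    have h1 : Measurable fun w : Rn n × Rn n => Metric.infDist w.2 F :=
      ((Metric.continuous_infDist_pt F).comp continuous_snd).measurable
    exact (h1.div (by fun_prop)).ennreal_ofReal
  refine ae_lt_top' hm.lintegral_prod_right' (ne_of_lt ?_)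
  calc ∫⁻ x in F, ∫⁻ y, ENNReal.ofReal (Metric.infDist y F / ‖x - y‖ ^ (n + 1)) * ‖f y‖ₑ
      = ∫⁻ y, ∫⁻ x in F, ENNReal.ofReal (Metric.infDist y F / ‖x - y‖ ^ (n + 1)) * ‖f y‖ₑ :=
        lintegral_lintegral_swap hm
    _ ≤ ∫⁻ y, ENNReal.ofReal C * ‖f y‖ₑ := by
        refine lintegral_mono fun y => ?_
        rw [lintegral_mul_const _ (by fun_prop)]
        gcongr
        rcases (Metric.infDist_nonneg (x := y) (s := F)).eq_or_lt' with h | h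
        · simp [h]
        · refine (lintegral_mono_set fun x hx => ?_).trans (hC y _ h)
          rw [Set.mem_ofPred_eq, norm_sub_rev, ← dist_eq_norm]
          exact Metric.infDist_le_dist_of_mem hx
    _ < ⊤ := by
        rw [lintegral_const_mul'' _ hf.aestronglyMeasurable.enorm]
        exact ENNReal.mul_lt_top ENNReal.ofReal_lt_top hf.2

theorem norm_le_of_isLebesguePoint {f : Rn n → ℂ} (hf : Integrable f volume) {x : Rn n}
    (hx : IsLebesguePoint f x) {A : ℝ}
    (hA : ∀ r, 0 < r → ∫ y in Metric.ball x r, ‖f y‖ ≤ A * r ^ n) :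
    ‖f x‖ ≤ (unitBallVolume n)⁻¹ * (2 ^ n * A) := by
  have hv := unitBallVolume_pos (n := n)
  rw [← div_eq_inv_mul, le_div_iff₀ hv]
  have hlim := (hx.add_const (2 ^ n * A))
  rw [zero_add] at hlim
  refine ge_of_tendsto hlim ?_
  filter_upwards [self_mem_nhdsWithin] with r hr
  have hr' : 0 < r := hr
  have hi : IntegrableOn (fun y => ‖f y - f x‖) (Metric.closedBall x r) volume :=
    (hf.integrableOn.sub (integrableOn_const measure_closedBall_lt_top.ne)).norm
  have hi2 : IntegrableOn (fun y => ‖f y‖) (Metric.closedBall x r) volume := hf.norm.integrableOn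
  have h1 : ∫ y in Metric.closedBall x r, ‖f x‖ ≤
      (∫ y in Metric.closedBall x r, ‖f y - f x‖) + ∫ y in Metric.closedBall x r, ‖f y‖ := by
    rw [← integral_add hi hi2]
    refine setIntegral_mono (integrableOn_const measure_closedBall_lt_top.ne) (hi.add hi2)
      fun y => ?_
    have := norm_sub_norm_le (f x) (f x - f y)
    rw [sub_sub_cancel, norm_sub_rev] at this
    simp only
    linarith
  have h2 : ∫ y in Metric.closedBall x r, ‖f y‖ ≤ A * (2 * r) ^ n :=
    (setIntegral_mono_set hf.norm.integrableOn (.of_forall fun _ => norm_nonneg _)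
      (Metric.closedBall_subset_ball (by linarith)).eventuallyLE).trans (hA (2 * r) (by linarith))
  rw [setIntegral_const, measureReal_def, volume_closedBall x hr'.le,
    ENNReal.toReal_ofReal (by positivity), smul_eq_mul] at h1
  calc ‖f x‖ * unitBallVolume n = (r ^ n)⁻¹ * (unitBallVolume n * r ^ n * ‖f x‖) := by
        field_simp
    _ ≤ (r ^ n)⁻¹ * ((∫ y in Metric.closedBall x r, ‖f y - f x‖) + A * (2 * r) ^ n) := by
        gcongr
        linarith
    _ = _ := by rw [mul_add, mul_pow]; field_simp

theorem exists_integral_ball_le_of_isLebesguePoint {f : Rn n → ℂ} (hf : Integrable f volume)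
    {x : Rn n} (hx : IsLebesguePoint f x) :
    ∃ A : ℝ, 0 ≤ A ∧ ∀ r, 0 < r → ∫ y in Metric.ball x r, ‖f y‖ ≤ A * r ^ n := by
  have hv := unitBallVolume_pos (n := n)
  obtain ⟨ρ, hρ, hρ1⟩ := (mem_nhdsGT_iff_exists_Ioo_subset).1
    (hx.eventually (ge_mem_nhds (zero_lt_one (α := ℝ))))
  have hρ0 : (0 : ℝ) < ρ := hρ
  have hI : 0 ≤ ∫ y, ‖f y‖ := integral_nonneg fun _ => norm_nonneg _
  -- The first two terms handle radii below `ρ` through the Lebesgue point property; the last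
  -- handles larger radii by the total integral.
  refine ⟨1 + unitBallVolume n * ‖f x‖ + (∫ y, ‖f y‖) / ρ ^ n, by positivity, fun r hr => ?_⟩
  rcases lt_or_ge r ρ with h | h
  · have hi : IntegrableOn (fun y => ‖f y - f x‖) (Metric.closedBall x r) volume :=
      (hf.integrableOn.sub (integrableOn_const measure_closedBall_lt_top.ne)).norm
    have hi2 : IntegrableOn (fun _ => ‖f x‖) (Metric.closedBall x r) volume :=
      integrableOn_const measure_closedBall_lt_top.ne
    have h1 : ∫ y in Metric.closedBall x r, ‖f y - f x‖ ≤ r ^ n := by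
      have := hρ1 ⟨hr, h⟩
      rwa [Set.mem_ofPred_eq, inv_mul_le_iff₀ (by positivity), mul_one] at this
    calc ∫ y in Metric.ball x r, ‖f y‖ ≤ ∫ y in Metric.closedBall x r, ‖f y‖ :=
          setIntegral_mono_set hf.norm.integrableOn (.of_forall fun _ => norm_nonneg _)
            Metric.ball_subset_closedBall.eventuallyLE
      _ ≤ ∫ y in Metric.closedBall x r, (‖f y - f x‖ + ‖f x‖) :=
          setIntegral_mono hf.norm.integrableOn (hi.add hi2) fun y => by
            simpa using norm_add_le (f y - f x) (f x)
      _ ≤ r ^ n + unitBallVolume n * r ^ n * ‖f x‖ := by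
          rw [integral_add hi hi2, setIntegral_const, measureReal_def,
            volume_closedBall x hr.le, ENNReal.toReal_ofReal (by positivity), smul_eq_mul]
          linarith
      _ = (1 + unitBallVolume n * ‖f x‖) * r ^ n := by ring
      _ ≤ _ := mul_le_mul_of_nonneg_right (le_add_of_nonneg_right (by positivity))
          (by positivity)
  · calc ∫ y in Metric.ball x r, ‖f y‖ ≤ ∫ y, ‖f y‖ :=
          setIntegral_le_integral hf.norm (.of_forall fun _ => norm_nonneg _)
      _ = (∫ y, ‖f y‖) / ρ ^ n * ρ ^ n := by field_simp
      _ ≤ (∫ y, ‖f y‖) / ρ ^ n * r ^ n := by gcongr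
      _ ≤ _ := mul_le_mul_of_nonneg_right (le_add_of_nonneg_left (by positivity))
          (by positivity)

theorem isClosed_setOf_integral_ball_le {f : Rn n → ℂ} (hf : Integrable f volume) (A : ℝ) :
    IsClosed {x | ∀ r, 0 < r → ∫ y in Metric.ball x r, ‖f y‖ ≤ A * r ^ n} := by
  refine isClosed_of_closure_subset fun x hx r hr => ?_
  have hlim : Tendsto (fun r' : ℝ => A * r' ^ n) (𝓝[>] r) (𝓝 (A * r ^ n)) :=
    ((continuous_const.mul (continuous_id.pow n)).tendsto r).mono_left nhdsWithin_le_nhds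
  refine ge_of_tendsto hlim ?_
  filter_upwards [self_mem_nhdsWithin] with r' hr'
  have hrr : r < r' := hr'
  obtain ⟨x', hx', hd⟩ := Metric.mem_closure_iff.1 hx (r' - r) (by linarith)
  exact (setIntegral_mono_set hf.norm.integrableOn (.of_forall fun _ => norm_nonneg _)
    (Metric.ball_subset_ball' (by linarith)).eventuallyLE).trans (hx' r' (hr.trans hrr))

/-- On each `F k` the bounded function `1_F f` plus the Whitney average has convergent truncations,
and the remainder converges by dominated convergence. The sets `F k` exhaust almost every point
because ball averages stay bounded at Lebesgue points. -/
theorem IsAngular.ae_exists_tendsto_integral_smoothKernel (hΩ : IsAngular Ω) (hn : 1 ≤ n)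
    {f : Rn n → ℂ} (hf : Integrable f volume) :
    ∀ᵐ x, ∃ v, Tendsto (fun ε => ∫ y, smoothKernel Ω ε (x - y) * f y) (𝓝[>] 0) (𝓝 v) := by
  have hv := unitBallVolume_pos (n := n)
  obtain ⟨C, hC0, hC⟩ := hΩ.exists_norm_smoothKernel_sub_average_le hn
  obtain ⟨B, hB0, hB⟩ := hΩ.exists_norm_smoothKernel_le hn
  have hleb := ae_isLebesguePoint hf.locallyIntegrable
  set F : ℕ → Set (Rn n) := fun k =>
    {x | ∀ r, 0 < r → ∫ y in Metric.ball x r, ‖f y‖ ≤ (k : ℝ) * r ^ n} with hF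
  have hFc : ∀ k, IsClosed (F k) := fun k => isClosed_setOf_integral_ball_le hf k
  have key : ∀ k : ℕ, ∀ᵐ x, x ∈ F k →
      ∃ v, Tendsto (fun ε => ∫ y, smoothKernel Ω ε (x - y) * f y) (𝓝[>] 0) (𝓝 v) := by
    intro k
    rcases (F k).eq_empty_or_nonempty with h0 | hne
    · exact .of_forall fun x hx => by rw [h0] at hx; exact hx.elim
    have hFm := (hFc k).measurableSet
    have hf1 : Integrable ((F k).indicator f) volume := hf.indicator hFm
    have hf2 : Integrable ((F k)ᶜ.indicator f) volume := hf.indicator hFm.compl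
    have hav := integrable_whitneyAverage (F k) hf
    have hbd : ∀ᵐ y, ‖((F k).indicator f + whitneyAverage (F k) f) y‖ ≤
        (unitBallVolume n)⁻¹ * (2 ^ n * k) + (unitBallVolume n)⁻¹ * 9 ^ n * k := by
      filter_upwards [hleb] with y hy
      refine (norm_add_le _ _).trans (add_le_add ?_
        (norm_whitneyAverage_le hne hf (Nat.cast_nonneg k) (fun x hx => hx) y))
      by_cases hyF : y ∈ F k
      · rw [Set.indicator_of_mem hyF]
        exact norm_le_of_isLebesguePoint hf hy hyF
      · rw [Set.indicator_of_notMem hyF, norm_zero]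
        positivity
    filter_upwards [hΩ.ae_exists_tendsto_integral_smoothKernel_of_ae_bounded hn (hf1.add hav)
      (by positivity) hbd, (ae_restrict_iff' hFm).1 (ae_lintegral_infDist_lt_top (F k) hf)]
      with x hx1 hx2 hxF
    obtain ⟨v, hv1⟩ := hx1
    have hx3 := hx2 hxF
    -- The error of replacing `f` off `F k` by its Whitney average, written with the averaging moved
    -- onto the kernel. For each `y` it is eventually constant as `ε → 0`, and it is dominated by
    -- the Marcinkiewicz integrand.
    set J : ℝ → Rn n → ℂ := fun ε y => smoothKernel Ω ε (x - y) * (F k)ᶜ.indicator f y -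
      (∫ z, (whitneyDensity (F k) z y : ℂ) * smoothKernel Ω ε (x - z)) * f y with hJ
    have hsplit : ∀ ε, 0 < ε → ∫ y, smoothKernel Ω ε (x - y) * f y =
        (∫ y, smoothKernel Ω ε (x - y) * ((F k).indicator f + whitneyAverage (F k) f) y) +
          ∫ y, J ε y ∧ Integrable (J ε) volume := by
      intro ε hε
      have hSc : Continuous fun y => smoothKernel Ω ε (x - y) :=
        (hΩ.contDiff_smoothKernel hε).continuous.comp (by fun_prop)
      have hSb : ∀ y, ‖smoothKernel Ω ε (x - y)‖ ≤ B / ε ^ n := fun y => hB ε _ hε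
      have hi : ∀ {g : Rn n → ℂ}, Integrable g volume →
          Integrable (fun y => smoothKernel Ω ε (x - y) * g y) volume := fun hg =>
        hg.bdd_mul hSc.aestronglyMeasurable (.of_forall hSb)
      obtain ⟨ha, hb⟩ := integral_mul_whitneyAverage (F k) hf hSc hSb
      refine ⟨?_, (hi hf2).sub ha⟩
      simp only [hJ, Pi.add_apply, mul_add]
      rw [integral_add (hi hf1) (hi hav), integral_sub (hi hf2) ha, hb]
      have : ∀ y, smoothKernel Ω ε (x - y) * f y = smoothKernel Ω ε (x - y) * (F k).indicator f y +
          smoothKernel Ω ε (x - y) * (F k)ᶜ.indicator f y := fun y => by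
        rw [← mul_add, ← Pi.add_apply, Set.indicator_self_add_compl]
      simp_rw [this]
      rw [integral_add (hi hf1) (hi hf2)]
      ring
    have hJ0 : ∀ y ∈ F k, ∀ ε, J ε y = 0 := fun y hy ε => by
      have : ∀ z, whitneyDensity (F k) z y = 0 := fun z =>
        whitneyDensity_of_le (by rw [Metric.infDist_zero_of_mem hy]; simp)
      simp [hJ, hy, this]
    have hJ1 : ∀ y ∉ F k, ∀ ε, J ε y = (smoothKernel Ω ε (x - y) -
        ∫ z, (whitneyDensity (F k) z y : ℂ) * smoothKernel Ω ε (x - z)) * f y := fun y hy ε => by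
      simp only [hJ]
      rw [Set.indicator_of_mem (by exact hy), sub_mul]
    have hpos : ∀ y ∉ F k, 0 < Metric.infDist y (F k) := fun y hy =>
      ((hFc k).notMem_iff_infDist_pos hne).1 hy
    have hlimJ : ∀ y, ∃ v, ∀ᶠ ε in 𝓝[>] (0 : ℝ), J ε y = v := fun y => by
      by_cases hy : y ∈ F k
      · exact ⟨0, .of_forall fun ε => hJ0 y hy ε⟩
      · refine ⟨(kernel Ω (x - y) - ∫ z, (whitneyDensity (F k) z y : ℂ) * kernel Ω (x - z)) * f y, ?_⟩
        filter_upwards [eventually_smoothKernel_sub_average_eq (Ω := Ω) hxF (hpos y hy)] with ε hε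
        rw [hJ1 y hy, hε]
    choose w hw using hlimJ
    have hbound : Integrable (fun y => C * (Metric.infDist y (F k) / ‖x - y‖ ^ (n + 1)) * ‖f y‖)
        volume := by
      have hm : AEStronglyMeasurable (fun y =>
          Metric.infDist y (F k) / ‖x - y‖ ^ (n + 1) * ‖f y‖) volume :=
        (((Metric.continuous_infDist_pt (F k)).measurable.div
          (by fun_prop)).aestronglyMeasurable).mul hf.aestronglyMeasurable.norm
      have : Integrable (fun y => Metric.infDist y (F k) / ‖x - y‖ ^ (n + 1) * ‖f y‖) volume := by
        refine ⟨hm, ?_⟩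
        rw [hasFiniteIntegral_iff_enorm]
        refine lt_of_le_of_lt (lintegral_mono fun y => ?_) hx3
        rw [enorm_mul, enorm_norm, Real.enorm_eq_ofReal
          (div_nonneg Metric.infDist_nonneg (by positivity))]
      simpa only [mul_assoc] using this.const_mul C
    refine ⟨v + ∫ y, w y, (hv1.add (tendsto_integral_filter_of_dominated_convergence
      (F := J) (f := w) _ ?_ ?_ hbound (.of_forall fun y =>
        tendsto_const_nhds.congr' ((hw y).mono fun _ h => h.symm)))).congr' ?_⟩
    · filter_upwards [self_mem_nhdsWithin] with ε hε using (hsplit ε hε).2.aestronglyMeasurable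
    · filter_upwards [self_mem_nhdsWithin] with ε hε
      refine .of_forall fun y => ?_
      by_cases hy : y ∈ F k
      · rw [hJ0 y hy, norm_zero]
        have := Metric.infDist_nonneg (x := y) (s := F k)
        positivity
      · rw [hJ1 y hy, norm_mul]
        gcongr
        exact hC (F k) x y ε hε hxF (hpos y hy)
    · filter_upwards [self_mem_nhdsWithin] with ε hε using (hsplit ε hε).1.symm
  filter_upwards [ae_all_iff.2 key, hleb] with x hx hxl
  obtain ⟨A, hA0, hA⟩ := exists_integral_ball_le_of_isLebesguePoint hf hxl
  obtain ⟨k, hk⟩ := exists_nat_ge A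
  exact hx k fun r hr => (hA r hr).trans (by gcongr)

/-! ### Sharp truncations and principal values -/

theorem measurableSet_setOf_lt_norm_sub (ε : ℝ) (x : Rn n) :
    MeasurableSet {y : Rn n | ε < ‖x - y‖} :=
  (isOpen_lt continuous_const (by fun_prop)).measurableSet

/-- The sharply truncated kernel. -/
def sharpKernel (Ω : Rn n → ℂ) (ε : ℝ) (x : Rn n) : ℂ :=
  kernel Ω x * (if ε < ‖x‖ then 1 else 0)

theorem truncated_eq_integral_sharpKernel (ε : ℝ) (f : Rn n → ℂ) (x : Rn n) :
    truncated Ω ε f x = ∫ y, sharpKernel Ω ε (x - y) * f y := by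
  rw [truncated, ← integral_indicator (measurableSet_setOf_lt_norm_sub ε x)]
  refine integral_congr_ae (.of_forall fun y => ?_)
  simp only [sharpKernel, Set.indicator_apply, Set.mem_ofPred_eq]
  split_ifs <;> simp

theorem norm_sharpKernel_le {C ε : ℝ} (hC : 0 ≤ C) (hK : ∀ x, ‖kernel Ω x‖ ≤ C / ‖x‖ ^ n)
    (hε : 0 < ε) (x : Rn n) : ‖sharpKernel Ω ε x‖ ≤ C / ε ^ n := by
  rw [sharpKernel]
  split_ifs with h
  · rw [mul_one]
    exact (hK x).trans (by gcongr)
  · rw [mul_zero, norm_zero]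
    positivity

theorem IsAngular.measurable_sharpKernel (hΩ : IsAngular Ω) (ε : ℝ) :
    Measurable (sharpKernel Ω ε) :=
  hΩ.measurable_kernel.mul (Measurable.ite (isOpen_lt continuous_const (by fun_prop)).measurableSet
    measurable_const measurable_const)

/-- The two truncations differ by the kernel times a radial function supported within radius `2 ε`,
of size `ε^{-n}` and mean zero. A Lebesgue point of `f` is all that is needed. -/
theorem IsAngular.tendsto_integral_sharpKernel_sub_smoothKernel (hΩ : IsAngular Ω) (hn : 1 ≤ n)
    {f : Rn n → ℂ} (hf : Integrable f volume) {x : Rn n} (hx : IsLebesguePoint f x) :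
    Tendsto (fun ε => ∫ y, (sharpKernel Ω ε (x - y) - smoothKernel Ω ε (x - y)) * f y)
      (𝓝[>] 0) (𝓝 0) := by
  obtain ⟨C, hC0, hC⟩ := hΩ.exists_norm_kernel_le hn
  set k : ℝ → Rn n → ℂ := fun ε y => sharpKernel Ω ε (x - y) - smoothKernel Ω ε (x - y) with hk
  have hk0 : ∀ ε, 0 < ε → ∀ y, 2 * ε < ‖y - x‖ → k ε y = 0 := fun ε hε y hy => by
    rw [norm_sub_rev] at hy
    simp only [hk]
    rw [smoothKernel_eq_kernel hε hy.le, sharpKernel, if_pos (by linarith), mul_one, sub_self]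
  have hkb : ∀ ε, 0 < ε → ∀ y, ‖k ε y‖ ≤ (C + C) * (ε ^ n)⁻¹ := fun ε hε y => by
    rw [← div_eq_mul_inv, add_div]
    refine (norm_sub_le _ _).trans (add_le_add (norm_sharpKernel_le hC0 hC hε _) ?_)
    rcases le_or_gt ‖x - y‖ ε with h | h
    · rw [smoothKernel_eq_zero hε h, norm_zero]
      positivity
    · exact ((norm_smoothKernel_le ε _).trans (hC _)).trans (by gcongr)
  refine (tendsto_integral_mul_sub_of_isLebesguePoint hf.locallyIntegrable hx two_pos hkb
    hk0).congr' ?_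
  filter_upwards [self_mem_nhdsWithin] with ε hε
  have hε' : 0 < ε := hε
  have hkm : Measurable (k ε) :=
    ((hΩ.measurable_sharpKernel ε).sub (hΩ.contDiff_smoothKernel hε').continuous.measurable).comp
      (by fun_prop)
  have hki : Integrable (k ε) volume := by
    rw [← integrableOn_iff_integrable_of_support_subset (s := Metric.closedBall x (2 * ε))]
    · exact Measure.integrableOn_of_bounded measure_closedBall_lt_top.ne
        hkm.aestronglyMeasurable (.of_forall fun y => hkb ε hε' y)
    · intro y hy
      by_contra h
      rw [mem_closedBall_iff_norm, not_le] at h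
      exact hy (hk0 ε hε' y h)
  have hkz : ∫ y, k ε y = 0 := by
    have h := integral_sub_left_eq_self
      (fun u => sharpKernel Ω ε u - smoothKernel Ω ε u) volume x
    simp only [hk]
    rw [h, ← hΩ.integral_kernel_mul_comp_norm hn fun r => (if ε < r then 1 else 0) -
      ((Real.smoothTransition (((ε⁻¹ * r) ^ 2 - 1) / 3) : ℝ) : ℂ)]
    refine integral_congr_ae (.of_forall fun u => ?_)
    simp only
    rw [smoothKernel_eq_radial hε', mul_sub, sharpKernel]
  have hkf : Integrable (fun y => k ε y * f y) volume :=
    hf.bdd_mul hkm.aestronglyMeasurable (.of_forall fun y => hkb ε hε' y)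
  simp_rw [mul_sub]
  rw [integral_sub hkf (hki.mul_const _), integral_mul_const, hkz, zero_mul, sub_zero]

theorem IsAngular.ae_exists_tendsto_truncated (hΩ : IsAngular Ω) (hn : 1 ≤ n)
    {f : Rn n → ℂ} (hf : Integrable f volume) :
    ∀ᵐ x, ∃ v, Tendsto (fun ε => truncated Ω ε f x) (𝓝[>] 0) (𝓝 v) := by
  obtain ⟨C, hC0, hC⟩ := hΩ.exists_norm_kernel_le hn
  obtain ⟨B, hB0, hB⟩ := hΩ.exists_norm_smoothKernel_le hn
  filter_upwards [hΩ.ae_exists_tendsto_integral_smoothKernel hn hf,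
    ae_isLebesguePoint hf.locallyIntegrable] with x hx hxl
  obtain ⟨v, hv⟩ := hx
  refine ⟨0 + v, ((hΩ.tendsto_integral_sharpKernel_sub_smoothKernel hn hf hxl).add hv).congr' ?_⟩
  filter_upwards [self_mem_nhdsWithin] with ε hε
  have hε' : 0 < ε := hε
  have h1 : Integrable (fun y => sharpKernel Ω ε (x - y) * f y) volume :=
    hf.bdd_mul ((hΩ.measurable_sharpKernel ε).comp (by fun_prop)).aestronglyMeasurable
      (.of_forall fun y => norm_sharpKernel_le hC0 hC hε' _)
  have h2 : Integrable (fun y => smoothKernel Ω ε (x - y) * f y) volume :=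
    hf.bdd_mul ((hΩ.contDiff_smoothKernel hε').continuous.comp
      (by fun_prop)).aestronglyMeasurable (.of_forall fun y => hB ε _ hε')
  simp_rw [sub_mul]
  rw [integral_sub h1 h2, sub_add_cancel, truncated_eq_integral_sharpKernel]

/-- Existence of the limit is local: outside a large ball around the origin containing `x`, the
truncated integrals do not depend on small `ε`. -/
theorem IsAngular.ae_pvExists (hΩ : IsAngular Ω) (hn : 1 ≤ n) {f : Rn n → ℂ}
    (hf : LocallyIntegrable f volume)
    (hi : ∀ᵐ x, ∀ ε : ℝ, 0 < ε →
      IntegrableOn (fun y => kernel Ω (x - y) * f y) {y | ε < ‖x - y‖} volume) :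
    ∀ᵐ x, PVExists Ω f x := by
  have hloc : ∀ k : ℕ, Integrable ((Metric.ball (0 : Rn n) k).indicator f) volume := fun k =>
    (integrable_indicator_iff measurableSet_ball).2
      ((hf.integrableOn_isCompact (isCompact_closedBall 0 (k : ℝ))).mono_set
        Metric.ball_subset_closedBall)
  filter_upwards [hi, ae_all_iff.2 fun k => hΩ.ae_exists_tendsto_truncated hn (hloc k)]
    with x hx1 hx2
  refine ⟨hx1, ?_⟩
  obtain ⟨k, hk⟩ := exists_nat_gt ‖x‖
  obtain ⟨v, hv⟩ := hx2 k
  refine ⟨v + ∫ y in (Metric.ball (0 : Rn n) k)ᶜ, kernel Ω (x - y) * f y,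
    (hv.add_const _).congr' ?_⟩
  filter_upwards [Ioo_mem_nhdsGT (sub_pos.2 hk)] with ε hε
  have hm := measurableSet_setOf_lt_norm_sub ε x
  have hsub : (Metric.ball (0 : Rn n) k)ᶜ ⊆ {y | ε < ‖x - y‖} := fun y hy => by
    rw [Set.mem_compl_iff, mem_ball_zero_iff, not_lt] at hy
    rw [Set.mem_ofPred_eq, norm_sub_rev]
    linarith [norm_sub_norm_le y x, hε.2]
  have e : ∀ y, kernel Ω (x - y) * (Metric.ball (0 : Rn n) k).indicator f y =
      (Metric.ball (0 : Rn n) k).indicator (fun y => kernel Ω (x - y) * f y) y := fun y => by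
    by_cases hy : y ∈ Metric.ball (0 : Rn n) k
    · rw [Set.indicator_of_mem hy, Set.indicator_of_mem hy]
    · rw [Set.indicator_of_notMem hy, Set.indicator_of_notMem hy, mul_zero]
  rw [truncated, truncated, ← integral_inter_add_sdiff (s := {y | ε < ‖x - y‖})
    (t := Metric.ball (0 : Rn n) k) measurableSet_ball (hx1 ε hε.1), Set.sdiff_eq,
    Set.inter_eq_right.2 hsub]
  simp_rw [e]
  rw [setIntegral_indicator measurableSet_ball]

/-! ### Boundedness of the commutator for Hölder symbols -/

theorem MemLip.exists_norm_sub_le {α : ℝ} {b : Rn n → ℂ} (h : MemLip α b) (hα : 0 < α) :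
    ∃ g : Rn n → ℂ, b =ᵐ[volume] g ∧ ∃ C : ℝ, 0 ≤ C ∧ ∀ x y, ‖g x - g y‖ ≤ C * ‖x - y‖ ^ α := by
  obtain ⟨g, hg, C, hC⟩ := h
  refine ⟨g, hg, max C 0, le_max_right _ _, fun x y => ?_⟩
  rcases eq_or_ne x y with rfl | hxy
  · simp [hα.ne']
  · have hp : 0 < ‖x - y‖ := norm_pos_iff.2 (sub_ne_zero.2 hxy)
    have := hC y (x - y) (sub_ne_zero.2 hxy)
    rw [add_sub_cancel, div_le_iff₀ (by positivity)] at this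
    exact this.trans (by gcongr; exact le_max_left _ _)

theorem integrable_norm_rpow_mul_of_riesz_lt_top {α : ℝ} {f : Rn n → ℂ}
    (hf : AEStronglyMeasurable f volume) {x : Rn n} (hx : riesz α (fun y => ‖f y‖ₑ) x < ⊤) :
    Integrable (fun y => ‖x - y‖ ^ (α - n) * ‖f y‖) volume := by
  have hm : Measurable fun y : Rn n => ‖x - y‖ ^ (α - n) := by fun_prop
  refine ⟨hm.aestronglyMeasurable.mul hf.norm, ?_⟩
  rw [hasFiniteIntegral_iff_enorm]
  refine lt_of_le_of_lt (lintegral_mono fun y => ?_) hx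
  rw [enorm_mul, enorm_norm, Real.enorm_eq_ofReal (by positivity)]

theorem IsAngular.integrableOn_kernel_mul_of_riesz_lt_top (hΩ : IsAngular Ω) (hn : 1 ≤ n)
    {α : ℝ} (hα : 0 < α) {f : Rn n → ℂ} (hf : AEStronglyMeasurable f volume) {x : Rn n}
    (hx : riesz α (fun y => ‖f y‖ₑ) x < ⊤) {ε : ℝ} (hε : 0 < ε) :
    IntegrableOn (fun y => kernel Ω (x - y) * f y) {y | ε < ‖x - y‖} volume := by
  obtain ⟨C, hC0, hC⟩ := hΩ.exists_norm_kernel_le hn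
  have hm : AEStronglyMeasurable (fun y => kernel Ω (x - y) * f y) volume :=
    (hΩ.measurable_kernel.comp (by fun_prop)).aestronglyMeasurable.mul hf
  refine Integrable.mono' ((integrable_norm_rpow_mul_of_riesz_lt_top hf hx).const_mul
    (C * (ε ^ α)⁻¹)).integrableOn hm.restrict ?_
  refine (ae_restrict_iff' (measurableSet_setOf_lt_norm_sub ε x)).2 (.of_forall fun y hy => ?_)
  have hy' : ε < ‖x - y‖ := hy
  have hp : 0 < ‖x - y‖ := hε.trans hy'
  rw [norm_mul, ← mul_assoc]
  gcongr
  refine (hC _).trans ?_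
  rw [Real.rpow_sub hp, Real.rpow_natCast]
  calc C / ‖x - y‖ ^ n = C * (‖x - y‖ ^ α)⁻¹ * (‖x - y‖ ^ α / ‖x - y‖ ^ n) := by
        field_simp
    _ ≤ _ := by gcongr

/-- Write `g y = g x - (g x - g y)`. The first term reproduces the principal value of `f`, and the
second gives the integrable function `H`, so the principal value of `b f` exists and the commutator
is the absolutely convergent integral of `H`. -/
theorem pvExists_mul_and_enorm_commutator_le (hΩ : IsAngular Ω)
    {C C₀ α : ℝ} (hC0 : 0 ≤ C) (hC : ∀ x, ‖kernel Ω x‖ ≤ C / ‖x‖ ^ n) (hC₀ : 0 ≤ C₀) {b g f : Rn n → ℂ}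
    (hbg : b =ᵐ[volume] g) (hb : AEStronglyMeasurable b volume)
    (hg : ∀ x y, ‖g x - g y‖ ≤ C₀ * ‖x - y‖ ^ α)
    (hf : AEStronglyMeasurable f volume) {x : Rn n} (hbx : b x = g x)
    (hx : riesz α (fun y => ‖f y‖ₑ) x < ⊤) (hpv : PVExists Ω f x) :
    PVExists Ω (fun y => b y * f y) x ∧
      ‖commutator Ω b f x‖ₑ ≤ ENNReal.ofReal (C₀ * C) * riesz α (fun y => ‖f y‖ₑ) x := by
  set H : Rn n → ℂ := fun y => (g x - g y) * (kernel Ω (x - y) * f y) with hH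
  have hHx : H x = 0 := by simp [hH]
  have hHb : ∀ y, ‖H y‖ ≤ C₀ * C * (‖x - y‖ ^ (α - n) * ‖f y‖) := fun y => by
    rcases eq_or_ne x y with rfl | hxy
    · rw [hHx, norm_zero]
      positivity
    · have hp : 0 < ‖x - y‖ := norm_pos_iff.2 (sub_ne_zero.2 hxy)
      rw [hH, norm_mul, norm_mul]
      calc ‖g x - g y‖ * (‖kernel Ω (x - y)‖ * ‖f y‖)
          ≤ C₀ * ‖x - y‖ ^ α * (C / ‖x - y‖ ^ n * ‖f y‖) := by
            gcongr
            exacts [hg x y, hC _]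
        _ = _ := by
            rw [Real.rpow_sub hp, Real.rpow_natCast]
            ring
  have hHm : AEStronglyMeasurable H volume :=
    (aestronglyMeasurable_const.sub (hb.congr hbg)).mul
      ((hΩ.measurable_kernel.comp (by fun_prop)).aestronglyMeasurable.mul hf)
  have hHi : Integrable H volume :=
    Integrable.mono' ((integrable_norm_rpow_mul_of_riesz_lt_top hf hx).const_mul _) hHm
      (.of_forall hHb)
  have hae : (fun y => kernel Ω (x - y) * (b y * f y)) =ᵐ[volume]
      fun y => g x * (kernel Ω (x - y) * f y) - H y := by
    filter_upwards [hbg] with y hy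
    rw [hy, hH]
    ring
  have hi : ∀ ε : ℝ, 0 < ε → IntegrableOn (fun y => g x * (kernel Ω (x - y) * f y))
      {y | ε < ‖x - y‖} volume := fun ε hε => (hpv.1 ε hε).const_mul _
  obtain ⟨v, hv⟩ := hpv.2
  have hHlim : Tendsto (fun ε : ℝ => ∫ y in {y | ε < ‖x - y‖}, H y) (𝓝[>] 0) (𝓝 (∫ y, H y)) := by
    have e : ∀ ε : ℝ, ∫ y in {y | ε < ‖x - y‖}, H y =
        ∫ y, {y | ε < ‖x - y‖}.indicator H y := fun ε =>
      (integral_indicator (measurableSet_setOf_lt_norm_sub ε x)).symm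
    simp_rw [e]
    refine tendsto_integral_filter_of_dominated_convergence (fun y => ‖H y‖)
      (.of_forall fun ε => hHm.indicator (measurableSet_setOf_lt_norm_sub ε x))
      (.of_forall fun ε => .of_forall fun y => norm_indicator_le_norm_self _ _) hHi.norm
      (.of_forall fun y => ?_)
    rcases eq_or_ne x y with rfl | hxy
    · have : ∀ ε : ℝ, {y | ε < ‖x - y‖}.indicator H x = H x := fun ε => by
        rw [Set.indicator_apply, hHx, ite_self]
      simp_rw [this]
      exact tendsto_const_nhds
    · have hp : 0 < ‖x - y‖ := norm_pos_iff.2 (sub_ne_zero.2 hxy)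
      refine tendsto_const_nhds.congr' ?_
      filter_upwards [Ioo_mem_nhdsGT hp] with ε hε
      rw [Set.indicator_of_mem (by exact hε.2)]
  have htr : Tendsto (fun ε => truncated Ω ε (fun y => b y * f y) x) (𝓝[>] 0)
      (𝓝 (g x * v - ∫ y, H y)) := by
    refine ((hv.const_mul (g x)).sub hHlim).congr' ?_
    filter_upwards [self_mem_nhdsWithin] with ε hε
    rw [truncated, truncated, ← integral_const_mul, ← integral_sub (hi ε hε) hHi.integrableOn]
    exact (integral_congr_ae (ae_restrict_of_ae hae)).symm
  refine ⟨⟨fun ε hε => ((hi ε hε).sub hHi.integrableOn).congr (ae_restrict_of_ae hae.symm),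
    _, htr⟩, ?_⟩
  have hc : commutator Ω b f x = ∫ y, H y := by
    rw [commutator, singularIntegral, singularIntegral, hv.limUnder_eq, htr.limUnder_eq, hbx,
      sub_sub_cancel]
  rw [hc]
  refine (enorm_integral_le_lintegral_enorm _).trans ?_
  rw [riesz, ← lintegral_const_mul' _ _ ENNReal.ofReal_ne_top]
  refine lintegral_mono fun y => ?_
  rw [← ofReal_norm, ← ofReal_norm, ← ENNReal.ofReal_mul (by positivity),
    ← ENNReal.ofReal_mul (by positivity)]
  exact ENNReal.ofReal_le_ofReal (hHb y)

theorem IsAngular.aestronglyMeasurable_singularIntegral (hΩ : IsAngular Ω) {f : Rn n → ℂ}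
    (hf : AEStronglyMeasurable f volume) (hpv : ∀ᵐ x, PVExists Ω f x) :
    AEStronglyMeasurable (singularIntegral Ω f) volume := by
  have ht : ∀ ε, AEStronglyMeasurable (truncated Ω ε f) volume := fun ε => by
    have : truncated Ω ε f = fun x => ∫ y, sharpKernel Ω ε (x - y) * f y := by
      funext x
      exact truncated_eq_integral_sharpKernel ε f x
    rw [this]
    refine AEStronglyMeasurable.integral_prod_right'
      (f := fun w : Rn n × Rn n => sharpKernel Ω ε (w.1 - w.2) * f w.2) ?_
    exact ((hΩ.measurable_sharpKernel ε).comp (by fun_prop)).aestronglyMeasurable.mul hf.comp_snd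
  refine aestronglyMeasurable_of_tendsto_ae (𝓝[>] (0 : ℝ)) ht ?_
  filter_upwards [hpv] with x hx
  obtain ⟨v, hv⟩ := hx.2
  rw [singularIntegral, hv.limUnder_eq]
  exact hv

theorem locallyIntegrable_of_morreyNorm_le {p q N : ℝ} (hq : 1 < q) (hqp : q ≤ p)
    (hN : 0 < N) {f : Rn n → ℂ} (hf : AEStronglyMeasurable f volume)
    (h : morreyNorm p q f ≤ ENNReal.ofReal N) : LocallyIntegrable f volume := by
  refine fun x => ⟨Metric.ball x 1, Metric.ball_mem_nhds x one_pos, ?_⟩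
  have hq0 : 0 < q := by linarith
  have hfin := (lintegral_ball_rpow_le_of_morreyNorm_le hq hqp hN h x one_pos).trans_lt
    ENNReal.ofReal_lt_top
  have hmem : MemLp f (ENNReal.ofReal q) (volume.restrict (Metric.ball x 1)) := by
    refine ⟨hf.restrict, ?_⟩
    rw [eLpNorm_lt_top_iff_lintegral_rpow_enorm_lt_top (ENNReal.ofReal_pos.2 hq0).ne'
      ENNReal.ofReal_ne_top, ENNReal.toReal_ofReal hq0.le]
    exact hfin
  have : IsFiniteMeasure (volume.restrict (Metric.ball x 1)) :=
    ⟨by rw [Measure.restrict_apply_univ]; exact measure_ball_lt_top⟩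
  exact hmem.integrable (ENNReal.one_le_ofReal.2 hq.le)

theorem commutatorBounded_of_memLip (hn : 1 ≤ n) (hΩ : IsAngular Ω) {b : Rn n → ℂ}
    (hb : LocallyIntegrable b volume) {α p q s l : ℝ} (hα : 0 < α) (hα1 : α < 1)
    (hq : 1 < q) (hqp : q ≤ p) (hl : 1 < l) (hls : l ≤ s) (hs_eq : 1 / s = 1 / p - α / (n : ℝ))
    (hl_eq : l / s = q / p) (h : MemLip α b) :
    CommutatorBounded Ω b (morreyNorm p q) (morreyNorm s l) := by
  obtain ⟨g, hbg, C₀, hC₀, hg⟩ := h.exists_norm_sub_le hα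
  obtain ⟨C, hC0, hC⟩ := hΩ.exists_norm_kernel_le hn
  obtain ⟨A, hA0, hA⟩ := exists_morreyNorm_le_of_riesz hn hα hα1 hq hqp hl hls hs_eq hl_eq
    (C₀ * C) (by positivity)
  have hbm := hb.aestronglyMeasurable
  refine ⟨A.toNNReal, fun f ⟨hfm, hfN⟩ => ?_⟩
  -- The fractional integral estimate requires a positive `N`, so it is used for all `N` strictly
  -- above the norm, followed by a limit; this covers norm zero too.
  have hle : ∀ N : ℝ, (morreyNorm p q f).toReal < N → morreyNorm p q f ≤ ENNReal.ofReal N :=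
    fun N hN => (ENNReal.le_ofReal_iff_toReal_le hfN.ne
      (ENNReal.toReal_nonneg.trans hN.le)).2 hN.le
  have hN1 : (morreyNorm p q f).toReal < (morreyNorm p q f).toReal + 1 := lt_add_one _
  have hN1' : 0 < (morreyNorm p q f).toReal + 1 := ENNReal.toReal_nonneg.trans_lt hN1
  obtain ⟨hr, -⟩ := hA _ f hN1' hfm (hle _ hN1)
  have hpv : ∀ᵐ x, PVExists Ω f x := by
    refine hΩ.ae_pvExists hn (locallyIntegrable_of_morreyNorm_le hq hqp hN1' hfm (hle _ hN1)) ?_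
    filter_upwards [hr] with x hx ε hε
    exact hΩ.integrableOn_kernel_mul_of_riesz_lt_top hn hα hfm hx hε
  have hkey : ∀ᵐ x, PVExists Ω (fun y => b y * f y) x ∧
      ‖commutator Ω b f x‖ₑ ≤ ENNReal.ofReal (C₀ * C) * riesz α (fun y => ‖f y‖ₑ) x := by
    filter_upwards [hbg, hr, hpv] with x hx1 hx2 hx3
    exact pvExists_mul_and_enorm_commutator_le hΩ hC0 hC hC₀ hbg hbm hg hfm hx1 hx2 hx3
  have hpv2 := hkey.mono fun x hx => hx.1
  have hbound : morreyNorm s l (commutator Ω b f) ≤ (A.toNNReal : ℝ≥0∞) * morreyNorm p q f := by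
    rw [← ENNReal.ofReal, ← ENNReal.ofReal_toReal hfN.ne, ← ENNReal.ofReal_mul hA0.le]
    have hlim : Tendsto (fun N : ℝ => ENNReal.ofReal (A * N)) (𝓝[>] (morreyNorm p q f).toReal)
        (𝓝 (ENNReal.ofReal (A * (morreyNorm p q f).toReal))) :=
      ((ENNReal.continuous_ofReal.comp (continuous_const.mul continuous_id)).tendsto _).mono_left
        nhdsWithin_le_nhds
    refine ge_of_tendsto hlim ?_
    filter_upwards [self_mem_nhdsWithin] with N hN
    exact (hA N f (ENNReal.toReal_nonneg.trans_lt hN) hfm (hle N hN)).2 _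
      (hkey.mono fun x hx => hx.2)
  refine ⟨hpv, hpv2, ⟨?_, hbound.trans_lt (ENNReal.mul_lt_top ENNReal.coe_lt_top hfN)⟩, hbound⟩
  exact (hbm.mul (hΩ.aestronglyMeasurable_singularIntegral hfm hpv)).sub
    (hΩ.aestronglyMeasurable_singularIntegral (hbm.mul hfm) hpv2)

end MorreyCommutator

end

/-! ### The equivalence -/

theorem mainTheorem6 {n : ℕ} (hn : 1 ≤ n)
    (Ω : MorreyCommutator.Rn n → ℂ) (hΩ : MorreyCommutator.IsAngular Ω)
    (hΩ0 : ∃ x : MorreyCommutator.Rn n, x ≠ 0 ∧ Ω x ≠ 0)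
    (b : MorreyCommutator.Rn n → ℂ) (hb : LocallyIntegrable b volume)
    (α p q s t l : ℝ) (hα0 : 0 < α) (hα1 : α < 1)
    (hq : 1 < q) (hqp : q ≤ p)
    (ht : 1 < t) (hts : t ≤ s)
    (hl : 1 < l) (hls : l ≤ s)
    (hs_eq : 1 / s = 1 / p - α / (n : ℝ))
    (ht_eq : 1 / t = 1 / q - α / (n : ℝ))
    (hl_eq : l / s = q / p) :
    List.TFAE
      [ MorreyCommutator.MemLip α b,
        MorreyCommutator.CommutatorBounded Ω b
          (MorreyCommutator.morreyNorm p q) (MorreyCommutator.morreyNorm s l),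
        MorreyCommutator.CommutatorBounded Ω b
          (MorreyCommutator.morreyNorm p q) (MorreyCommutator.morreyNorm s t),
        MorreyCommutator.CommutatorBounded Ω b
          (MorreyCommutator.morreyNorm p q) (MorreyCommutator.weakMorreyNorm s t) ] := by
  -- Here `1/l = (p/q)(1/s) = 1/q - (p/q)(α/n) ≤ 1/q - α/n = 1/t`, because `q ≤ p`.
  have htl : t ≤ l := by
    have hq0 : 0 < q := by linarith
    have hp0 : 0 < p := by linarith
    have hs0 : 0 < s := by linarith
    have hl0 : 0 < l := by linarith
    have hαn : 0 ≤ α / (n : ℝ) := by positivity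
    have h1 : 1 / l = p / q * (1 / s) := by
      rw [div_eq_div_iff hs0.ne' hp0.ne'] at hl_eq
      field_simp
      linarith
    have h2 : p / q * (1 / p) = 1 / q := by field_simp
    have h3 : α / (n : ℝ) ≤ p / q * (α / n) :=
      le_mul_of_one_le_left hαn ((one_le_div hq0).2 hqp)
    refine (one_div_le_one_div hl0 (by linarith)).1 ?_
    rw [h1, hs_eq, ht_eq, mul_sub, h2]
    linarith
  tfae_have 1 → 2 := MorreyCommutator.commutatorBounded_of_memLip hn hΩ hb hα0 hα1 hq hqp hl hls
    hs_eq hl_eq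
  tfae_have 2 → 3 := fun h => h.mono fun F hF =>
    MorreyCommutator.morreyNorm_le_morreyNorm (by linarith) htl hF
  tfae_have 3 → 4 := fun h => h.mono fun F hF =>
    MorreyCommutator.weakMorreyNorm_le_morreyNorm (by linarith) hF
  tfae_have 4 → 1 := fun h => by
    obtain ⟨C, hC0, hC⟩ :=
      MorreyCommutator.exists_oscillation_le hn hΩ hΩ0 hb hq hqp ht hs_eq h
    exact MorreyCommutator.memLip_of_oscillation_le hb hα0 hC0 hC
  tfae_finish
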